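/- \textbf{Notation.} Put $s=\tfrac12+it$, $e(\theta)=e^{2\pi i\theta}$, and let $\chi$ be the factor in $\zeta(s)=\chi(s)\zeta(1-s)$, i.e. $\chi(1-s)=2(2\pi)^{-s}\Gamma(s)\cos\frac{\pi s}{2}$. For a prime $p$ put $z_p(x)=(1-p^{-x})^{-1}$ and $z_{p,\theta}(x)=(1-e(\theta)p^{-x})^{-1}$. For finite families $A,B,C,D$ of complex numbers put $$Z_\zeta(A,B)=\prod_{\alpha\in A,\beta\in B}\zeta(1+\alpha+\beta),\qquad Z^\dagger_\zeta(A,B)=\prod_{\alpha\in A,\beta\in B,\ \alpha+\beta\ne0}\zeta(1+\alpha+\beta),\qquad Z_p(A,B)=\prod_{\alpha\in A,\beta\in B}z_p(1+\alpha+\beta)^{-1},$$ $$Z_\bullet(A,B;C,D)=\frac{Z_\bullet(A,B)Z_\bullet(C,D)}{Z_\bullet(A,D)Z_\bullet(B,C)}\quad(\bullet=\zeta,p;\ 1/\zeta(x)\text{ is read as }0\text{ at }x=1),$$ $$\mathcal A_{p,\theta}(A,B;C,D)=\frac{\prod_{\alpha\in A}z_{p,-\theta}(\frac12+\alpha)\prod_{\beta\in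 B}z_{p,\theta}(\frac12+\beta)}{\prod_{\gamma\in C}z_{p,-\theta}(\frac12+\gamma)\prod_{\delta\in D}z_{p,\theta}(\frac12+\delta)},\qquad \mathcal A_\zeta(A,B;C,D)=\prod_pZ_p(A,B;C,D)\int_0^1\mathcal A_{p,\theta}(A,B;C,D)\,d\theta .$$ For $S\subseteq A$, $T\subseteq B$ write $\overline S=A\setminus S$, $\overline T=B\setminus T$, $S^-=\{-\alpha:\alpha\in S\}$, $T^-=\{-\beta:\beta\in T\}$, let $+$ be disjoint union, and put $X_t(S,T)=\prod_{\hat\alpha\in S}\chi(s+\hat\alpha)\prod_{\hat\beta\in T}\chi(1-s+\hat\beta)$ and $$\mathcal R_{\zeta,t}(A,B;C,D)=\sum_{S\subseteq A,\,T\subseteq B,\,|S|=|T|}X_t(S,T)\,Z_\zeta\mathcal A_\zeta(\overline S+T^-,\overline T+S^-;C,D).$$ \textbf{Ratios Conjecture $RC(\vartheta,\eta)$} ($0\le\vartheta\le1$, $0<\eta\le1$). For all sizes $|A|,|B|,|C|,|D|$ and all $\varepsilon,c,K>0$ there is a constant $C_0$ such that for every $\tau\ge2$, every interval $I\subseteq[-\tau,\tau]$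 with $|I|\ge \tau^{\eta}$ and all finite sets $A,B,C,D$ of those sizes whose elements have imaginary parts at most $K\tau^{\vartheta}$ in absolute value, with $0<\Re\alpha,\Re\beta<\frac14$ and $\frac{c}{\log \tau}\le\Re\gamma,\Re\delta<\frac14$ ($\alpha\in A$, $\beta\in B$, $\gamma\in C$, $\delta\in D$), $$\Big|\int_I\frac{\prod_{\alpha\in A}\zeta(s+\alpha)\prod_{\beta\in B}\zeta(1-s+\beta)}{\prod_{\gamma\in C}\zeta(s+\gamma)\prod_{\delta\in D}\zeta(1-s+\delta)}\,dt-\int_I\mathcal R_{\zeta,t}(A,B;C,D)\,dt\Big|\le C_0|I|^{1/2+\varepsilon}.$$ \textbf{The functions.} For $W\subseteq\overline S+\overline T$ let $$H_{\zeta;S,T}(W)=\begin{cases}\sum_{\hat\alpha\in S}\frac{\zeta'}{\zeta}(1+\alpha-\hat\alpha)-\sum_{\hat\beta\in T}\frac{\zeta'}{\zeta}(1+\alpha+\hat\beta)&W=\{\alpha\}\subseteq\overline S,\\ \sum_{\hat\beta\in T}\frac{\zeta'}{\zeta}(1+\beta-\hat\beta)-\sum_{\hat\alpha\in S}\frac{\zeta'}{\zeta}(1+\beta+\hat\alpha)&W=\{\beta\}\subseteq\overline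 T,\\ \big(\frac{\zeta'}{\zeta}\big)'(1+\alpha+\beta)&W=\{\alpha,\beta\},\ \alpha\in\overline S,\ \beta\in\overline T,\\0&\text{otherwise,}\end{cases}$$ let $H_{p,1;S,T}(W)$ be the same with $z_p$ in place of $\zeta$, and, with $\mathcal A_{p,\theta}(S,T)=\mathcal A_{p,\theta}(T^-,S^-;S,T)$, $$H_{p,2;S,T}(W)=\sum_{W=X_1+\dots+X_J}(-1)^{J-1}(J-1)!\prod_{j=1}^Jc_{S,T}(X_j),$$ $$c_{S,T}(X)=\frac{\int_0^1\mathcal A_{p,\theta}(S,T)\prod_{\alpha\in\overline S\cap X}\frac{z_{p,-\theta}'}{z_{p,-\theta}}(\frac12+\alpha)\prod_{\beta\in\overline T\cap X}\frac{z_{p,\theta}'}{z_{p,\theta}}(\frac12+\beta)\,d\theta}{\int_0^1\mathcal A_{p,\theta}(S,T)\,d\theta},$$ $$\mathcal H_{S,T}(W)=H_{\zeta;S,T}(W)+\sum_p\big(H_{p,2;S,T}(W)-H_{p,1;S,T}(W)\big).$$ For finite families $A,B,U$ put $$J_{\zeta,I}(A;B;U)=\int_I\prod_{\alpha\in A}\frac{\zeta'}{\zeta}(\tfrac12+it+\alpha)\prod_{\beta\in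 B}\frac{\zeta'}{\zeta}(\tfrac12-it+\beta)\prod_{\mu\in U}\Big(-\frac{\chi'}{\chi}(\tfrac12+it+\mu)\Big)dt,$$ $$J^*_{\zeta,t}(A;B;U)=\sum_{\substack{S\subseteq A,\,T\subseteq B\\|S|=|T|}}X_t(S,T)\frac{Z_\zeta(S,T)Z_\zeta(S^-,T^-)}{Z^\dagger_\zeta(S,S^-)Z^\dagger_\zeta(T,T^-)}\mathcal A_\zeta(T^-,S^-;S,T)\sum_{\overline S+\overline T=W_1+\dots+W_R}\ \prod_{r=1}^R\mathcal H_{S,T}(W_r)\ \prod_{\mu\in U}\Big(-\frac{\chi'}{\chi}(\tfrac12+it+\mu)\Big).$$ Sums over decompositions run over set partitions into nonempty disjoint sets. \textbf{Theorem.} Let $0\le\vartheta\le1$, $0<\eta\le1$, and assume the Riemann Hypothesis and $RC(\vartheta,\eta)$. In what follows $A$ and $B$ consist of distinct numbers, and the denominators in $J^*$ do not vanish: $\int_0^1\mathcal A_{p,\theta}(S,T)\,d\theta\ne0$ for all primes $p$ and all $S\subseteq A$, $T\subseteq B$ with $|S|=|T|$ and $\overline S+\overline T\neq\emptyset$. (i)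 If $0<\Re\alpha,\Re\beta<\frac14$ for $\alpha\in A,\beta\in B$ and $|\Re\mu|<\frac14$ for $\mu\in U$, then for all $S,T$ with $|S|=|T|$ the product $\mathcal A_\zeta(T^-,S^-;S,T)$ and, for nonempty $W\subseteq\overline S+\overline T$, the sum over $p$ in $\mathcal H_{S,T}(W)$ converge unconditionally; and the integrand of $J_{\zeta,I}(A;B;U)$ and $t\mapsto J^*_{\zeta,t}(A;B;U)$ are integrable on every bounded interval. (ii) For all $|A|,|B|,|U|$ and $\varepsilon,c,K>0$ there is a constant $C_1$ such that $$\Big|J_{\zeta,I}(A;B;U)-\int_IJ^*_{\zeta,t}(A;B;U)\,dt\Big|\le C_1|I|^{1/2+\varepsilon}$$ for every $\tau\ge2$, every interval $I\subseteq[-\tau,\tau]$ with $|I|\ge \tau^\eta$, and all $A,B,U$ of the given sizes whose elements have imaginary parts at most $K\tau^\vartheta$ in absolute value, with $\frac{c}{\log \tau}\le\Re\alpha,\Re\beta\le\frac14-c$ for $\alpha\in A,\beta\in B$ and $|\Re\mu|<\frac14$ for $\mu\in U$. -/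

import Mathlib

namespace ZetaRatios

variable {ι κ ρ σ : Type} [Fintype ι] [Fintype κ] [Fintype ρ] [Fintype σ]

/-- `e(θ) = exp(2πiθ)`. -/
noncomputable def e (θ : ℝ) : ℂ := Complex.exp (2 * Real.pi * Complex.I * θ)

/-- The local factor `z_p(x) = (1 - p^{-x})⁻¹`. -/
noncomputable def localZeta (p : ℕ) (x : ℂ) : ℂ := (1 - (p : ℂ) ^ (-x))⁻¹

/-- The twisted local factor `z_{p,θ}(x) = (1 - e(θ) p^{-x})⁻¹`. -/
noncomputable def twistedLocalZeta (p : ℕ) (θ : ℝ) (x : ℂ) : ℂ :=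
  (1 - e θ * (p : ℂ) ^ (-x))⁻¹

/-- The factor `χ` of the functional equation `ζ(s) = χ(s) ζ(1-s)`, that is
`χ(1-s) = 2 (2π)^{-s} Γ(s) cos(πs/2)`. -/
noncomputable def chi (s : ℂ) : ℂ :=
  2 * (2 * Real.pi : ℂ) ^ (-(1 - s)) * Complex.Gamma (1 - s) *
    Complex.cos (Real.pi * (1 - s) / 2)

/-- The holomorphic function `1/ζ`, which vanishes at the pole `x = 1` of `ζ`. -/
noncomputable def invZeta (x : ℂ) : ℂ := if x = 1 then 0 else (riemannZeta x)⁻¹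

/-! Finite sets of shifts are given as families `ι → ℂ`; the sum `A + B` of two of them is the
family on the disjoint union of the index types. -/

/-- `Z_ζ(A,B) = ∏_{α ∈ A, β ∈ B} ζ(1+α+β)`. -/
noncomputable def zetaProd (a : ι → ℂ) (b : κ → ℂ) : ℂ :=
  ∏ i, ∏ j, riemannZeta (1 + a i + b j)

/-- `1 / Z_ζ(A,B)`. -/
noncomputable def invZetaProd (a : ι → ℂ) (b : κ → ℂ) : ℂ :=
  ∏ i, ∏ j, invZeta (1 + a i + b j)

/-- `Z_ζ(A,B;C,D) = Z_ζ(A,B) Z_ζ(C,D) / (Z_ζ(A,D) Z_ζ(B,C))`. -/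
noncomputable def zetaRatio (a : ι → ℂ) (b : κ → ℂ) (c : ρ → ℂ) (d : σ → ℂ) : ℂ :=
  zetaProd a b * zetaProd c d * (invZetaProd a d * invZetaProd b c)

/-- `Z_ζ^†(A,B)`: the product `Z_ζ(A,B)` without the factors with `α + β = 0`. -/
noncomputable def zetaProdDagger (a : ι → ℂ) (b : κ → ℂ) : ℂ :=
  ∏ i, ∏ j, if a i + b j = 0 then 1 else riemannZeta (1 + a i + b j)

/-- `Z_p(A,B) = ∏_{α ∈ A, β ∈ B} z_p(1+α+β)⁻¹`. -/
noncomputable def localProd (p : ℕ) (a : ι → ℂ) (b : κ → ℂ) : ℂ :=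
  ∏ i, ∏ j, (localZeta p (1 + a i + b j))⁻¹

/-- `Z_p(A,B;C,D) = Z_p(A,B) Z_p(C,D) / (Z_p(A,D) Z_p(B,C))`. -/
noncomputable def localRatio (p : ℕ) (a : ι → ℂ) (b : κ → ℂ) (c : ρ → ℂ) (d : σ → ℂ) : ℂ :=
  localProd p a b * localProd p c d / (localProd p a d * localProd p b c)

/-- `𝒜_{p,θ}(A,B;C,D)`. -/
noncomputable def localIntegrand (p : ℕ) (θ : ℝ)
    (a : ι → ℂ) (b : κ → ℂ) (c : ρ → ℂ) (d : σ → ℂ) : ℂ :=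
  ((∏ i, twistedLocalZeta p (-θ) (1 / 2 + a i)) * ∏ j, twistedLocalZeta p θ (1 / 2 + b j)) /
    ((∏ k, twistedLocalZeta p (-θ) (1 / 2 + c k)) * ∏ l, twistedLocalZeta p θ (1 / 2 + d l))

/-- The factor at `p` of the Euler product `𝒜_ζ(A,B;C,D)`. -/
noncomputable def arithLocal (p : ℕ)
    (a : ι → ℂ) (b : κ → ℂ) (c : ρ → ℂ) (d : σ → ℂ) : ℂ :=
  localRatio p a b c d * ∫ θ in (0 : ℝ)..1, localIntegrand p θ a b c d

/-- The arithmetic factor `𝒜_ζ(A,B;C,D)`. -/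
noncomputable def arithFactor (a : ι → ℂ) (b : κ → ℂ) (c : ρ → ℂ) (d : σ → ℂ) : ℂ :=
  ∏' p : Nat.Primes, arithLocal p a b c d

/-- `X_t(S,T) = ∏_{α ∈ S} χ(s+α) ∏_{β ∈ T} χ(1-s+β)` with `s = 1/2 + it`. -/
noncomputable def chiFactor (t : ℝ) (α : ι → ℂ) (β : κ → ℂ) (S : Finset ι) (T : Finset κ) : ℂ :=
  (∏ i ∈ S, chi (1 / 2 + Complex.I * t + α i)) * ∏ j ∈ T, chi (1 / 2 - Complex.I * t + β j)

section Swap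

variable [DecidableEq ι] [DecidableEq κ]

/-- `S̄ + T⁻`, where `S̄` is the complement of `S` in `A` and `T⁻ = {-β : β ∈ T}`. -/
def swapped (α : ι → ℂ) (β : κ → ℂ) (S : Finset ι) (T : Finset κ) : ↥Sᶜ ⊕ ↥T → ℂ :=
  Sum.elim (fun i => α i) (fun j => -β j)

/-- `ℛ_{ζ,t}(A,B;C,D)`, the sum over all `S ⊆ A`, `T ⊆ B` with `|S| = |T|` of
`X_t(S,T) Z_ζ 𝒜_ζ (S̄ + T⁻, T̄ + S⁻; C, D)`. -/
noncomputable def ratiosMain (t : ℝ) (α : ι → ℂ) (β : κ → ℂ) (γ : ρ → ℂ) (δ : σ → ℂ) : ℂ :=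
  ∑ S : Finset ι, ∑ T : Finset κ with S.card = T.card,
    chiFactor t α β S T *
      zetaRatio (swapped α β S T) (swapped β α T S) γ δ *
      arithFactor (swapped α β S T) (swapped β α T S) γ δ

end Swap

/-- The ratio of products of zeta functions at `s + α`, `1 - s + β` over `s + γ`, `1 - s + δ`,
`s = 1/2 + it`. -/
noncomputable def ratiosIntegrand (t : ℝ)
    (α : ι → ℂ) (β : κ → ℂ) (γ : ρ → ℂ) (δ : σ → ℂ) : ℂ :=
  ((∏ i, riemannZeta (1 / 2 + Complex.I * t + α i)) *
      ∏ j, riemannZeta (1 / 2 - Complex.I * t + β j)) /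
    ((∏ k, riemannZeta (1 / 2 + Complex.I * t + γ k)) *
      ∏ l, riemannZeta (1 / 2 - Complex.I * t + δ l))

/-- The Ratios Conjecture for shifts with imaginary parts `≪ T^ϑ` and for intervals
`[a,b] ⊆ [-T,T]` of length at least `T^η`, with the error `O((b-a)^{1/2+ε})`. The implied constant
is uniform in `T`, in the interval and in the shifts. Only numerator shifts with positive real part
are considered. -/
def RatiosConjecture (ϑ η : ℝ) : Prop :=
  ∀ k l m n : ℕ, ∀ ε c K : ℝ, 0 < ε → 0 < c → 0 < K → ∃ C : ℝ,
    ∀ T a b : ℝ, 2 ≤ T → -T ≤ a → b ≤ T → T ^ η ≤ b - a →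
    ∀ (α : Fin k → ℂ) (β : Fin l → ℂ) (γ : Fin m → ℂ) (δ : Fin n → ℂ),
      α.Injective → β.Injective → γ.Injective → δ.Injective →
      (∀ i, 0 < (α i).re ∧ (α i).re < 1 / 4 ∧ |(α i).im| ≤ K * T ^ ϑ) →
      (∀ i, 0 < (β i).re ∧ (β i).re < 1 / 4 ∧ |(β i).im| ≤ K * T ^ ϑ) →
      (∀ i, c / Real.log T ≤ (γ i).re ∧ (γ i).re < 1 / 4 ∧ |(γ i).im| ≤ K * T ^ ϑ) →
      (∀ i, c / Real.log T ≤ (δ i).re ∧ (δ i).re < 1 / 4 ∧ |(δ i).im| ≤ K * T ^ ϑ) →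
      ‖(∫ t in a..b, ratiosIntegrand t α β γ δ) - ∫ t in a..b, ratiosMain t α β γ δ‖ ≤
        C * (b - a) ^ (1 / 2 + ε)

/-! In what follows `W` is a subset of the disjoint union of `S̄ ⊆ A` and `T̄ ⊆ B`; `W.toLeft` and
`W.toRight` are its parts in `S̄` and in `T̄`. -/

/-- `H_{ζ;S,T}(W)` for `L = ζ'/ζ`, and `H_{p,1;S,T}(W)` for `L = z_p'/z_p`. -/
noncomputable def pairTerm (L : ℂ → ℂ) (α : ι → ℂ) (β : κ → ℂ) (S : Finset ι) (T : Finset κ)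
    (W : Finset (ι ⊕ κ)) : ℂ :=
  if W.toLeft.card = 1 ∧ W.toRight.card = 0 then
    ∑ i ∈ W.toLeft, ((∑ i' ∈ S, L (1 + α i - α i')) - ∑ j' ∈ T, L (1 + α i + β j'))
  else if W.toLeft.card = 0 ∧ W.toRight.card = 1 then
    ∑ j ∈ W.toRight, ((∑ j' ∈ T, L (1 + β j - β j')) - ∑ i' ∈ S, L (1 + β j + α i'))
  else if W.toLeft.card = 1 ∧ W.toRight.card = 1 then
    ∑ i ∈ W.toLeft, ∑ j ∈ W.toRight, deriv L (1 + α i + β j)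
  else 0

/-- `𝒜_{p,θ}(S,T) = 𝒜_{p,θ}(T⁻,S⁻;S,T)`. -/
noncomputable def localWeight (p : ℕ) (θ : ℝ) (α : ι → ℂ) (β : κ → ℂ)
    (S : Finset ι) (T : Finset κ) : ℂ :=
  localIntegrand p θ (-T.restrict β) (-S.restrict α) (S.restrict α) (T.restrict β)

/-- `c_{S,T}(X)` (at the prime `p`). -/
noncomputable def cumulantMoment (p : ℕ) (α : ι → ℂ) (β : κ → ℂ) (S : Finset ι) (T : Finset κ)
    (X : Finset (ι ⊕ κ)) : ℂ :=
  (∫ θ in (0 : ℝ)..1, localWeight p θ α β S T *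
      (∏ i ∈ X.toLeft, logDeriv (twistedLocalZeta p (-θ)) (1 / 2 + α i)) *
      ∏ j ∈ X.toRight, logDeriv (twistedLocalZeta p θ) (1 / 2 + β j)) /
    ∫ θ in (0 : ℝ)..1, localWeight p θ α β S T

section Partitions

variable [DecidableEq ι] [DecidableEq κ]

/-- `H_{p,2;S,T}(W)`, a sum over all set partitions `W = X_1 + ⋯ + X_J`. -/
noncomputable def cumulantTerm (p : ℕ) (α : ι → ℂ) (β : κ → ℂ) (S : Finset ι) (T : Finset κ)
    (W : Finset (ι ⊕ κ)) : ℂ :=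
  ∑ P : Finpartition W, (-1) ^ (P.parts.card - 1) * ((P.parts.card - 1).factorial : ℂ) *
    ∏ X ∈ P.parts, cumulantMoment p α β S T X

/-- The contribution `H_{p,2;S,T}(W) - H_{p,1;S,T}(W)` of `p` to `ℋ_{S,T}(W)`. -/
noncomputable def primeTerm (p : ℕ) (α : ι → ℂ) (β : κ → ℂ) (S : Finset ι) (T : Finset κ)
    (W : Finset (ι ⊕ κ)) : ℂ :=
  cumulantTerm p α β S T W - pairTerm (logDeriv (localZeta p)) α β S T W

/-- `ℋ_{S,T}(W) = H_{ζ;S,T}(W) + ∑_p (H_{p,2;S,T}(W) - H_{p,1;S,T}(W))`. -/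
noncomputable def calH (α : ι → ℂ) (β : κ → ℂ) (S : Finset ι) (T : Finset κ)
    (W : Finset (ι ⊕ κ)) : ℂ :=
  pairTerm (logDeriv riemannZeta) α β S T W + ∑' p : Nat.Primes, primeTerm p α β S T W

/-- `J*_{ζ,t}(A;B;U)`; the inner sum runs over all set partitions of `S̄ + T̄`. -/
noncomputable def jStar (t : ℝ) (α : ι → ℂ) (β : κ → ℂ) (μ : ρ → ℂ) : ℂ :=
  (∑ S : Finset ι, ∑ T : Finset κ with S.card = T.card,
    chiFactor t α β S T *
      (zetaProd (S.restrict α) (T.restrict β) * zetaProd (-S.restrict α) (-T.restrict β) /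
        (zetaProdDagger (S.restrict α) (-S.restrict α) *
          zetaProdDagger (T.restrict β) (-T.restrict β))) *
      arithFactor (-T.restrict β) (-S.restrict α) (S.restrict α) (T.restrict β) *
      ∑ P : Finpartition (Sᶜ.disjSum Tᶜ), ∏ W ∈ P.parts, calH α β S T W) *
    ∏ k, (-logDeriv chi (1 / 2 + Complex.I * t + μ k))

/-- No denominator that occurs in the formula for `J*_{ζ,t}(A;B;U)` vanishes: for every prime `p`
and all `S ⊆ A`, `T ⊆ B` with `|S| = |T|`, unless `S = A` and `T = B` (when there is no
`c_{S,T}`), the integral `∫₀¹ 𝒜_{p,θ}(S,T) dθ` is nonzero. -/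
def LocalNonvanishing (α : ι → ℂ) (β : κ → ℂ) : Prop :=
  ∀ (p : Nat.Primes) (S : Finset ι) (T : Finset κ), S.card = T.card →
    (Sᶜ.disjSum Tᶜ).Nonempty → (∫ θ in (0 : ℝ)..1, localWeight p θ α β S T) ≠ 0

end Partitions

/-- The integrand of `J_{ζ,I}(A;B;U)`. -/
noncomputable def jIntegrand (t : ℝ) (α : ι → ℂ) (β : κ → ℂ) (μ : ρ → ℂ) : ℂ :=
  (∏ i, logDeriv riemannZeta (1 / 2 + Complex.I * t + α i)) *
    (∏ j, logDeriv riemannZeta (1 / 2 - Complex.I * t + β j)) *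
    ∏ k, (-logDeriv chi (1 / 2 + Complex.I * t + μ k))

end ZetaRatios

/-! Apply the Ratios Conjecture with C = A and D = B, and treat the numerator shifts as independent
variables x near the base point (A, B). Differentiated once in every variable at the base point, the
ratio of zeta functions becomes the product of ζ'/ζ (`jet_ratiosIntegrand`), so for empty U the
prediction J* has to be the same mixed derivative of the main term. The error is then the mixed
derivative of a function that the conjecture bounds on a polydisc of radius about 1/log T, and
Cauchy's estimate costs only (log T)^(|A|+|B|). The main term can have poles where two variables
coincide, and the conjecture is available for distinct shifts only; but each coordinate disc meets
these diagonals in finitely many points, which are removable for the bounded difference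
(`norm_jet_univ_le`).

The derivative of the main term is computed for each S, T separately. The term contains the factors
1/ζ(1+α-x_α), α in S, and their analogues for T. Each has a simple zero at the base point, so all
derivatives in the variables of S+T must fall on them; they contribute (-1)^(|S|+|T|) = 1
(`jet_diagPart`). What remains is a derivative in the variables of the complements, with those of
S+T frozen. The frozen function is a constant times a product of zeta values and an Euler product,
and the set-partition form of J* is the exponential formula: the mixed derivatives of F are F times
a sum over set partitions of products of derivatives of log F (`IsLogOn.eq_partitionSum`).

No logarithm of F is ever chosen. The array of mixed derivatives (the jet) is a function of finite
sets of coordinates, multiplication of functions becomes convolution over subsets by the Leibniz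
rule, and a logarithm is an array κ solving f(w ∪ V) = Σ f(Y) κ(w ∪ (V∖Y)). It is additive under
products (`IsLogOn.mul`) and unique where f(∅) ≠ 0. The zeta values give H_ζ, the same computation
with 1/z_p gives -H_{p,1} (`logHol_variablePart`), and the integral over θ gives the cumulants
H_{p,2} (`logHol_integral_localIntegrand`).

The Euler factors are 1 + O(p^(-1-4δ)) (`exists_bound_arithLocal`), so finite products converge
locally uniformly together with all their derivatives. As the limit does not vanish at the base
point, the logarithms converge too, and this is the convergence of the sum over p in part (i)
(`hasSum_primeTerm`).

Finally the factors -χ'/χ are inserted by partial summation. This needs the estimate on all initial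
segments of the interval, including short ones, which are differences of long ones
(`norm_integral_initial_le`), and the bound O(1/(1+|Im s|)) for the derivative of χ'/χ, obtained
from the digamma function (`norm_deriv_negLogDerivChi_le`). All powers of log T are absorbed by the
spare exponent, because the interval is at least T^η long. -/

set_option linter.unusedSectionVars false

namespace ZetaRatios

section

open Function Set Filter Topology MeasureTheory

/-! ### Holomorphic functions of one variable with a parameter -/

section OneVariable

variable {P : Type*} [TopologicalSpace P]

lemma continuousOn_intervalIntegral {X : Type*} [TopologicalSpace X] {s : Set X} {f : X → ℝ → ℂ}
    (hf : ContinuousOn (uncurry f) (s ×ˢ univ)) (a b : ℝ) :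
    ContinuousOn (fun x => ∫ t in a..b, f x t) s := by
  rw [continuousOn_iff_continuous_domRestrict]
  refine intervalIntegral.continuous_parametric_intervalIntegral_of_continuous'
    (f := fun (x : s) t => f x t) ?_ a b
  exact hf.comp_continuous (f := fun q : s × ℝ => ((q.1 : X), q.2)) (by fun_prop)
    (fun q => ⟨q.1.2, trivial⟩)

/-- Cauchy's formula over a fixed circle turns the derivative into an integral of f over a compact
set, so joint continuity of f alone gives joint continuity of the derivative. -/
lemma continuousOn_deriv_param {U : Set ℂ} (hU : IsOpen U) {f : P → ℂ → ℂ}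
    (hc : ContinuousOn (uncurry f) (univ ×ˢ U)) (hd : ∀ p, DifferentiableOn ℂ (f p) U) :
    ContinuousOn (uncurry fun p z => deriv (f p) z) (univ ×ˢ U) := by
  rintro ⟨p₀, z₀⟩ ⟨-, hz₀⟩
  obtain ⟨R, hR, hRU⟩ := Metric.nhds_basis_closedBall.mem_iff.1 (hU.mem_nhds hz₀)
  have key : ContinuousOn (fun q : P × ℂ => ((2 * Real.pi * Complex.I : ℂ)⁻¹ *
      ∮ w in C(z₀, R), ((w - q.2) ^ 2)⁻¹ • f q.1 w)) (univ ×ˢ Metric.ball z₀ R) := by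
    refine continuousOn_const.mul ?_
    simp only [circleIntegral, smul_eq_mul]
    refine continuousOn_intervalIntegral
      (f := fun (q : P × ℂ) θ => deriv (circleMap z₀ R) θ *
        (((circleMap z₀ R θ - q.2) ^ 2)⁻¹ * f q.1 (circleMap z₀ R θ))) ?_ _ _
    have h1 : ContinuousOn (fun q : (P × ℂ) × ℝ => f q.1.1 (circleMap z₀ R q.2))
        ((univ ×ˢ Metric.ball z₀ R) ×ˢ univ) := by
      refine hc.comp (f := fun q : (P × ℂ) × ℝ => (q.1.1, circleMap z₀ R q.2))
        (by fun_prop) ?_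
      rintro ⟨⟨p, z⟩, θ⟩ -
      exact ⟨trivial, hRU (circleMap_mem_closedBall _ hR.le _)⟩
    have h2 : ContinuousOn (fun q : (P × ℂ) × ℝ => ((circleMap z₀ R q.2 - q.1.2) ^ 2)⁻¹)
        ((univ ×ˢ Metric.ball z₀ R) ×ˢ univ) := by
      refine ContinuousOn.inv₀ (by fun_prop) ?_
      rintro ⟨⟨p, z⟩, θ⟩ ⟨⟨-, hz⟩, -⟩
      refine pow_ne_zero 2 (sub_ne_zero.2 ?_)
      rintro h
      have : circleMap z₀ R θ ∈ Metric.sphere z₀ R := circleMap_mem_sphere _ hR.le _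
      simp only at h
      rw [h, Metric.mem_sphere] at this
      simp only [Metric.mem_ball] at hz
      linarith
    have h3 : Continuous (fun q : (P × ℂ) × ℝ => deriv (circleMap z₀ R) q.2) := by
      simp only [deriv_circleMap]; fun_prop
    exact h3.continuousOn.mul (h2.mul h1)
  have hmem : univ ×ˢ Metric.ball z₀ R ∈ 𝓝 (p₀, z₀) :=
    (isOpen_univ.prod Metric.isOpen_ball).mem_nhds ⟨trivial, Metric.mem_ball_self hR⟩
  refine ContinuousAt.continuousWithinAt ((key.continuousAt hmem).congr ?_)
  filter_upwards [hmem] with q hq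
  exact Complex.two_pi_I_inv_smul_circleIntegral_sub_sq_inv_smul_of_differentiable hU hRU
    (hd q.1) hq.2

/-- The dominating function is a constant: the derivative is jointly continuous by
`continuousOn_deriv_param`, hence bounded on the compact product of the interval with a closed disc.
-/
lemma hasDerivAt_intervalIntegral_param {U : Set ℂ} (hU : IsOpen U) {f : ℝ → ℂ → ℂ}
    (hc : ContinuousOn (uncurry f) (univ ×ˢ U)) (hd : ∀ t, DifferentiableOn ℂ (f t) U)
    {z₀ : ℂ} (hz₀ : z₀ ∈ U) (a b : ℝ) :
    HasDerivAt (fun z => ∫ t in a..b, f t z) (∫ t in a..b, deriv (f t) z₀) z₀ := by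
  obtain ⟨R, hR, hRU⟩ := Metric.nhds_basis_closedBall.mem_iff.1 (hU.mem_nhds hz₀)
  have hc' := continuousOn_deriv_param hU hc hd
  have hcomp : IsCompact (uIcc a b ×ˢ Metric.closedBall z₀ R) :=
    isCompact_uIcc.prod (isCompact_closedBall _ _)
  obtain ⟨M, hM⟩ := hcomp.exists_bound_of_continuousOn
    (hc'.mono (prod_mono (subset_univ _) hRU))
  have hslice : ∀ z ∈ U, Continuous fun t => f t z := fun z hz =>
    hc.comp_continuous (f := fun t => (t, z)) (by fun_prop) fun _ => ⟨trivial, hz⟩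
  have hslice' : ∀ z ∈ U, Continuous fun t => deriv (f t) z := fun z hz =>
    hc'.comp_continuous (f := fun t => (t, z)) (by fun_prop) fun _ => ⟨trivial, hz⟩
  refine (intervalIntegral.hasDerivAt_integral_of_dominated_loc_of_deriv_le
    (F := fun z t => f t z) (F' := fun z t => deriv (f t) z) (bound := fun _ => M)
    (Metric.ball_mem_nhds z₀ hR) ?_ ?_ ?_ ?_ ?_ ?_).2
  · filter_upwards [hU.mem_nhds hz₀] with z hz
    exact (hslice z hz).aestronglyMeasurable
  · exact (hslice z₀ hz₀).intervalIntegrable _ _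
  · exact (hslice' z₀ hz₀).aestronglyMeasurable
  · refine Eventually.of_forall fun t ht z hz => ?_
    exact hM (t, z) ⟨uIoc_subset_uIcc ht, Metric.ball_subset_closedBall hz⟩
  · exact intervalIntegrable_const
  · refine Eventually.of_forall fun t _ z hz => ?_
    exact ((hd t).differentiableAt
      (hU.mem_nhds (hRU (Metric.ball_subset_closedBall hz)))).hasDerivAt

end OneVariable

/-! ### Separately holomorphic, jointly continuous functions of several variables -/

section SeveralVariables

variable {P : Type*} [TopologicalSpace P] {ν : Type*} [Fintype ν] [DecidableEq ν]

/-- The partial derivative in the coordinate `i`. -/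
noncomputable def partialDeriv (i : ν) (F : (ν → ℂ) → ℂ) (x : ν → ℂ) : ℂ :=
  deriv (fun z => F (update x i z)) (x i)

/-- A family of functions on `Ω` is jointly continuous and each member is holomorphic in each
variable. -/
structure SepHol (Ω : Set (ν → ℂ)) (K : P → (ν → ℂ) → ℂ) : Prop where
  cont : ContinuousOn (uncurry K) (univ ×ˢ Ω)
  diff : ∀ p, ∀ x ∈ Ω, ∀ i, DifferentiableAt ℂ (fun z => K p (update x i z)) (x i)

/-- The slice of a set in a coordinate direction. -/
def slice (Ω : Set (ν → ℂ)) (x : ν → ℂ) (i : ν) : Set ℂ := {z | update x i z ∈ Ω}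

lemma continuous_update_right (x : ν → ℂ) (i : ν) : Continuous fun z : ℂ => update x i z :=
  continuous_const.update i continuous_id

lemma isOpen_slice {Ω : Set (ν → ℂ)} (hΩ : IsOpen Ω) (x : ν → ℂ) (i : ν) :
    IsOpen (slice Ω x i) := hΩ.preimage (continuous_update_right x i)

lemma mem_slice_self {Ω : Set (ν → ℂ)} {x : ν → ℂ} (hx : x ∈ Ω) (i : ν) : x i ∈ slice Ω x i := by
  simpa [slice] using hx

variable {Ω : Set (ν → ℂ)}

lemma SepHol.differentiableOn_slice {K : P → (ν → ℂ) → ℂ} (hK : SepHol Ω K) (p : P) (x : ν → ℂ)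
    (i : ν) : DifferentiableOn ℂ (fun z => K p (update x i z)) (slice Ω x i) := by
  intro z hz
  have := hK.diff p (update x i z) hz i
  simp only [update_idem, update_self] at this
  exact this.differentiableWithinAt

lemma SepHol.mono {Ω' : Set (ν → ℂ)} {K : P → (ν → ℂ) → ℂ} (hK : SepHol Ω K) (h : Ω' ⊆ Ω) :
    SepHol Ω' K :=
  ⟨hK.cont.mono (prod_mono subset_rfl h), fun p x hx => hK.diff p x (h hx)⟩

lemma SepHol.congr (hΩ : IsOpen Ω) {K L : P → (ν → ℂ) → ℂ} (hK : SepHol Ω K)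
    (h : ∀ p, ∀ x ∈ Ω, L p x = K p x) : SepHol Ω L := by
  refine ⟨hK.cont.congr fun q hq => h q.1 q.2 hq.2, fun p x hx i => ?_⟩
  refine (hK.diff p x hx i).congr_of_eventuallyEq ?_
  filter_upwards [(isOpen_slice hΩ x i).mem_nhds (mem_slice_self hx i)] with z hz
  exact h p _ hz

lemma SepHol.mul {K L : P → (ν → ℂ) → ℂ} (hK : SepHol Ω K) (hL : SepHol Ω L) :
    SepHol Ω (fun p x => K p x * L p x) :=
  ⟨hK.cont.mul hL.cont, fun p x hx i => (hK.diff p x hx i).mul (hL.diff p x hx i)⟩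

lemma SepHol.add {K L : P → (ν → ℂ) → ℂ} (hK : SepHol Ω K) (hL : SepHol Ω L) :
    SepHol Ω (fun p x => K p x + L p x) :=
  ⟨hK.cont.add hL.cont, fun p x hx i => (hK.diff p x hx i).add (hL.diff p x hx i)⟩

lemma SepHol.sub {K L : P → (ν → ℂ) → ℂ} (hK : SepHol Ω K) (hL : SepHol Ω L) :
    SepHol Ω (fun p x => K p x - L p x) :=
  ⟨hK.cont.sub hL.cont, fun p x hx i => (hK.diff p x hx i).sub (hL.diff p x hx i)⟩

lemma SepHol.finset_prod {τ : Type*} {s : Finset τ} {K : τ → P → (ν → ℂ) → ℂ}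
    (hK : ∀ k ∈ s, SepHol Ω (K k)) : SepHol Ω (fun p x => ∏ k ∈ s, K k p x) := by
  refine ⟨continuousOn_finsetProd _ fun k hk => (hK k hk).cont, fun p x hx i => ?_⟩
  exact DifferentiableAt.fun_finsetProd fun k hk => (hK k hk).diff p x hx i

lemma SepHol.finset_sum {τ : Type*} {s : Finset τ} {K : τ → P → (ν → ℂ) → ℂ}
    (hK : ∀ k ∈ s, SepHol Ω (K k)) : SepHol Ω (fun p x => ∑ k ∈ s, K k p x) := by
  refine ⟨continuousOn_finsetSum _ fun k hk => (hK k hk).cont, fun p x hx i => ?_⟩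
  exact DifferentiableAt.fun_sum fun k hk => (hK k hk).diff p x hx i

lemma SepHol.const (Ω : Set (ν → ℂ)) {c : P → ℂ} (hc : Continuous c) :
    SepHol Ω (fun p _ => c p) :=
  ⟨(hc.comp continuous_fst).continuousOn, fun _ _ _ _ => differentiableAt_const _⟩

lemma SepHol.comp_param {Q : Type*} [TopologicalSpace Q] {K : P → (ν → ℂ) → ℂ} (hK : SepHol Ω K)
    {g : Q → P} (hg : Continuous g) : SepHol Ω (fun q => K (g q)) :=
  ⟨hK.cont.comp (f := fun q : Q × (ν → ℂ) => (g q.1, q.2)) (by fun_prop)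
    (fun q hq => ⟨trivial, hq.2⟩), fun q => hK.diff (g q)⟩

lemma SepHol.continuousOn {K : P → (ν → ℂ) → ℂ} (hK : SepHol Ω K) (p : P) :
    ContinuousOn (K p) Ω :=
  hK.cont.comp (f := fun x => (p, x)) (by fun_prop) (fun _ hx => ⟨trivial, hx⟩)

lemma SepHol.continuous_param {K : P → (ν → ℂ) → ℂ} (hK : SepHol Ω K) {x : ν → ℂ} (hx : x ∈ Ω) :
    Continuous fun p => K p x :=
  hK.cont.comp_continuous (f := fun p => (p, x)) (by fun_prop) (fun _ => ⟨trivial, hx⟩)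

lemma hasDerivAt_integral_update (hΩ : IsOpen Ω) {K : ℝ → (ν → ℂ) → ℂ} (hK : SepHol Ω K)
    (a b : ℝ) {x : ν → ℂ} (hx : x ∈ Ω) (i : ν) :
    HasDerivAt (fun z => ∫ t in a..b, K t (update x i z))
      (∫ t in a..b, partialDeriv i (K t) x) (x i) := by
  refine hasDerivAt_intervalIntegral_param (f := fun t z => K t (update x i z))
    (isOpen_slice hΩ x i) ?_ (fun t => hK.differentiableOn_slice t x i) (mem_slice_self hx i) a b
  exact hK.cont.comp (f := fun q : ℝ × ℂ => (q.1, update x i q.2))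
    ((continuous_fst).prodMk ((continuous_update_right x i).comp continuous_snd)).continuousOn
    (fun q hq => ⟨trivial, hq.2⟩)

lemma SepHol.integral (hΩ : IsOpen Ω) {K : P × ℝ → (ν → ℂ) → ℂ} (hK : SepHol Ω K) (a b : ℝ) :
    SepHol Ω (fun p x => ∫ t in a..b, K (p, t) x) := by
  constructor
  · refine continuousOn_intervalIntegral (f := fun (q : P × (ν → ℂ)) t => K (q.1, t) q.2) ?_ a b
    exact hK.cont.comp (f := fun q : (P × (ν → ℂ)) × ℝ => ((q.1.1, q.2), q.1.2)) (by fun_prop)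
      (fun q hq => ⟨trivial, hq.1.2⟩)
  · intro p x hx i
    exact (hasDerivAt_integral_update hΩ
      (hK.comp_param (g := fun t => (p, t)) (by fun_prop)) a b hx i).differentiableAt

lemma partialDeriv_integral (hΩ : IsOpen Ω) {K : ℝ → (ν → ℂ) → ℂ} (hK : SepHol Ω K)
    (a b : ℝ) {x : ν → ℂ} (hx : x ∈ Ω) (i : ν) :
    partialDeriv i (fun x => ∫ t in a..b, K t x) x = ∫ t in a..b, partialDeriv i (K t) x :=
  (hasDerivAt_integral_update hΩ hK a b hx i).deriv

lemma partialDeriv_congr (hΩ : IsOpen Ω) {F G : (ν → ℂ) → ℂ} (h : ∀ x ∈ Ω, F x = G x)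
    {x : ν → ℂ} (hx : x ∈ Ω) (i : ν) : partialDeriv i F x = partialDeriv i G x := by
  refine Filter.EventuallyEq.deriv_eq ?_
  filter_upwards [(isOpen_slice hΩ x i).mem_nhds (mem_slice_self hx i)] with z hz
  exact h _ hz

lemma sepHol_of_nhds {K : P → (ν → ℂ) → ℂ}
    (h : ∀ x ∈ Ω, ∃ Ω' : Set (ν → ℂ), IsOpen Ω' ∧ x ∈ Ω' ∧ SepHol Ω' K) : SepHol Ω K := by
  constructor
  · rintro ⟨p, x⟩ ⟨-, hx⟩
    obtain ⟨Ω', ho, hx', hK⟩ := h x hx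
    exact (hK.cont.continuousAt ((isOpen_univ.prod ho).mem_nhds ⟨trivial, hx'⟩)).continuousWithinAt
  · intro p x hx i
    obtain ⟨Ω', ho, hx', hK⟩ := h x hx
    exact hK.diff p x hx' i

lemma update_mem_ball_pi {x₀ x : ν → ℂ} {r : ℝ} (hx : x ∈ Metric.ball x₀ r) {i : ν} {z : ℂ}
    (hz : z ∈ Metric.ball (x₀ i) r) : update x i z ∈ Metric.ball x₀ r := by
  have hr : 0 < r := dist_nonneg.trans_lt hx
  rw [Metric.mem_ball, dist_pi_lt_iff hr] at hx ⊢
  intro j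
  rcases eq_or_ne j i with rfl | hj
  · simpa using hz
  · simpa [hj] using hx j

/-- Cauchy's formula for the partial derivative. -/
lemma partialDeriv_eq_circleIntegral {K : P → (ν → ℂ) → ℂ} {x₀ : ν → ℂ}
    {r R : ℝ} (hrR : r < R) (hK : SepHol (Metric.ball x₀ R) K) (p : P)
    {x : ν → ℂ} (hx : x ∈ Metric.ball x₀ r) (i : ν) :
    partialDeriv i (K p) x = (2 * Real.pi * Complex.I : ℂ)⁻¹ •
      ∮ w in C(x₀ i, r), ((w - x i) ^ 2)⁻¹ • K p (update x i w) := by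
  have hr : 0 < r := dist_nonneg.trans_lt hx
  refine (Complex.two_pi_I_inv_smul_circleIntegral_sub_sq_inv_smul_of_differentiable
    (isOpen_slice Metric.isOpen_ball x i) ?_ (hK.differentiableOn_slice p x i) ?_).symm
  · intro z hz
    exact update_mem_ball_pi (Metric.ball_subset_ball hrR.le hx)
      (Metric.closedBall_subset_ball hrR hz)
  · exact (dist_pi_lt_iff hr).1 hx i

/-- Near a point, Cauchy's formula writes the partial derivative as an integral over an angle. The
integrand belongs to the class with the angle as a further parameter, and the class is closed under
such integrals, so partial derivatives may be iterated in any variables. -/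
lemma SepHol.partialDeriv (hΩ : IsOpen Ω) {K : P → (ν → ℂ) → ℂ} (hK : SepHol Ω K) (i : ν) :
    SepHol Ω (fun p => partialDeriv i (K p)) := by
  refine sepHol_of_nhds fun x₀ hx₀ => ?_
  obtain ⟨R, hR, hRΩ⟩ := Metric.isOpen_iff.1 hΩ x₀ hx₀
  have hrR : R / 2 < R := by linarith
  have hr : 0 < R / 2 := by linarith
  set r := R / 2
  have hK' := hK.mono hRΩ
  refine ⟨Metric.ball x₀ r, Metric.isOpen_ball, Metric.mem_ball_self hr, ?_⟩
  have hker : SepHol (Metric.ball x₀ r) (fun (q : P × ℝ) x => deriv (circleMap (x₀ i) r) q.2 •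
      (((circleMap (x₀ i) r q.2 - x i) ^ 2)⁻¹ • K q.1 (update x i (circleMap (x₀ i) r q.2)))) := by
    have hne : ∀ θ, ∀ x ∈ Metric.ball x₀ r, circleMap (x₀ i) r θ - x i ≠ 0 := by
      intro θ x hx h
      have h1 : circleMap (x₀ i) r θ ∈ Metric.sphere (x₀ i) r := circleMap_mem_sphere _ hr.le _
      have h2 := (dist_pi_lt_iff hr).1 hx i
      rw [sub_eq_zero.1 h, Metric.mem_sphere] at h1
      linarith
    have hup : ∀ θ, ∀ x ∈ Metric.ball x₀ r,
        update x i (circleMap (x₀ i) r θ) ∈ Metric.ball x₀ R := fun θ x hx =>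
      update_mem_ball_pi (Metric.ball_subset_ball hrR.le hx)
        (Metric.closedBall_subset_ball hrR (circleMap_mem_closedBall _ hr.le _))
    constructor
    · simp only [smul_eq_mul]
      refine ContinuousOn.mul ?_ (ContinuousOn.mul (ContinuousOn.inv₀ ?_ ?_) ?_)
      · simp only [deriv_circleMap]; fun_prop
      · fun_prop
      · exact fun q hq => pow_ne_zero 2 (hne _ _ hq.2)
      · refine hK'.cont.comp
          (f := fun q : (P × ℝ) × (ν → ℂ) => (q.1.1, update q.2 i (circleMap (x₀ i) r q.1.2)))
          ?_ (fun q hq => ⟨trivial, hup _ _ hq.2⟩)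
        refine Continuous.continuousOn ?_
        refine (continuous_fst.comp continuous_fst).prodMk (continuous_snd.update i ?_)
        fun_prop
    · rintro ⟨p, θ⟩ x hx j
      simp only [smul_eq_mul]
      refine DifferentiableAt.const_mul (DifferentiableAt.fun_mul ?_ ?_) _
      · refine DifferentiableAt.inv ?_ ?_
        · refine DifferentiableAt.pow (DifferentiableAt.const_sub ?_ _) _
          exact differentiableAt_pi.1 (hasDerivAt_update x j (x j)).differentiableAt i
        · simpa using hne θ x hx
      -- For j = i the variable x_i survives only in the Cauchy kernel: the circle point overwrites
      -- it in K.
      · rcases eq_or_ne j i with rfl | hj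
        · simp only [update_idem]; exact differentiableAt_const _
        · have := hK'.diff p _ (hup θ x hx) j
          rw [update_of_ne hj] at this
          simp_rw [update_comm hj]
          exact this
  refine ((hker.integral Metric.isOpen_ball 0 (2 * Real.pi)).mul
    (SepHol.const _ (continuous_const (y := (2 * Real.pi * Complex.I : ℂ)⁻¹)))).congr
      Metric.isOpen_ball ?_
  intro p x hx
  rw [partialDeriv_eq_circleIntegral hrR hK' p hx i, smul_eq_mul, mul_comm]
  rfl

/-- A single function is viewed as a family over a point. -/
abbrev Hol (Ω : Set (ν → ℂ)) (F : (ν → ℂ) → ℂ) : Prop := SepHol Ω (fun _ : Unit => F)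

lemma SepHol.hol {K : P → (ν → ℂ) → ℂ} (hK : SepHol Ω K) (p : P) : Hol Ω (K p) :=
  hK.comp_param (g := fun _ => p) continuous_const

lemma Hol.param {F : (ν → ℂ) → ℂ} (hF : Hol Ω F) : SepHol Ω (fun _ : P => F) :=
  hF.comp_param (g := fun _ => ()) continuous_const

lemma Hol.continuousOn {F : (ν → ℂ) → ℂ} (hF : Hol Ω F) : ContinuousOn F Ω :=
  SepHol.continuousOn hF ()

lemma hol_of_differentiableAt {F : (ν → ℂ) → ℂ} (h : ∀ x ∈ Ω, DifferentiableAt ℂ F x) :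
    Hol Ω F := by
  refine ⟨?_, fun p x hx i => ?_⟩
  · intro q hq
    exact ((h q.2 hq.2).continuousAt.comp continuousAt_snd).continuousWithinAt
  · refine DifferentiableAt.comp (x i) (g := F) (f := fun z => update x i z) ?_
      (hasDerivAt_update x i (x i)).differentiableAt
    simpa using h x hx

lemma norm_partialDeriv_le {F : (ν → ℂ) → ℂ} {x : ν → ℂ} {r M : ℝ} (hr : 0 < r)
    (hF : Hol Ω F) (hsub : Metric.closedBall x r ⊆ Ω)
    (hM : ∀ y ∈ Metric.closedBall x r, ‖F y‖ ≤ M) (i : ν) : ‖partialDeriv i F x‖ ≤ M / r := by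
  have hup : ∀ z ∈ Metric.closedBall (x i) r, update x i z ∈ Metric.closedBall x r := by
    intro z hz
    rw [Metric.mem_closedBall, dist_pi_le_iff hr.le]
    intro j
    rcases eq_or_ne j i with rfl | hj
    · simpa using hz
    · simpa [hj] using hr.le
  refine Complex.norm_deriv_le_of_forall_mem_sphere_norm_le hr ?_
    fun z hz => hM _ (hup z (Metric.sphere_subset_closedBall hz))
  have : DifferentiableOn ℂ (fun z => F (update x i z)) (Metric.closedBall (x i) r) :=
    (hF.differentiableOn_slice () x i).mono fun z hz => hsub (hup z hz)
  exact DifferentiableOn.diffContOnCl_ball (U := Metric.closedBall (x i) r) this subset_rfl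

/-- Weierstrass' theorem on every coordinate slice; continuity of the limit is that of a locally
uniform limit. -/
lemma hol_of_tendstoLocallyUniformlyOn {τ : Type*} {l : Filter τ} [l.NeBot] (hΩ : IsOpen Ω)
    {F : τ → (ν → ℂ) → ℂ} {G : (ν → ℂ) → ℂ} (hF : ∀ᶠ s in l, Hol Ω (F s))
    (h : TendstoLocallyUniformlyOn F G l Ω) : Hol Ω G := by
  refine ⟨?_, fun _ x hx i => ?_⟩
  · have : ContinuousOn G Ω := h.continuousOn (hF.frequently.mono fun s hs => hs.continuousOn)
    exact this.comp (f := fun q : Unit × (ν → ℂ) => q.2) continuousOn_snd fun q hq => hq.2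
  · have h1 : TendstoLocallyUniformlyOn (fun s z => F s (update x i z))
        (fun z => G (update x i z)) l (slice Ω x i) :=
      h.comp (fun z => update x i z) (fun z hz => hz) (continuous_update_right x i).continuousOn
    exact (h1.differentiableOn (hF.mono fun s hs => hs.differentiableOn_slice () x i)
      (isOpen_slice hΩ x i)).differentiableAt
      ((isOpen_slice hΩ x i).mem_nhds (mem_slice_self hx i))

lemma tendstoLocallyUniformlyOn_partialDeriv {τ : Type*} {l : Filter τ} [l.NeBot]
    (hΩ : IsOpen Ω) {F : τ → (ν → ℂ) → ℂ} {G : (ν → ℂ) → ℂ} (hF : ∀ᶠ s in l, Hol Ω (F s))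
    (h : TendstoLocallyUniformlyOn F G l Ω) (i : ν) :
    TendstoLocallyUniformlyOn (fun s => partialDeriv i (F s)) (partialDeriv i G) l Ω := by
  have hG := hol_of_tendstoLocallyUniformlyOn hΩ hF h
  refine tendstoLocallyUniformlyOn_of_forall_exists_nhds ?_
  intro x hx
  obtain ⟨R, hR, hRΩ⟩ := Metric.nhds_basis_closedBall.mem_iff.1 (hΩ.mem_nhds hx)
  refine ⟨Metric.closedBall x (R / 2),
    mem_nhdsWithin_of_mem_nhds (Metric.closedBall_mem_nhds x (by linarith)), ?_⟩
  have hu : TendstoUniformlyOn F G l (Metric.closedBall x R) :=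
    (tendstoLocallyUniformlyOn_iff_forall_isCompact hΩ).1 h _ hRΩ (isCompact_closedBall _ _)
  rw [Metric.tendstoUniformlyOn_iff] at hu ⊢
  intro ε hε
  -- Cauchy's estimate on discs of radius R/2 divides the tolerance by R/2, which leaves ε/2.
  filter_upwards [hu (ε / 2 * (R / 2)) (by positivity), hF] with s hs hFs y hy
  have hsub : Metric.closedBall y (R / 2) ⊆ Metric.closedBall x R := by
    intro z hz
    rw [Metric.mem_closedBall] at *
    linarith [dist_triangle z y x]
  have hyΩ : y ∈ Ω := hRΩ (hsub (Metric.mem_closedBall_self (by linarith)))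
  have hd : partialDeriv i (fun x => G x - F s x) y = partialDeriv i G y - partialDeriv i (F s) y :=
    deriv_fun_sub (hG.diff () y hyΩ i) (hFs.diff () y hyΩ i)
  rw [dist_eq_norm, ← hd]
  have := norm_partialDeriv_le (M := ε / 2 * (R / 2)) (by linarith : 0 < R / 2) (hG.sub hFs)
    (hsub.trans hRΩ) (fun z hz => by
      have := hs z (hsub hz); rw [dist_eq_norm] at this; exact this.le) i
  rw [mul_div_cancel_right₀ _ (by linarith)] at this
  linarith

end SeveralVariables

/-! ### Arrays of mixed derivatives -/

section Jets

variable {P : Type*} [TopologicalSpace P] {ν : Type*} [Fintype ν] [DecidableEq ν]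
  {Ω : Set (ν → ℂ)}

/-- The iterated partial derivative in those coordinates of the list `l` that belong to `X`. -/
noncomputable def iterDeriv (l : List ν) (X : Finset ν) (F : (ν → ℂ) → ℂ) : (ν → ℂ) → ℂ :=
  l.foldr (fun i G => if i ∈ X then partialDeriv i G else G) F

@[simp] lemma iterDeriv_nil (X : Finset ν) (F : (ν → ℂ) → ℂ) : iterDeriv [] X F = F := rfl

lemma iterDeriv_cons_mem {i : ν} {l : List ν} {X : Finset ν} (hi : i ∈ X) (F : (ν → ℂ) → ℂ) :
    iterDeriv (i :: l) X F = partialDeriv i (iterDeriv l X F) := by simp [iterDeriv, hi]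

lemma iterDeriv_cons_notMem {i : ν} {l : List ν} {X : Finset ν} (hi : i ∉ X) (F : (ν → ℂ) → ℂ) :
    iterDeriv (i :: l) X F = iterDeriv l X F := by simp [iterDeriv, hi]

/-- The order of differentiation is that of the list and never changes, so only membership in X
matters and no symmetry of mixed derivatives is needed. -/
lemma iterDeriv_congr_set {l : List ν} {X Y : Finset ν} (h : ∀ i ∈ l, i ∈ X ↔ i ∈ Y)
    (F : (ν → ℂ) → ℂ) : iterDeriv l X F = iterDeriv l Y F := by
  induction l with
  | nil => rfl
  | cons a l ih =>
    have ih := ih fun i hi => h i (List.mem_cons_of_mem _ hi)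
    have ha := h a List.mem_cons_self
    by_cases hX : a ∈ X
    · rw [iterDeriv_cons_mem hX, iterDeriv_cons_mem (ha.1 hX), ih]
    · rw [iterDeriv_cons_notMem hX, iterDeriv_cons_notMem (fun h => hX (ha.2 h)), ih]

lemma SepHol.iterDeriv (hΩ : IsOpen Ω) {K : P → (ν → ℂ) → ℂ} (hK : SepHol Ω K) (l : List ν)
    (X : Finset ν) : SepHol Ω (fun p => iterDeriv l X (K p)) := by
  induction l with
  | nil => exact hK
  | cons a l ih =>
    by_cases hX : a ∈ X
    · simp only [iterDeriv_cons_mem hX]; exact ih.partialDeriv hΩ a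
    · simp only [iterDeriv_cons_notMem hX]; exact ih

lemma iterDeriv_congr (hΩ : IsOpen Ω) {F G : (ν → ℂ) → ℂ} (h : ∀ x ∈ Ω, F x = G x) (l : List ν)
    (X : Finset ν) : ∀ x ∈ Ω, iterDeriv l X F x = iterDeriv l X G x := by
  induction l with
  | nil => exact h
  | cons a l ih =>
    intro x hx
    by_cases hX : a ∈ X
    · simp only [iterDeriv_cons_mem hX]; exact partialDeriv_congr hΩ ih hx a
    · simp only [iterDeriv_cons_notMem hX]; exact ih x hx

lemma iterDeriv_sub (hΩ : IsOpen Ω) {F G : (ν → ℂ) → ℂ} (hF : Hol Ω F) (hG : Hol Ω G)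
    (l : List ν) (X : Finset ν) : ∀ x ∈ Ω,
      iterDeriv l X (fun x => F x - G x) x = iterDeriv l X F x - iterDeriv l X G x := by
  induction l with
  | nil => exact fun x _ => rfl
  | cons a l ih =>
    intro x hx
    by_cases hX : a ∈ X
    · simp only [iterDeriv_cons_mem hX]
      rw [partialDeriv_congr hΩ ih hx a]
      exact deriv_fun_sub ((hF.iterDeriv hΩ l X).diff () x hx a)
        ((hG.iterDeriv hΩ l X).diff () x hx a)
    · simp only [iterDeriv_cons_notMem hX]; exact ih x hx

lemma iterDeriv_finset_sum (hΩ : IsOpen Ω) {τ : Type*} {s : Finset τ} {F : τ → (ν → ℂ) → ℂ}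
    (hF : ∀ k ∈ s, Hol Ω (F k)) (l : List ν) (X : Finset ν) : ∀ x ∈ Ω,
      iterDeriv l X (fun x => ∑ k ∈ s, F k x) x = ∑ k ∈ s, iterDeriv l X (F k) x := by
  induction l with
  | nil => exact fun x _ => rfl
  | cons a l ih =>
    intro x hx
    by_cases hX : a ∈ X
    · simp only [iterDeriv_cons_mem hX]
      rw [partialDeriv_congr hΩ ih hx a]
      exact deriv_fun_sum fun k hk => ((hF k hk).iterDeriv hΩ l X).diff () x hx a
    · simp only [iterDeriv_cons_notMem hX]; exact ih x hx

lemma iterDeriv_integral (hΩ : IsOpen Ω) {K : ℝ → (ν → ℂ) → ℂ} (hK : SepHol Ω K) (a b : ℝ)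
    (l : List ν) (X : Finset ν) : ∀ x ∈ Ω,
      iterDeriv l X (fun x => ∫ t in a..b, K t x) x = ∫ t in a..b, iterDeriv l X (K t) x := by
  induction l with
  | nil => exact fun x _ => rfl
  | cons i l ih =>
    intro x hx
    by_cases hX : i ∈ X
    · simp only [iterDeriv_cons_mem hX]
      rw [partialDeriv_congr hΩ ih hx i]
      exact partialDeriv_integral hΩ (hK.iterDeriv hΩ l X) a b hx i
    · simp only [iterDeriv_cons_notMem hX]; exact ih x hx

lemma tendstoLocallyUniformlyOn_iterDeriv {τ : Type*} {f : Filter τ} [f.NeBot]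
    (hΩ : IsOpen Ω) {F : τ → (ν → ℂ) → ℂ} {G : (ν → ℂ) → ℂ} (hF : ∀ᶠ s in f, Hol Ω (F s))
    (h : TendstoLocallyUniformlyOn F G f Ω) (l : List ν) (X : Finset ν) :
    TendstoLocallyUniformlyOn (fun s => iterDeriv l X (F s)) (iterDeriv l X G) f Ω := by
  induction l with
  | nil => exact h
  | cons i l ih =>
    by_cases hX : i ∈ X
    · simp only [iterDeriv_cons_mem hX]
      exact tendstoLocallyUniformlyOn_partialDeriv hΩ (hF.mono fun s hs => hs.iterDeriv hΩ l X) ih i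
    · simp only [iterDeriv_cons_notMem hX]; exact ih

/-- The Leibniz rule. -/
lemma iterDeriv_mul (hΩ : IsOpen Ω) {F G : (ν → ℂ) → ℂ} (hF : Hol Ω F) (hG : Hol Ω G)
    {l : List ν} (hl : l.Nodup) {X : Finset ν} (hX : ∀ i ∈ X, i ∈ l) : ∀ x ∈ Ω,
      iterDeriv l X (fun x => F x * G x) x =
        ∑ Y ∈ X.powerset, iterDeriv l Y F x * iterDeriv l (X \ Y) G x := by
  induction l generalizing X with
  | nil =>
    intro x _
    have : X = ∅ := Finset.eq_empty_of_forall_notMem fun i hi => by simpa using hX i hi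
    simp [this]
  | cons a l ih =>
    intro x hx
    obtain ⟨hal, hl⟩ := List.nodup_cons.1 hl
    by_cases haX : a ∈ X
    · have hXe : X = insert a (X.erase a) := (Finset.insert_erase haX).symm
      have haE : a ∉ X.erase a := Finset.notMem_erase a X
      have hE : ∀ i ∈ X.erase a, i ∈ l := fun i hi =>
        (List.mem_cons.1 (hX i (Finset.mem_of_mem_erase hi))).resolve_left
          (Finset.ne_of_mem_erase hi)
      have hset : ∀ F : (ν → ℂ) → ℂ, iterDeriv l X F = iterDeriv l (X.erase a) F := fun F =>
        iterDeriv_congr_set (fun i hi => by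
          have : i ≠ a := fun h => hal (h ▸ hi)
          simp [this]) F
      rw [iterDeriv_cons_mem haX, hset, partialDeriv_congr hΩ (ih hl hE) hx a]
      have hd : ∀ Y (F : (ν → ℂ) → ℂ), Hol Ω F → DifferentiableAt ℂ
          (fun z => iterDeriv l Y F (update x a z)) (x a) := fun Y F hF =>
        (hF.iterDeriv hΩ l Y).diff () x hx a
      have h1 : partialDeriv a (fun x => ∑ Y ∈ (X.erase a).powerset,
          iterDeriv l Y F x * iterDeriv l (X.erase a \ Y) G x) x =
          ∑ Y ∈ (X.erase a).powerset, (partialDeriv a (iterDeriv l Y F) x *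
            iterDeriv l (X.erase a \ Y) G x +
            iterDeriv l Y F x * partialDeriv a (iterDeriv l (X.erase a \ Y) G) x) := by
        unfold partialDeriv
        beta_reduce
        rw [deriv_fun_sum fun Y _ => (hd Y F hF).fun_mul (hd (X.erase a \ Y) G hG)]
        refine Finset.sum_congr rfl fun Y _ => ?_
        rw [deriv_fun_mul (hd _ F hF) (hd _ G hG)]
        simp
      rw [h1, Finset.sum_add_distrib, add_comm]
      conv_rhs => rw [hXe]
      rw [Finset.sum_powerset_insert haE]
      congr 1
      · refine Finset.sum_congr rfl fun Y hY => ?_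
        have haY : a ∉ Y := fun h => haE (Finset.mem_powerset.1 hY h)
        rw [iterDeriv_cons_notMem haY, iterDeriv_cons_mem (by simp [haY])]
        congr 2
        exact iterDeriv_congr_set (fun i hi => by
          have : i ≠ a := fun h => hal (h ▸ hi)
          simp [this]) G
      · refine Finset.sum_congr rfl fun Y hY => ?_
        have haY : a ∉ Y := fun h => haE (Finset.mem_powerset.1 hY h)
        rw [iterDeriv_cons_mem (Finset.mem_insert_self a Y), iterDeriv_cons_notMem (by simp)]
        congr 1
        · congr 1
          exact iterDeriv_congr_set (fun i hi => by
            have : i ≠ a := fun h => hal (h ▸ hi)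
            simp [this]) F
        · exact congrFun (iterDeriv_congr_set (fun i hi => by
            have : i ≠ a := fun h => hal (h ▸ hi)
            simp [this]) G) x
    · have hE : ∀ i ∈ X, i ∈ l := fun i hi =>
        (List.mem_cons.1 (hX i hi)).resolve_left (fun h => haX (h ▸ hi))
      rw [iterDeriv_cons_notMem haX, ih hl hE x hx]
      refine Finset.sum_congr rfl fun Y hY => ?_
      have haY : a ∉ Y := fun h => haX (Finset.mem_powerset.1 hY h)
      rw [iterDeriv_cons_notMem haY, iterDeriv_cons_notMem (by simp [haX])]

/-- The point `x` with the coordinates outside `Q` replaced by those of `x₀`. -/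
def freeze (Q : Finset ν) (x₀ x : ν → ℂ) : ν → ℂ := fun i => if i ∈ Q then x i else x₀ i

lemma freeze_self (Q : Finset ν) (x₀ : ν → ℂ) : freeze Q x₀ x₀ = x₀ := by
  funext i; simp [freeze]

lemma continuous_freeze (Q : Finset ν) (x₀ : ν → ℂ) : Continuous (freeze Q x₀) := by
  refine continuous_pi fun i => ?_
  unfold freeze
  split_ifs <;> fun_prop

lemma freeze_update {Q : Finset ν} (x₀ x : ν → ℂ) {i : ν} (hi : i ∈ Q) (z : ℂ) :
    freeze Q x₀ (update x i z) = update (freeze Q x₀ x) i z := by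
  funext j
  rcases eq_or_ne j i with rfl | hj
  · simp [freeze, hi]
  · simp [freeze, hj]

/-- Freezing commutes with changing a coordinate of Q, and only such coordinates are differentiated.
-/
lemma iterDeriv_freeze {Q X : Finset ν} (hX : X ⊆ Q) (x₀ : ν → ℂ) (F : (ν → ℂ) → ℂ) (l : List ν)
    (x : ν → ℂ) :
    iterDeriv l X (fun x => F (freeze Q x₀ x)) x = iterDeriv l X F (freeze Q x₀ x) := by
  induction l generalizing x with
  | nil => rfl
  | cons a l ih =>
    by_cases ha : a ∈ X
    · rw [iterDeriv_cons_mem ha, iterDeriv_cons_mem ha]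
      unfold partialDeriv
      have : freeze Q x₀ x a = x a := by simp [freeze, hX ha]
      rw [this]
      congr 1
      funext z
      rw [ih, freeze_update _ _ (hX ha)]
    · rw [iterDeriv_cons_notMem ha, iterDeriv_cons_notMem ha, ih]

/-- Every coordinate of Q acts on φ(Σ) as the derivative of φ, and a coordinate outside Q
differentiates a constant. With Q of one or two elements this covers the values ζ(1+α+β). -/
lemma iterDeriv_comp_sum (Q : Finset ν) (φ : ℂ → ℂ) {l : List ν} (hl : l.Nodup) {X : Finset ν}
    (hX : ∀ i ∈ X, i ∈ l) (x : ν → ℂ) :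
    iterDeriv l X (fun x => φ (∑ k ∈ Q, x k)) x =
      if X ⊆ Q then iteratedDeriv X.card φ (∑ k ∈ Q, x k) else 0 := by
  induction l generalizing X x with
  | nil =>
    have : X = ∅ := Finset.eq_empty_of_forall_notMem fun i hi => by simpa using hX i hi
    simp [this]
  | cons a l ih =>
    obtain ⟨hal, hl⟩ := List.nodup_cons.1 hl
    by_cases haX : a ∈ X
    · have hE : ∀ i ∈ X.erase a, i ∈ l := fun i hi =>
        (List.mem_cons.1 (hX i (Finset.mem_of_mem_erase hi))).resolve_left
          (Finset.ne_of_mem_erase hi)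
      have hset : iterDeriv l X = iterDeriv l (X.erase a) := funext fun F =>
        iterDeriv_congr_set (fun i hi => by
          have : i ≠ a := fun h => hal (h ▸ hi)
          simp [this]) F
      rw [iterDeriv_cons_mem haX, hset]
      unfold partialDeriv
      simp only [ih hl hE]
      have hsub : X ⊆ Q ↔ a ∈ Q ∧ X.erase a ⊆ Q := by
        conv_lhs => rw [← Finset.insert_erase haX]
        exact Finset.insert_subset_iff
      by_cases h1 : X.erase a ⊆ Q
      · by_cases h2 : a ∈ Q
        · rw [if_pos (hsub.2 ⟨h2, h1⟩)]
          simp only [if_pos h1]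
          have h3 : ∀ z, ∑ k ∈ Q, update x a z k = z + ∑ k ∈ Q.erase a, x k := by
            intro z
            rw [← Finset.add_sum_erase _ _ h2, update_self]
            congr 1
            refine Finset.sum_congr rfl fun k hk => ?_
            rw [update_of_ne (Finset.ne_of_mem_erase hk)]
          simp only [h3]
          rw [deriv_comp_add_const, Finset.add_sum_erase _ _ h2,
            ← Finset.card_erase_add_one haX, iteratedDeriv_succ]
        · rw [if_neg (fun h => h2 (hsub.1 h).1)]
          simp only [if_pos h1]
          have h3 : ∀ z, ∑ k ∈ Q, update x a z k = ∑ k ∈ Q, x k := fun z =>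
            Finset.sum_congr rfl fun k hk => update_of_ne (fun h : k = a => h2 (h ▸ hk)) _ _
          simp only [h3, deriv_const]
      · rw [if_neg (fun h => h1 (hsub.1 h).2)]
        simp only [if_neg h1, deriv_const]
    · have hE : ∀ i ∈ X, i ∈ l := fun i hi =>
        (List.mem_cons.1 (hX i hi)).resolve_left (fun h => haX (h ▸ hi))
      rw [iterDeriv_cons_notMem haX, ih hl hE]

/-- Each coordinate occurs in a single factor, so differentiating in it replaces that factor by its
derivative. No differentiability is required: the rule for a constant multiple holds in a field
without it. -/
lemma iterDeriv_prod (Q : Finset ν) (φ : ν → ℂ → ℂ) {l : List ν} (hl : l.Nodup) {X : Finset ν}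
    (hX : ∀ i ∈ X, i ∈ l) (x : ν → ℂ) :
    iterDeriv l X (fun x => ∏ k ∈ Q, φ k (x k)) x =
      if X ⊆ Q then ∏ k ∈ Q, (if k ∈ X then deriv (φ k) (x k) else φ k (x k)) else 0 := by
  induction l generalizing X x with
  | nil =>
    have : X = ∅ := Finset.eq_empty_of_forall_notMem fun i hi => by simpa using hX i hi
    simp [this]
  | cons a l ih =>
    obtain ⟨hal, hl⟩ := List.nodup_cons.1 hl
    by_cases haX : a ∈ X
    · have hE : ∀ i ∈ X.erase a, i ∈ l := fun i hi =>
        (List.mem_cons.1 (hX i (Finset.mem_of_mem_erase hi))).resolve_left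
          (Finset.ne_of_mem_erase hi)
      have hset : iterDeriv l X = iterDeriv l (X.erase a) := funext fun F =>
        iterDeriv_congr_set (fun i hi => by
          have : i ≠ a := fun h => hal (h ▸ hi)
          simp [this]) F
      rw [iterDeriv_cons_mem haX, hset]
      unfold partialDeriv
      simp only [ih hl hE]
      have hsub : X ⊆ Q ↔ a ∈ Q ∧ X.erase a ⊆ Q := by
        conv_lhs => rw [← Finset.insert_erase haX]
        exact Finset.insert_subset_iff
      by_cases h1 : X.erase a ⊆ Q
      · by_cases h2 : a ∈ Q
        · rw [if_pos (hsub.2 ⟨h2, h1⟩)]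
          simp only [if_pos h1]
          have h3 : ∀ z, ∏ k ∈ Q, (if k ∈ X.erase a then deriv (φ k) (update x a z k)
              else φ k (update x a z k)) =
              φ a z * ∏ k ∈ Q.erase a, (if k ∈ X then deriv (φ k) (x k) else φ k (x k)) := by
            intro z
            rw [← Finset.mul_prod_erase _ _ h2]
            congr 1
            · simp
            · refine Finset.prod_congr rfl fun k hk => ?_
              have := Finset.ne_of_mem_erase hk
              simp [this]
          simp only [h3]
          rw [deriv_mul_const_field, ← Finset.mul_prod_erase _ _ h2, if_pos haX]
        · rw [if_neg (fun h => h2 (hsub.1 h).1)]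
          simp only [if_pos h1]
          have h3 : ∀ z, ∀ k ∈ Q, update x a z k = x k := fun z k hk =>
            update_of_ne (fun h : k = a => h2 (h ▸ hk)) _ _
          have h4 : ∀ z, ∏ k ∈ Q, (if k ∈ X.erase a then deriv (φ k) (update x a z k)
              else φ k (update x a z k)) = ∏ k ∈ Q, (if k ∈ X.erase a then deriv (φ k) (x k)
              else φ k (x k)) := fun z => Finset.prod_congr rfl fun k hk => by rw [h3 z k hk]
          simp only [h4, deriv_const]
      · rw [if_neg (fun h => h1 (hsub.1 h).2)]
        simp only [if_neg h1, deriv_const]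
    · have hE : ∀ i ∈ X, i ∈ l := fun i hi =>
        (List.mem_cons.1 (hX i hi)).resolve_left (fun h => haX (h ▸ hi))
      rw [iterDeriv_cons_notMem haX, ih hl hE]

/-- The mixed partial derivatives of `F` at `x`, as a function of the set of coordinates. -/
noncomputable def jet (F : (ν → ℂ) → ℂ) (x : ν → ℂ) (X : Finset ν) : ℂ :=
  iterDeriv Finset.univ.toList X F x

/-- Convolution over subsets. -/
def subsetConv (f g : Finset ν → ℂ) (X : Finset ν) : ℂ := ∑ Y ∈ X.powerset, f Y * g (X \ Y)

lemma jet_empty (F : (ν → ℂ) → ℂ) (x : ν → ℂ) : jet F x ∅ = F x := by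
  unfold jet
  induction (Finset.univ : Finset ν).toList with
  | nil => rfl
  | cons a l ih => rw [iterDeriv_cons_notMem (by simp), ih]

lemma jet_mul (hΩ : IsOpen Ω) {F G : (ν → ℂ) → ℂ} (hF : Hol Ω F) (hG : Hol Ω G) {x : ν → ℂ}
    (hx : x ∈ Ω) : jet (fun x => F x * G x) x = subsetConv (jet F x) (jet G x) :=
  funext fun X => iterDeriv_mul hΩ hF hG (Finset.nodup_toList _) (by simp) x hx

lemma jet_congr (hΩ : IsOpen Ω) {F G : (ν → ℂ) → ℂ} (h : ∀ x ∈ Ω, F x = G x) {x : ν → ℂ}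
    (hx : x ∈ Ω) : jet F x = jet G x :=
  funext fun X => iterDeriv_congr hΩ h _ X x hx

lemma jet_freeze {Q X : Finset ν} (hX : X ⊆ Q) (x : ν → ℂ) (F : (ν → ℂ) → ℂ) :
    jet (fun y => F (freeze Q x y)) x X = jet F x X := by
  unfold jet
  rw [iterDeriv_freeze hX, freeze_self]

lemma jet_comp_sum (Q : Finset ν) (φ : ℂ → ℂ) (x : ν → ℂ) (X : Finset ν) :
    jet (fun x => φ (∑ k ∈ Q, x k)) x X =
      if X ⊆ Q then iteratedDeriv X.card φ (∑ k ∈ Q, x k) else 0 :=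
  iterDeriv_comp_sum Q φ (Finset.nodup_toList _) (by simp) x

lemma jet_prod (Q : Finset ν) (φ : ν → ℂ → ℂ) (x : ν → ℂ) (X : Finset ν) :
    jet (fun x => ∏ k ∈ Q, φ k (x k)) x X =
      if X ⊆ Q then ∏ k ∈ Q, (if k ∈ X then deriv (φ k) (x k) else φ k (x k)) else 0 :=
  iterDeriv_prod Q φ (Finset.nodup_toList _) (by simp) x

lemma jet_integral (hΩ : IsOpen Ω) {K : ℝ → (ν → ℂ) → ℂ} (hK : SepHol Ω K) (a b : ℝ)
    {x : ν → ℂ} (hx : x ∈ Ω) (X : Finset ν) :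
    jet (fun x => ∫ t in a..b, K t x) x X = ∫ t in a..b, jet (K t) x X :=
  iterDeriv_integral hΩ hK a b _ X x hx

lemma tendsto_jet {τ : Type*} {f : Filter τ} [f.NeBot] (hΩ : IsOpen Ω) {F : τ → (ν → ℂ) → ℂ}
    {G : (ν → ℂ) → ℂ} (hF : ∀ᶠ s in f, Hol Ω (F s)) (h : TendstoLocallyUniformlyOn F G f Ω)
    {x : ν → ℂ} (hx : x ∈ Ω) (X : Finset ν) :
    Tendsto (fun s => jet (F s) x X) f (𝓝 (jet G x X)) :=
  (tendstoLocallyUniformlyOn_iterDeriv hΩ hF h _ X).tendsto_at hx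

lemma jet_const (c : ℂ) (x : ν → ℂ) (X : Finset ν) :
    jet (fun _ => c) x X = if X = ∅ then c else 0 := by
  have := jet_comp_sum (∅ : Finset ν) (fun _ => c) x X
  simp only [Finset.subset_empty] at this
  rw [this]
  split_ifs with h
  · simp [h]
  · rfl

end Jets

/-! ### Convolution over subsets, logarithms and cumulants -/

section Cumulants

variable {ν : Type*} [DecidableEq ν]

lemma subsetConv_congr {f f' g g' : Finset ν → ℂ} {V : Finset ν}
    (hf : ∀ X ⊆ V, f X = f' X) (hg : ∀ X ⊆ V, g X = g' X) :
    subsetConv f g V = subsetConv f' g' V := by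
  refine Finset.sum_congr rfl fun Y hY => ?_
  rw [hf Y (Finset.mem_powerset.1 hY), hg _ Finset.sdiff_subset]

lemma subsetConv_comm (f g : Finset ν → ℂ) : subsetConv f g = subsetConv g f := by
  funext V
  refine Finset.sum_bij' (fun Y _ => V \ Y) (fun Y _ => V \ Y) ?_ ?_ ?_ ?_ ?_
  · simp
  · simp
  · exact fun Y hY => Finset.sdiff_sdiff_eq_self (Finset.mem_powerset.1 hY)
  · exact fun Y hY => Finset.sdiff_sdiff_eq_self (Finset.mem_powerset.1 hY)
  · intro Y hY
    rw [Finset.sdiff_sdiff_eq_self (Finset.mem_powerset.1 hY), mul_comm]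

lemma subsetConv_assoc (f g h : Finset ν → ℂ) :
    subsetConv (subsetConv f g) h = subsetConv f (subsetConv g h) := by
  funext V
  simp only [subsetConv, Finset.sum_mul, Finset.mul_sum]
  rw [Finset.sum_sigma', Finset.sum_sigma']
  -- Both sides are sums over ordered decompositions of V into three pieces: a pair X ⊆ Z
  -- corresponds to the disjoint pair X, Z∖X.
  refine Finset.sum_bij' (fun p _ => ⟨p.2, p.1 \ p.2⟩) (fun p _ => ⟨p.1 ∪ p.2, p.1⟩) ?_ ?_ ?_ ?_ ?_
  · rintro ⟨Z, X⟩ h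
    simp only [Finset.mem_sigma, Finset.mem_powerset] at h ⊢
    exact ⟨h.2.trans h.1, Finset.sdiff_subset_sdiff h.1 subset_rfl⟩
  · rintro ⟨X, Y⟩ h
    simp only [Finset.mem_sigma, Finset.mem_powerset] at h ⊢
    exact ⟨Finset.union_subset h.1 (h.2.trans Finset.sdiff_subset), Finset.subset_union_left⟩
  · rintro ⟨Z, X⟩ h
    simp only [Finset.mem_sigma, Finset.mem_powerset] at h
    simp [Finset.union_sdiff_of_subset h.2]
  · rintro ⟨X, Y⟩ h
    simp only [Finset.mem_sigma, Finset.mem_powerset] at h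
    have : Disjoint X Y := (Finset.subset_sdiff.1 h.2).2.symm
    simp [Finset.union_sdiff_cancel_left this]
  · rintro ⟨Z, X⟩ h
    simp only [Finset.mem_sigma, Finset.mem_powerset] at h
    have : (V \ X) \ (Z \ X) = V \ Z := by
      ext a; simp only [Finset.mem_sdiff]; have := @h.2 a; tauto
    rw [this, mul_assoc]

/-- The element w belongs to one of the two pieces. Thus f ↦ f(w ∪ ·) is a derivation of the
convolution algebra. -/
lemma subsetConv_insert (f g : Finset ν → ℂ) {w : ν} {V : Finset ν} (hw : w ∉ V) :
    subsetConv f g (insert w V) = subsetConv (fun X => f (insert w X)) g V +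
      subsetConv f (fun X => g (insert w X)) V := by
  unfold subsetConv
  rw [Finset.sum_powerset_insert hw, add_comm]
  congr 1
  · refine Finset.sum_congr rfl fun Y hY => ?_
    congr 2
    ext a; simp only [Finset.mem_sdiff, Finset.mem_insert]
    constructor
    · rintro ⟨rfl | h1, h2⟩ <;> tauto
    · rintro ⟨h1, h2⟩
      refine ⟨Or.inr h1, ?_⟩
      rintro (rfl | h3) <;> tauto
  · refine Finset.sum_congr rfl fun Y hY => ?_
    have : w ∉ Y := fun h => hw (Finset.mem_powerset.1 hY h)
    rw [Finset.insert_sdiff_of_notMem _ this]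

lemma subsetConv_add_right (f g h : Finset ν → ℂ) (V : Finset ν) :
    subsetConv f (fun X => g X + h X) V = subsetConv f g V + subsetConv f h V := by
  simp [subsetConv, mul_add, Finset.sum_add_distrib]

lemma subsetConv_empty (f g : Finset ν → ℂ) : subsetConv f g ∅ = f ∅ * g ∅ := by
  simp [subsetConv]

/-- `κ` is the logarithm of `f` with respect to convolution, on the nonempty subsets of `U`. -/
def IsLogOn (U : Finset ν) (f κ : Finset ν → ℂ) : Prop :=
  ∀ V w, w ∉ V → insert w V ⊆ U →
    f (insert w V) = subsetConv f (fun X => κ (insert w X)) V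

lemma IsLogOn.congr {U : Finset ν} {f f' κ κ' : Finset ν → ℂ} (h : IsLogOn U f κ)
    (hf : ∀ X ⊆ U, f' X = f X) (hκ : ∀ X ⊆ U, X.Nonempty → κ' X = κ X) : IsLogOn U f' κ' := by
  intro V w hw hU
  rw [hf _ hU, h V w hw hU]
  refine subsetConv_congr (fun X hX => ?_) (fun X hX => ?_)
  · exact (hf X (hX.trans ((Finset.subset_insert _ _).trans hU))).symm
  · exact (hκ _ ((Finset.insert_subset_insert _ hX).trans hU) (Finset.insert_nonempty _ _)).symm

/-- Write f' for f(w ∪ ·). By the derivation rule (f*g)' = f'*g + f*g', and f' = f*κ', g' = g*l'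
turn this into (f*g)*(κ'+l'). -/
lemma IsLogOn.mul {U : Finset ν} {f g κ l : Finset ν → ℂ} (hf : IsLogOn U f κ)
    (hg : IsLogOn U g l) : IsLogOn U (subsetConv f g) (fun X => κ X + l X) := by
  intro V w hw hU
  have hsub : ∀ X ⊆ V, w ∉ X ∧ insert w X ⊆ U := fun X hX =>
    ⟨fun h => hw (hX h), (Finset.insert_subset_insert _ hX).trans hU⟩
  rw [subsetConv_insert f g hw, subsetConv_add_right]
  congr 1
  · rw [subsetConv_congr (f' := subsetConv f (fun X => κ (insert w X)))
      (fun X hX => hf X w (hsub X hX).1 (hsub X hX).2) (fun X _ => rfl), subsetConv_assoc,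
      subsetConv_comm _ g, ← subsetConv_assoc]
  · rw [subsetConv_congr (f' := f) (g' := subsetConv g (fun X => l (insert w X)))
      (fun X _ => rfl) (fun X hX => hg X w (hsub X hX).1 (hsub X hX).2), subsetConv_assoc]

/-- This also holds for c = 0, so constant factors that may vanish cause no trouble. -/
lemma isLogOn_const (U : Finset ν) (c : ℂ) :
    IsLogOn U (fun X => if X = ∅ then c else 0) (fun _ => 0) := by
  intro V w hw hU
  simp [subsetConv]

lemma IsLogOn.smul {U : Finset ν} {f κ : Finset ν → ℂ} (hf : IsLogOn U f κ) (c : ℂ) :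
    IsLogOn U (fun X => c * f X) κ := by
  intro V w hw hU
  simp only [hf V w hw hU, subsetConv, Finset.mul_sum, mul_assoc]

/-- In the recursion for W the term Y = ∅ is f(∅) times the value at W, while all other terms
involve proper subsets of W. Induction and division by f(∅) determine the value. -/
lemma IsLogOn.unique {U : Finset ν} {f κ l : Finset ν → ℂ} (h0 : f ∅ ≠ 0) (hκ : IsLogOn U f κ)
    (hl : IsLogOn U f l) : ∀ W ⊆ U, W.Nonempty → κ W = l W := by
  intro W
  induction W using Finset.strongInduction with
  | H W ih =>
    intro hWU hW
    obtain ⟨w, hw⟩ := hW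
    have hins : insert w (W.erase w) = W := Finset.insert_erase hw
    have h1 := hκ (W.erase w) w (Finset.notMem_erase _ _) (by rwa [hins])
    have h2 := hl (W.erase w) w (Finset.notMem_erase _ _) (by rwa [hins])
    rw [h1] at h2
    unfold subsetConv at h2
    rw [← Finset.add_sum_erase _ _ (Finset.empty_mem_powerset (W.erase w)),
      ← Finset.add_sum_erase _ _ (Finset.empty_mem_powerset (W.erase w))] at h2
    have h3 : ∑ Y ∈ (W.erase w).powerset.erase ∅, f Y * κ (insert w (W.erase w \ Y)) =
        ∑ Y ∈ (W.erase w).powerset.erase ∅, f Y * l (insert w (W.erase w \ Y)) := by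
      refine Finset.sum_congr rfl fun Y hY => ?_
      obtain ⟨hY0, hY⟩ := Finset.mem_erase.1 hY
      rw [Finset.mem_powerset] at hY
      obtain ⟨y, hy⟩ := Finset.nonempty_iff_ne_empty.2 hY0
      have hsub : insert w (W.erase w \ Y) ⊂ W := by
        refine (Finset.ssubset_iff_of_subset ?_).2 ⟨y, Finset.mem_of_mem_erase (hY hy), ?_⟩
        · conv_rhs => rw [← hins]
          exact Finset.insert_subset_insert _ Finset.sdiff_subset
        · have := Finset.ne_of_mem_erase (hY hy)
          simp [this, hy]
      rw [ih _ hsub (hsub.subset.trans hWU) (Finset.insert_nonempty _ _)]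
    rw [h3] at h2
    simp only [Finset.sdiff_empty, hins] at h2
    exact mul_left_cancel₀ h0 (add_right_cancel h2)

/-- Partitions with one marked block B correspond to a nonempty B together with a partition of its
complement. -/
lemma sum_finpartition_sum_parts (s : Finset ν) (φ : Finset ν → Finset (Finset ν) → ℂ) :
    ∑ P : Finpartition s, ∑ B ∈ P.parts, φ B (P.parts.erase B) =
      ∑ B ∈ s.powerset with B.Nonempty, ∑ P : Finpartition (s \ B), φ B P.parts := by
  rw [Finset.sum_sigma', Finset.sum_sigma']
  symm
  have hcond : ∀ q : (B : Finset ν) × Finpartition (s \ B),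
      q ∈ (s.powerset.filter (·.Nonempty)).sigma (fun B => (Finset.univ : Finset _)) →
      q.1 ⊆ s ∧ q.1.Nonempty := by
    intro q hq
    simpa using hq
  have hnot : ∀ (B : Finset ν), B.Nonempty → ∀ P : Finpartition (s \ B), B ∉ P.parts := by
    intro B hB P h
    obtain ⟨b, hb⟩ := hB
    have := P.le h hb
    simp [hb] at this
  refine Finset.sum_bij (fun q hq => ⟨q.2.extend (b := q.1) (c := s)
    (hcond q hq).2.ne_empty Finset.disjoint_sdiff.symm
    (by simpa using (hcond q hq).1), q.1⟩) ?_ ?_ ?_ ?_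
  · intro q hq
    simp [Finpartition.extend]
  · rintro ⟨B, P⟩ hq ⟨B', P'⟩ hq' h
    simp only [Sigma.mk.injEq] at h
    obtain ⟨h1, h2⟩ := h
    have h2 : B = B' := by simpa using h2
    subst h2
    congr 1
    have h3 : insert B P.parts = insert B P'.parts := congrArg Finpartition.parts h1
    have hB := (hcond _ hq).2
    apply Finpartition.ext
    rw [← Finset.erase_insert (hnot B hB P), h3, Finset.erase_insert (hnot B hB P')]
  · rintro ⟨P, B⟩ h
    simp only [Finset.mem_sigma, Finset.mem_univ, true_and] at h
    have hBs : B ⊆ s := P.subset h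
    have hB : B.Nonempty := P.nonempty_of_mem_parts h
    refine ⟨⟨B, ⟨P.parts.erase B, ?_, ?_, ?_⟩⟩, by simp [hBs, hB], ?_⟩
    · exact P.supIndep.subset (Finset.erase_subset _ _)
    · ext a
      simp only [Finset.mem_sup, Finset.mem_erase, id, Finset.mem_sdiff]
      constructor
      · rintro ⟨C, ⟨hCB, hC⟩, ha⟩
        exact ⟨P.subset hC ha, fun haB => hCB (P.eq_of_mem_parts hC h ha haB)⟩
      · rintro ⟨has, haB⟩
        obtain ⟨C, hC, ha⟩ := P.exists_mem has
        exact ⟨C, ⟨fun hCB => haB (hCB ▸ ha), hC⟩, ha⟩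
    · intro h'
      exact P.bot_notMem (Finset.mem_of_mem_erase h')
    · congr 1
      apply Finpartition.ext
      exact Finset.insert_erase h
  · rintro ⟨B, P⟩ hq
    have := hnot B (hcond _ hq).2 P
    simp [Finpartition.extend, Finset.erase_insert this]

/-- A sum over all set partitions whose terms depend only on the set of parts. -/
noncomputable def partitionSum (F : Finset (Finset ν) → ℂ) (s : Finset ν) : ℂ :=
  ∑ P : Finpartition s, F P.parts

lemma partitionSum_empty (F : Finset (Finset ν) → ℂ) : partitionSum F ∅ = F ∅ := by
  unfold partitionSum
  have hP : ∀ P : Finpartition (∅ : Finset ν), P.parts = ∅ := fun P =>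
    Finpartition.parts_eq_empty_iff.2 rfl
  have : Unique (Finpartition (∅ : Finset ν)) :=
    inferInstanceAs (Unique (Finpartition (⊥ : Finset ν)))
  rw [Fintype.sum_unique, hP]

/-- Sort the partitions by the unique block w ∪ X that contains w. What remains is a partition of
V∖X. -/
lemma partitionSum_insert {w : ν} {V : Finset ν} (hw : w ∉ V) {F : Finset (Finset ν) → ℂ}
    {a : Finset ν → ℂ} {G : Finset (Finset ν) → ℂ}
    (h : ∀ P : Finpartition (insert w V), ∀ B ∈ P.parts, F P.parts = a B * G (P.parts.erase B)) :
    partitionSum F (insert w V) =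
      subsetConv (fun X => a (insert w X)) (partitionSum G) V := by
  have h1 : ∀ P : Finpartition (insert w V), F P.parts =
      ∑ B ∈ P.parts, if w ∈ B then a B * G (P.parts.erase B) else 0 := by
    intro P
    have hwi : w ∈ insert w V := Finset.mem_insert_self _ _
    rw [Finset.sum_eq_single_of_mem (P.part w) (P.part_mem.2 hwi), if_pos (P.mem_part_self.2 hwi),
      h P _ (P.part_mem.2 hwi)]
    intro B hB hne
    rw [if_neg fun hwB => hne (P.part_eq_of_mem hB hwB).symm]
  unfold partitionSum
  rw [Finset.sum_congr rfl fun P _ => h1 P,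
    sum_finpartition_sum_parts _ fun B p => if w ∈ B then a B * G p else 0,
    Finset.sum_filter, Finset.sum_powerset_insert hw]
  have h0 : ∑ B ∈ V.powerset, (if B.Nonempty then
      ∑ P : Finpartition (insert w V \ B), (if w ∈ B then a B * G P.parts else 0) else 0) = 0 := by
    refine Finset.sum_eq_zero fun B hB => ?_
    have : w ∉ B := fun h => hw (Finset.mem_powerset.1 hB h)
    simp [this]
  rw [h0, zero_add]
  refine Finset.sum_congr rfl fun Y hY => ?_
  rw [if_pos (Finset.insert_nonempty _ _)]
  simp only [Finset.mem_insert_self, if_true]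
  rw [← Finset.mul_sum]
  congr 1
  have : insert w V \ insert w Y = V \ Y := by
    ext b; simp only [Finset.mem_sdiff, Finset.mem_insert]
    constructor
    · rintro ⟨rfl | h1, h2⟩ <;> tauto
    · rintro ⟨h1, h2⟩
      refine ⟨Or.inr h1, ?_⟩
      rintro (rfl | h3) <;> tauto
  change partitionSum G _ = partitionSum G _
  rw [this]

/-- The exponential formula. -/
lemma IsLogOn.eq_partitionSum {U : Finset ν} {f κ : Finset ν → ℂ} (h : IsLogOn U f κ) :
    ∀ V ⊆ U, f V = f ∅ * ∑ P : Finpartition V, ∏ W ∈ P.parts, κ W := by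
  intro V
  change V ⊆ U → f V = f ∅ * partitionSum (fun p => ∏ W ∈ p, κ W) V
  induction V using Finset.strongInduction with
  | H V ih =>
    intro hVU
    rcases V.eq_empty_or_nonempty with rfl | ⟨w, hw⟩
    · simp [partitionSum_empty]
    · have hins : insert w (V.erase w) = V := Finset.insert_erase hw
      have hnot := Finset.notMem_erase w V
      have key := partitionSum_insert hnot (F := fun p => ∏ W ∈ p, κ W) (a := κ)
        (G := fun p => ∏ W ∈ p, κ W) (fun P B hB => (Finset.mul_prod_erase _ _ hB).symm)
      have h2 := h _ w hnot (by rwa [hins])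
      rw [hins] at key h2
      rw [key, subsetConv_comm, h2]
      simp only [subsetConv, Finset.mul_sum]
      refine Finset.sum_congr rfl fun Y hY => ?_
      have hYV : Y ⊂ V := (Finset.mem_powerset.1 hY).trans_ssubset (Finset.erase_ssubset hw)
      rw [ih Y hYV (hYV.subset.trans hVU), mul_assoc]

/-- The cumulants of the moments `m`. -/
noncomputable def cumulants (m : Finset ν → ℂ) : Finset ν → ℂ :=
  partitionSum fun p => (-1) ^ (p.card - 1) * ((p.card - 1).factorial : ℂ) * ∏ X ∈ p, m X

/-- The convolution inverse of the moments `m`, provided that `m ∅ = 1`. -/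
noncomputable def convInverse (m : Finset ν → ℂ) : Finset ν → ℂ :=
  partitionSum fun p => (-1) ^ p.card * (p.card.factorial : ℂ) * ∏ X ∈ p, m X

/-- For nonempty Y the terms with nonempty first set run over partitions with a marked block, and
they add up to minus the term of the empty set. -/
lemma subsetConv_convInverse {m : Finset ν → ℂ} (hm : m ∅ = 1) (Y : Finset ν) :
    subsetConv m (convInverse m) Y = if Y = ∅ then 1 else 0 := by
  rcases Y.eq_empty_or_nonempty with rfl | hY
  · simp [subsetConv_empty, convInverse, partitionSum_empty, hm]
  · rw [if_neg hY.ne_empty]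
    have h1 := sum_finpartition_sum_parts Y
      fun B p => m B * ((-1) ^ p.card * (p.card.factorial : ℂ) * ∏ X ∈ p, m X)
    -- A partition into J blocks has J choices of the mark, each of weight (-1)^(J-1) (J-1)!, in
    -- total -(-1)^J J!.
    have h2 : ∀ P : Finpartition Y, ∑ B ∈ P.parts, m B * ((-1) ^ (P.parts.erase B).card *
        ((P.parts.erase B).card.factorial : ℂ) * ∏ X ∈ P.parts.erase B, m X) =
        -((-1) ^ P.parts.card * (P.parts.card.factorial : ℂ) * ∏ X ∈ P.parts, m X) := by
      intro P
      have hpos : 0 < P.parts.card := Finset.card_pos.2 (P.parts_nonempty hY.ne_empty)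
      obtain ⟨k, hk⟩ : ∃ k, P.parts.card = k + 1 := ⟨P.parts.card - 1, by omega⟩
      have : ∀ B ∈ P.parts, m B * ((-1) ^ (P.parts.erase B).card *
        ((P.parts.erase B).card.factorial : ℂ) * ∏ X ∈ P.parts.erase B, m X) =
        (-1) ^ k * (k.factorial : ℂ) * ∏ X ∈ P.parts, m X := by
        intro B hB
        rw [Finset.card_erase_of_mem hB, hk, ← Finset.mul_prod_erase _ _ hB]
        simp only [Nat.add_sub_cancel]
        ring
      rw [Finset.sum_congr rfl this, Finset.sum_const, hk, Nat.factorial_succ]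
      simp only [nsmul_eq_mul]
      push_cast
      ring
    rw [Finset.sum_congr rfl fun P _ => h2 P, Finset.sum_neg_distrib] at h1
    simp only [← Finset.mul_sum] at h1
    have h3 : subsetConv m (convInverse m) Y = m ∅ * convInverse m Y +
        ∑ B ∈ Y.powerset with B.Nonempty, m B * convInverse m (Y \ B) := by
      unfold subsetConv
      rw [← Finset.add_sum_erase _ _ (Finset.empty_mem_powerset Y)]
      congr 1
      · simp
      · refine Finset.sum_congr ?_ fun _ _ => rfl
        ext B
        simp [Finset.nonempty_iff_ne_empty, and_comm]
    have h4 : ∑ B ∈ Y.powerset with B.Nonempty, m B * convInverse m (Y \ B) =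
        -convInverse m Y := h1.symm
    rw [h3, h4, hm]
    ring

/-- Removing the block of w from a partition into J blocks leaves J-1 of them, and (-1)^(J-1) (J-1)!
is exactly the weight of `convInverse`. Hence the cumulants at w ∪ X are m' * m⁻¹, the analogue of
m'/m, and convolving with m gives back m'. -/
lemma isLogOn_cumulants {m : Finset ν → ℂ} (hm : m ∅ = 1) (U : Finset ν) :
    IsLogOn U m (cumulants m) := by
  intro V w hw _
  have h1 : ∀ X ⊆ V, cumulants m (insert w X) =
      subsetConv (fun X => m (insert w X)) (convInverse m) X := by
    intro X hX
    refine partitionSum_insert (fun h => hw (hX h)) fun P B hB => ?_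
    rw [Finset.card_erase_of_mem hB, ← Finset.mul_prod_erase _ _ hB]
    ring
  rw [subsetConv_congr (f' := m) (fun X _ => rfl) h1, subsetConv_comm, subsetConv_assoc,
    subsetConv_comm (convInverse m)]
  have h2 : subsetConv m (convInverse m) = fun Y => if Y = ∅ then 1 else 0 :=
    funext (subsetConv_convInverse hm)
  rw [h2, subsetConv_comm]
  unfold subsetConv
  rw [Finset.sum_eq_single_of_mem ∅ (Finset.empty_mem_powerset V)]
  · simp
  · intro Y _ hY; simp [hY]

lemma isLogOn_cumulants_div {f : Finset ν → ℂ} (hf : f ∅ ≠ 0) (U : Finset ν) :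
    IsLogOn U f (cumulants fun X => f X / f ∅) := by
  have h := (isLogOn_cumulants (m := fun X => f X / f ∅) (div_self hf) U).smul (f ∅)
  refine h.congr (fun X _ => ?_) fun _ _ _ => rfl
  field_simp

lemma tendsto_cumulants {τ : Type*} {l : Filter τ} {m : τ → Finset ν → ℂ} {m' : Finset ν → ℂ}
    (h : ∀ X, Tendsto (fun s => m s X) l (𝓝 (m' X))) (W : Finset ν) :
    Tendsto (fun s => cumulants (m s) W) l (𝓝 (cumulants m' W)) := by
  unfold cumulants partitionSum
  exact tendsto_finsetSum _ fun P _ => tendsto_const_nhds.mul (tendsto_finsetProd _ fun X _ => h X)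

/-- Logarithms converge along with the functions. -/
lemma IsLogOn.tendsto {τ : Type*} {l : Filter τ} {U : Finset ν} {f κ : τ → Finset ν → ℂ}
    {g : Finset ν → ℂ} (h : ∀ s, IsLogOn U (f s) (κ s))
    (hlim : ∀ X, Tendsto (fun s => f s X) l (𝓝 (g X))) (hg : g ∅ ≠ 0) :
    ∀ W ⊆ U, W.Nonempty →
      Tendsto (fun s => κ s W) l (𝓝 (cumulants (fun X => g X / g ∅) W)) := by
  intro W hW hne
  -- The cumulants are polynomials in the normalized values, so they converge. Once f(∅) ≠ 0,
  -- uniqueness identifies them with the given logarithms.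
  refine (tendsto_cumulants (fun X => (hlim X).div (hlim ∅) hg) W).congr' ?_
  filter_upwards [(hlim ∅).eventually_ne hg] with s hs
  exact (isLogOn_cumulants_div hs U).unique hs (h s) W hW hne

end Cumulants

/-! ### The integral over θ of local factors -/

section LocalEstimate

lemma e_eq (θ : ℝ) : e θ = circleMap 0 1 (2 * Real.pi * θ) := by
  simp only [e, circleMap, zero_add, Complex.ofReal_one, one_mul]
  congr 1; push_cast; ring

lemma norm_e (θ : ℝ) : ‖e θ‖ = 1 := by rw [e_eq]; simp

lemma e_mul_e_neg (θ : ℝ) : e (-θ) * e θ = 1 := by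
  rw [e, e, ← Complex.exp_add]; simp

lemma continuous_e : Continuous e := by unfold e; fun_prop

/-- The mean value property: integration over θ extracts the constant term of a power series in
e(θ). -/
lemma integral_comp_e {H : ℂ → ℂ} (hH : DiffContOnCl ℂ H (Metric.ball 0 1)) :
    ∫ θ in (0 : ℝ)..1, H (e θ) = H 0 := by
  have h : Real.circleAverage H 0 1 = H 0 := DiffContOnCl.circleAverage (by simpa using hH)
  rw [Real.circleAverage_def] at h
  rw [← h]
  simp only [e_eq]
  rw [intervalIntegral.integral_comp_mul_left (fun x => H (circleMap 0 1 x))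
    (by positivity : 2 * Real.pi ≠ 0)]
  simp

lemma e_one_sub (θ : ℝ) : e (1 - θ) = e (-θ) := by
  have h : e (1 - θ) = e (-θ) * Complex.exp (2 * Real.pi * Complex.I) := by
    rw [e, e, ← Complex.exp_add]; congr 1; push_cast; ring
  rw [h, Complex.exp_two_pi_mul_I, mul_one]

lemma integral_comp_e_neg {H : ℂ → ℂ} (hH : DiffContOnCl ℂ H (Metric.ball 0 1)) :
    ∫ θ in (0 : ℝ)..1, H (e (-θ)) = H 0 := by
  rw [← integral_comp_e hH]
  simp only [← e_one_sub]
  rw [intervalIntegral.integral_comp_sub_left (fun x => H (e x))]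
  simp

lemma diffContOnCl_fun_mul {s : Set ℂ} {f g : ℂ → ℂ} (hf : DiffContOnCl ℂ f s)
    (hg : DiffContOnCl ℂ g s) : DiffContOnCl ℂ (fun w => f w * g w) s := hf.smul hg

lemma diffContOnCl_fun_add {s : Set ℂ} {f g : ℂ → ℂ} (hf : DiffContOnCl ℂ f s)
    (hg : DiffContOnCl ℂ g s) : DiffContOnCl ℂ (fun w => f w + g w) s := hf.add hg

/-- On the closed unit disc `f(w) = 1 + f₁ w + O(q²)`, the error being divisible by `w²`. -/
def LinApprox (M q : ℝ) (f : ℂ → ℂ) (f₁ : ℂ) : Prop :=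
  ‖f₁‖ ≤ M * q ∧ ∃ F : ℂ → ℂ, DiffContOnCl ℂ F (Metric.ball 0 1) ∧
    ∀ w ∈ Metric.closedBall (0 : ℂ) 1, f w = 1 + f₁ * w + w ^ 2 * F w ∧ ‖F w‖ ≤ M * q ^ 2

lemma LinApprox.mul {M N q : ℝ} {f g : ℂ → ℂ} {f₁ g₁ : ℂ} (hM : 0 ≤ M) (hN : 0 ≤ N) (hq : 0 ≤ q)
    (hq1 : q ≤ 1) (hf : LinApprox M q f f₁) (hg : LinApprox N q g g₁) :
    LinApprox (M + N + 4 * (M * N)) q (fun w => f w * g w) (f₁ + g₁) := by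
  obtain ⟨hf₁, F, hF, hfF⟩ := hf
  obtain ⟨hg₁, G, hG, hgG⟩ := hg
  have hMN : 0 ≤ M * N := mul_nonneg hM hN
  constructor
  · calc ‖f₁ + g₁‖ ≤ M * q + N * q := (norm_add_le _ _).trans (add_le_add hf₁ hg₁)
      _ ≤ (M + N + 4 * (M * N)) * q := by nlinarith
  · have hid : DiffContOnCl ℂ (fun w : ℂ => w) (Metric.ball 0 1) := differentiable_id.diffContOnCl
    -- This is the coefficient of w² in (1 + f₁w + w²F)(1 + g₁w + w²G). Its first two terms give M +
    -- N, and the other four give MN each.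
    refine ⟨fun w => F w + G w + f₁ * g₁ + w * (f₁ * G w + g₁ * F w) + w * (w * (F w * G w)),
      ?_, fun w hw => ⟨?_, ?_⟩⟩
    · refine diffContOnCl_fun_add (diffContOnCl_fun_add (diffContOnCl_fun_add
        (diffContOnCl_fun_add hF hG) diffContOnCl_const) ?_) ?_
      · exact diffContOnCl_fun_mul hid (diffContOnCl_fun_add
          (diffContOnCl_fun_mul diffContOnCl_const hG) (diffContOnCl_fun_mul diffContOnCl_const hF))
      · exact diffContOnCl_fun_mul hid (diffContOnCl_fun_mul hid (diffContOnCl_fun_mul hF hG))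
    · beta_reduce
      rw [(hfF w hw).1, (hgG w hw).1]; ring
    · have hw1 : ‖w‖ ≤ 1 := by simpa using hw
      have h1 := (hfF w hw).2
      have h2 := (hgG w hw).2
      have hFG : ‖F w * G w‖ ≤ M * N * q ^ 2 := by
        rw [norm_mul]
        calc ‖F w‖ * ‖G w‖ ≤ (M * q ^ 2) * (N * q ^ 2) := by gcongr
          _ = M * N * q ^ 2 * q ^ 2 := by ring
          _ ≤ M * N * q ^ 2 * 1 := by gcongr; exact pow_le_one₀ hq hq1
          _ = _ := by ring
      have hfg : ‖f₁ * g₁‖ ≤ M * N * q ^ 2 := by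
        rw [norm_mul]
        calc ‖f₁‖ * ‖g₁‖ ≤ (M * q) * (N * q) := by gcongr
          _ = _ := by ring
      have hfG : ‖f₁ * G w‖ ≤ M * N * q ^ 2 := by
        rw [norm_mul]
        calc ‖f₁‖ * ‖G w‖ ≤ (M * q) * (N * q ^ 2) := by gcongr
          _ = M * N * q ^ 2 * q := by ring
          _ ≤ M * N * q ^ 2 * 1 := by gcongr
          _ = _ := by ring
      have hgF : ‖g₁ * F w‖ ≤ M * N * q ^ 2 := by
        rw [norm_mul]
        calc ‖g₁‖ * ‖F w‖ ≤ (N * q) * (M * q ^ 2) := by gcongr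
          _ = M * N * q ^ 2 * q := by ring
          _ ≤ M * N * q ^ 2 * 1 := by gcongr
          _ = _ := by ring
      have hwle : ∀ z : ℂ, ‖w * z‖ ≤ ‖z‖ := fun z => by
        rw [norm_mul]; exact mul_le_of_le_one_left (norm_nonneg _) hw1
      calc _ ≤ ‖F w‖ + ‖G w‖ + ‖f₁ * g₁‖ + ‖w * (f₁ * G w + g₁ * F w)‖ +
            ‖w * (w * (F w * G w))‖ := by
              refine (norm_add_le _ _).trans (add_le_add ((norm_add_le _ _).trans
                (add_le_add ((norm_add_le _ _).trans (add_le_add (norm_add_le _ _) le_rfl))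
                le_rfl)) le_rfl)
        _ ≤ M * q ^ 2 + N * q ^ 2 + M * N * q ^ 2 + (M * N * q ^ 2 + M * N * q ^ 2) +
            M * N * q ^ 2 := by
              gcongr
              · exact (hwle _).trans ((norm_add_le _ _).trans (add_le_add hfG hgF))
              · exact (hwle _).trans ((hwle _).trans hFG)
        _ ≤ (M + N + 4 * (M * N)) * q ^ 2 := by nlinarith [sq_nonneg q]

lemma linApprox_one (q : ℝ) : LinApprox 0 q (fun _ => 1) 0 :=
  ⟨by simp, 0, diffContOnCl_const, fun w _ => by simp⟩

lemma linApprox_one_sub {q : ℝ} {u : ℂ} (hu : ‖u‖ ≤ q) :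
    LinApprox 1 q (fun w => 1 - u * w) (-u) :=
  ⟨by simpa using hu, 0, diffContOnCl_const, fun w _ => ⟨by simp; ring, by simp; positivity⟩⟩

lemma norm_one_sub_ge {q q₀ : ℝ} (hq : q ≤ q₀) {u w : ℂ} (hu : ‖u‖ ≤ q) (hw : ‖w‖ ≤ 1) :
    1 - q₀ ≤ ‖1 - u * w‖ := by
  have h1 := norm_sub_norm_le (1 : ℂ) (u * w)
  have h2 : ‖u * w‖ ≤ q₀ := by
    rw [norm_mul]
    calc ‖u‖ * ‖w‖ ≤ ‖u‖ * 1 := by gcongr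
      _ ≤ q₀ := by linarith
  rw [norm_one] at h1
  linarith

lemma linApprox_inv {q q₀ : ℝ} (hq₀ : q₀ < 1) (hq : q ≤ q₀) {u : ℂ} (hu : ‖u‖ ≤ q) :
    LinApprox (1 - q₀)⁻¹ q (fun w => (1 - u * w)⁻¹) u := by
  have hq0 : 0 ≤ q := (norm_nonneg u).trans hu
  have h0 : 0 < 1 - q₀ := by linarith
  have h1 : 1 ≤ (1 - q₀)⁻¹ := (one_le_inv₀ h0).2 (by linarith)
  have hne : ∀ w ∈ Metric.closedBall (0 : ℂ) 1, 1 - u * w ≠ 0 := fun w hw => by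
    have := norm_one_sub_ge hq hu (by simpa using hw)
    exact norm_pos_iff.1 (h0.trans_le this)
  refine ⟨?_, fun w => u ^ 2 * (1 - u * w)⁻¹, ?_, fun w hw => ⟨?_, ?_⟩⟩
  · exact hu.trans (le_mul_of_one_le_left hq0 h1)
  · refine DifferentiableOn.diffContOnCl_ball (U := Metric.closedBall 0 1) ?_ subset_rfl
    intro w hw
    refine DifferentiableAt.differentiableWithinAt ?_
    exact (((differentiableAt_id.const_mul u).const_sub 1).inv (hne w hw)).const_mul _
  · have := hne w hw
    field_simp
    ring
  · rw [norm_mul, norm_inv, norm_pow, mul_comm]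
    gcongr
    exact norm_one_sub_ge hq hu (by simpa using hw)

lemma exists_linApprox_prod {τ : Type*} (s : Finset τ) {M₀ : ℝ} (hM₀ : 0 ≤ M₀) :
    ∃ M, 0 ≤ M ∧ ∀ q : ℝ, 0 ≤ q → q ≤ 1 → ∀ (f : τ → ℂ → ℂ) (f₁ : τ → ℂ),
      (∀ k ∈ s, LinApprox M₀ q (f k) (f₁ k)) →
      LinApprox M q (fun w => ∏ k ∈ s, f k w) (∑ k ∈ s, f₁ k) := by
  classical
  induction s using Finset.induction_on with
  | empty => exact ⟨0, le_rfl, fun q _ _ f f₁ _ => by simpa using linApprox_one q⟩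
  | insert a s ha ih =>
    obtain ⟨M, hM, h⟩ := ih
    refine ⟨M₀ + M + 4 * (M₀ * M), by positivity, fun q hq hq1 f f₁ hf => ?_⟩
    simp only [Finset.prod_insert ha, Finset.sum_insert ha]
    exact (hf a (Finset.mem_insert_self _ _)).mul hM₀ hM hq hq1
      (h q hq hq1 f f₁ fun k hk => hf k (Finset.mem_insert_of_mem hk))

lemma LinApprox.norm_sub_le {M q : ℝ} {f : ℂ → ℂ} {f₁ : ℂ} (h : LinApprox M q f f₁) :
    ‖f 1 - (1 + f₁)‖ ≤ M * q ^ 2 := by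
  obtain ⟨-, F, -, hF⟩ := h
  obtain ⟨h1, h2⟩ := hF 1 (by simp)
  rw [h1]
  convert h2 using 2
  ring

/-- In the product of the two expansions the linear terms pair to f₁g₁, as e(-θ)e(θ) = 1. All other
terms but one are holomorphic in e(θ) or in e(-θ) and vanish at 0, so they integrate to 0. The
exception is F·G, of size q⁴. -/
lemma LinApprox.norm_integral_sub_le {M N q : ℝ} (hM : 0 ≤ M) {f g : ℂ → ℂ} {f₁ g₁ : ℂ}
    (hf : LinApprox M q f f₁) (hg : LinApprox N q g g₁) :
    ‖(∫ θ in (0 : ℝ)..1, f (e (-θ)) * g (e θ)) - (1 + f₁ * g₁)‖ ≤ M * N * q ^ 4 := by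
  obtain ⟨hf₁, F, hF, hfF⟩ := hf
  obtain ⟨hg₁, G, hG, hgG⟩ := hg
  have hid : DiffContOnCl ℂ (fun w : ℂ => w) (Metric.ball 0 1) := differentiable_id.diffContOnCl
  have hmem : ∀ θ, e θ ∈ Metric.closedBall (0 : ℂ) 1 := fun θ => by simp [norm_e]
  have hcont : ∀ {H : ℂ → ℂ}, DiffContOnCl ℂ H (Metric.ball 0 1) →
      Continuous fun θ => H (e θ) := fun {H} hH => by
    have : ContinuousOn H (Metric.closedBall 0 1) := by
      have := hH.continuousOn
      rwa [closure_ball _ one_ne_zero] at this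
    exact this.comp_continuous continuous_e hmem
  set H₁ : ℂ → ℂ := fun w => w * (g₁ + w * G w + f₁ * G w) with hH₁
  set H₂ : ℂ → ℂ := fun w => w * (f₁ + w * F w + g₁ * F w) with hH₂
  have hd₁ : DiffContOnCl ℂ H₁ (Metric.ball 0 1) :=
    diffContOnCl_fun_mul hid (diffContOnCl_fun_add (diffContOnCl_fun_add diffContOnCl_const
      (diffContOnCl_fun_mul hid hG)) (diffContOnCl_fun_mul diffContOnCl_const hG))
  have hd₂ : DiffContOnCl ℂ H₂ (Metric.ball 0 1) :=
    diffContOnCl_fun_mul hid (diffContOnCl_fun_add (diffContOnCl_fun_add diffContOnCl_const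
      (diffContOnCl_fun_mul hid hF)) (diffContOnCl_fun_mul diffContOnCl_const hF))
  -- `H₁` collects the surplus powers of e(θ) and `H₂` those of e(-θ).
  have hpt : ∀ θ, f (e (-θ)) * g (e θ) =
      (1 + f₁ * g₁) + H₁ (e θ) + H₂ (e (-θ)) + F (e (-θ)) * G (e θ) := by
    intro θ
    rw [(hfF _ (hmem (-θ))).1, (hgG _ (hmem θ)).1, hH₁, hH₂]
    have h := e_mul_e_neg θ
    linear_combination (f₁ * g₁ + f₁ * e θ * G (e θ) + e (-θ) * F (e (-θ)) * g₁ +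
      (e (-θ) * e θ + 1) * F (e (-θ)) * G (e θ)) * h
  have hi₁ := integral_comp_e hd₁
  have hi₂ := integral_comp_e_neg hd₂
  have c₁ : Continuous fun θ => H₁ (e θ) := hcont hd₁
  have c₂ : Continuous fun θ => H₂ (e (-θ)) := (hcont hd₂).comp continuous_neg
  have c₃ : Continuous fun θ => F (e (-θ)) := (hcont hF).comp continuous_neg
  have c₄ : Continuous fun θ => G (e θ) := hcont hG
  have hint : ∫ θ in (0 : ℝ)..1, f (e (-θ)) * g (e θ) =
      (1 + f₁ * g₁) + ∫ θ in (0 : ℝ)..1, F (e (-θ)) * G (e θ) := by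
    simp_rw [hpt]
    rw [intervalIntegral.integral_add, intervalIntegral.integral_add,
      intervalIntegral.integral_add, hi₁, hi₂]
    · simp [hH₁, hH₂]
    exacts [continuous_const.intervalIntegrable _ _, c₁.intervalIntegrable _ _,
      (continuous_const.add c₁).intervalIntegrable _ _, c₂.intervalIntegrable _ _,
      ((continuous_const.add c₁).add c₂).intervalIntegrable _ _,
      (c₃.mul c₄).intervalIntegrable _ _]
  rw [hint, add_sub_cancel_left]
  have := intervalIntegral.norm_integral_le_of_norm_le_const (a := (0 : ℝ)) (b := 1)
    (f := fun θ => F (e (-θ)) * G (e θ)) (C := M * N * q ^ 4) ?_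
  · simpa using this
  · intro θ _
    rw [norm_mul]
    calc ‖F (e (-θ))‖ * ‖G (e θ)‖ ≤ (M * q ^ 2) * (N * q ^ 2) := by
          gcongr
          · exact (hfF _ (hmem _)).2
          · exact (hgG _ (hmem _)).2
      _ = _ := by ring

/-- If R = 1 - y and E = 1 + y up to q⁴, then RE = 1 - y² up to q⁴, and y² is itself of this order.
-/
lemma norm_mul_sub_one_le {y R E : ℂ} {M q : ℝ} (hM : 0 ≤ M) (hq : 0 ≤ q) (hq1 : q ≤ 1)
    (hy : ‖y‖ ≤ M * q ^ 2) (hR : ‖R - (1 - y)‖ ≤ M * q ^ 4) (hE : ‖E - (1 + y)‖ ≤ M * q ^ 4) :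
    ‖R * E - 1‖ ≤ (4 * M ^ 2 + 2 * M) * q ^ 4 := by
  have hq4 : q ^ 4 ≤ 1 := pow_le_one₀ hq hq1
  have hq2 : q ^ 2 ≤ 1 := pow_le_one₀ hq hq1
  have h : R * E - 1 = -(y * y) + (E - (1 + y)) * (1 - y) + (R - (1 - y)) * (1 + y) +
      (R - (1 - y)) * (E - (1 + y)) := by ring
  have hyM : ‖y‖ ≤ M := hy.trans (mul_le_of_le_one_right hM hq2)
  have h1 : ‖1 - y‖ ≤ 1 + M := (norm_sub_le _ _).trans (by simpa using hyM)
  have h2 : ‖1 + y‖ ≤ 1 + M := (norm_add_le _ _).trans (by simpa using hyM)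
  have h3 : ‖E - (1 + y)‖ ≤ M := hE.trans (mul_le_of_le_one_right hM hq4)
  rw [h]
  calc _ ≤ ‖y‖ * ‖y‖ + ‖E - (1 + y)‖ * ‖1 - y‖ + ‖R - (1 - y)‖ * ‖1 + y‖ +
        ‖R - (1 - y)‖ * ‖E - (1 + y)‖ := by
        refine (norm_add_le _ _).trans (add_le_add ((norm_add_le _ _).trans (add_le_add
          ((norm_add_le _ _).trans (add_le_add ?_ ?_)) ?_)) ?_) <;>
        simp only [norm_mul, norm_neg, le_refl]
    _ ≤ (M * q ^ 2) * (M * q ^ 2) + (M * q ^ 4) * (1 + M) + (M * q ^ 4) * (1 + M) +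
        (M * q ^ 4) * M := by gcongr
    _ = _ := by ring

variable {ι κ ρ σ : Type*} [Fintype ι] [Fintype κ] [Fintype ρ] [Fintype σ]

/-- The integral over `θ` of products of local factors, in terms of the numbers `p^{-1/2-a}`. -/
lemma exists_bound_ratio_mul_integral (ι κ ρ σ : Type*) [Fintype ι] [Fintype κ] [Fintype ρ]
    [Fintype σ] {q₀ : ℝ} (hq₀ : q₀ < 1) :
    ∃ C : ℝ, 0 ≤ C ∧ ∀ q : ℝ, 0 ≤ q → q ≤ q₀ → ∀ (a : ι → ℂ) (b : κ → ℂ) (c : ρ → ℂ) (d : σ → ℂ),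
      (∀ i, ‖a i‖ ≤ q) → (∀ i, ‖b i‖ ≤ q) → (∀ i, ‖c i‖ ≤ q) → (∀ i, ‖d i‖ ≤ q) →
      ‖((∏ i, ∏ j, (1 - a i * b j)) * (∏ i, ∏ j, (1 - c i * d j)) *
          ((∏ i, ∏ j, (1 - a i * d j)⁻¹) * ∏ i, ∏ j, (1 - b i * c j)⁻¹)) *
        (∫ θ in (0 : ℝ)..1, ((∏ i, (1 - a i * e (-θ))⁻¹) * ∏ k, (1 - c k * e (-θ))) *
          ((∏ j, (1 - b j * e θ)⁻¹) * ∏ l, (1 - d l * e θ))) - 1‖ ≤ C * q ^ 4 := by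
  set M₀ := 1 + (1 - q₀)⁻¹
  have h0 : 0 < 1 - q₀ := by linarith
  have hM₀ : 0 ≤ M₀ := by positivity
  have hmono : ∀ {M q : ℝ} {f : ℂ → ℂ} {f₁ : ℂ}, 0 ≤ q → LinApprox M q f f₁ → M ≤ M₀ →
      LinApprox M₀ q f f₁ := by
    rintro M q f f₁ hq ⟨h1, F, hF, h2⟩ hM
    exact ⟨h1.trans (by gcongr), F, hF, fun w hw => ⟨(h2 w hw).1, (h2 w hw).2.trans (by gcongr)⟩⟩
  have h1M : 1 ≤ M₀ := by simp only [M₀]; have := inv_pos.2 h0; linarith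
  have h2M : (1 - q₀)⁻¹ ≤ M₀ := by simp only [M₀]; linarith
  obtain ⟨Ma, hMa, Ha⟩ := exists_linApprox_prod (Finset.univ : Finset ι) hM₀
  obtain ⟨Mb, hMb, Hb⟩ := exists_linApprox_prod (Finset.univ : Finset κ) hM₀
  obtain ⟨Mc, hMc, Hc⟩ := exists_linApprox_prod (Finset.univ : Finset ρ) hM₀
  obtain ⟨Md, hMd, Hd⟩ := exists_linApprox_prod (Finset.univ : Finset σ) hM₀
  obtain ⟨M1, hM1, H1⟩ := exists_linApprox_prod (Finset.univ : Finset (ι × κ)) hM₀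
  obtain ⟨M2, hM2, H2⟩ := exists_linApprox_prod (Finset.univ : Finset (ρ × σ)) hM₀
  obtain ⟨M3, hM3, H3⟩ := exists_linApprox_prod (Finset.univ : Finset (ι × σ)) hM₀
  obtain ⟨M4, hM4, H4⟩ := exists_linApprox_prod (Finset.univ : Finset (κ × ρ)) hM₀
  set Mf := Ma + Mc + 4 * (Ma * Mc)
  set Mg := Mb + Md + 4 * (Mb * Md)
  set M12 := M1 + M2 + 4 * (M1 * M2)
  set M34 := M3 + M4 + 4 * (M3 * M4)
  set Mr := M12 + M34 + 4 * (M12 * M34)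
  have hMf : 0 ≤ Mf := by positivity
  have hMg : 0 ≤ Mg := by positivity
  have hM12 : 0 ≤ M12 := by positivity
  have hM34 : 0 ≤ M34 := by positivity
  have hMr : 0 ≤ Mr := by positivity
  set M := Mr + Mf * Mg
  have hM : 0 ≤ M := by positivity
  refine ⟨4 * M ^ 2 + 2 * M, by positivity, fun q hq hqq a b c d ha hb hc hd => ?_⟩
  have hq1 : q ≤ 1 := by linarith
  have hqsq : q ^ 2 ≤ q₀ := by nlinarith
  have hq2 : 0 ≤ q ^ 2 := by positivity
  have hq21 : q ^ 2 ≤ 1 := pow_le_one₀ hq hq1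
  have hmul : ∀ {x y : ℂ}, ‖x‖ ≤ q → ‖y‖ ≤ q → ‖x * y‖ ≤ q ^ 2 := fun {x y} hx hy => by
    rw [norm_mul, sq]; gcongr
  have hf := (Ha q hq hq1 _ _ fun i _ => hmono hq (linApprox_inv hq₀ hqq (ha i)) h2M).mul
    hMa hMc hq hq1 (Hc q hq hq1 _ _ fun i _ => hmono hq (linApprox_one_sub (hc i)) h1M)
  have hg := (Hb q hq hq1 _ _ fun i _ => hmono hq (linApprox_inv hq₀ hqq (hb i)) h2M).mul
    hMb hMd hq hq1 (Hd q hq hq1 _ _ fun i _ => hmono hq (linApprox_one_sub (hd i)) h1M)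
  -- The factors of Z_p involve products of two of the numbers, so they are expanded with q² in
  -- place of q and evaluated at w = 1.
  have hr := ((H1 (q ^ 2) hq2 hq21 _ _ fun (k : ι × κ) _ => hmono hq2
      (linApprox_one_sub (hmul (ha k.1) (hb k.2))) h1M).mul hM1 hM2 hq2 hq21
    (H2 (q ^ 2) hq2 hq21 _ _ fun (k : ρ × σ) _ => hmono hq2
      (linApprox_one_sub (hmul (hc k.1) (hd k.2))) h1M)).mul hM12 hM34 hq2 hq21
    ((H3 (q ^ 2) hq2 hq21 _ _ fun (k : ι × σ) _ => hmono hq2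
      (linApprox_inv hq₀ hqsq (hmul (ha k.1) (hd k.2))) h2M).mul hM3 hM4 hq2 hq21
    (H4 (q ^ 2) hq2 hq21 _ _ fun (k : κ × ρ) _ => hmono hq2
      (linApprox_inv hq₀ hqsq (hmul (hb k.1) (hc k.2))) h2M))
  have hI := LinApprox.norm_integral_sub_le hMf hf hg
  have hR := hr.norm_sub_le
  simp only [mul_one, Fintype.prod_prod_type, Fintype.sum_prod_type] at hR
  -- The main term y = (Σa - Σc)(Σb - Σd) of the integral is cancelled by the linear part -Σab - Σcd
  -- + Σad + Σbc of Z_p. This cancellation is the purpose of Z_p.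
  refine norm_mul_sub_one_le (y := (∑ i, a i + ∑ k, -c k) * (∑ j, b j + ∑ l, -d l))
    hM hq hq1 ?_ ?_ ?_
  · rw [norm_mul]
    calc _ ≤ (Mf * q) * (Mg * q) := by
            gcongr
            · exact hf.1
            · exact hg.1
      _ = (Mf * Mg) * q ^ 2 := by ring
      _ ≤ M * q ^ 2 := by gcongr; simp only [M]; linarith
  · calc _ = _ := ?_
      _ ≤ _ := hR
      _ ≤ M * q ^ 4 := by
        rw [← pow_mul]
        gcongr
        simp only [M]; have := mul_nonneg hMf hMg; linarith
    congr 2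
    simp only [Finset.sum_neg_distrib, ← Finset.mul_sum, ← Finset.sum_mul]
    ring
  · refine hI.trans ?_
    gcongr
    simp only [M]; linarith

end LocalEstimate

/-! ### The local factors of the Euler product -/

section ArithLocal

variable {ι κ ρ σ : Type} [Fintype ι] [Fintype κ] [Fintype ρ] [Fintype σ]

/-- Since p^(-1-x-y) = p^(-1/2-x) p^(-1/2-y), both Z_p and the integrand are expressed by the same
small numbers p^(-1/2-a). -/
lemma arithLocal_eq {p : ℕ} (hp : p.Prime) (a : ι → ℂ) (b : κ → ℂ) (c : ρ → ℂ) (d : σ → ℂ) :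
    arithLocal p a b c d =
      ((∏ i, ∏ j, (1 - (p : ℂ) ^ (-(1 / 2 + a i)) * (p : ℂ) ^ (-(1 / 2 + b j)))) *
        (∏ i, ∏ j, (1 - (p : ℂ) ^ (-(1 / 2 + c i)) * (p : ℂ) ^ (-(1 / 2 + d j)))) *
          ((∏ i, ∏ j, (1 - (p : ℂ) ^ (-(1 / 2 + a i)) * (p : ℂ) ^ (-(1 / 2 + d j)))⁻¹) *
            ∏ i, ∏ j, (1 - (p : ℂ) ^ (-(1 / 2 + b i)) * (p : ℂ) ^ (-(1 / 2 + c j)))⁻¹)) *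
        (∫ θ in (0 : ℝ)..1, ((∏ i, (1 - (p : ℂ) ^ (-(1 / 2 + a i)) * e (-θ))⁻¹) *
          ∏ k, (1 - (p : ℂ) ^ (-(1 / 2 + c k)) * e (-θ))) *
          ((∏ j, (1 - (p : ℂ) ^ (-(1 / 2 + b j)) * e θ)⁻¹) *
            ∏ l, (1 - (p : ℂ) ^ (-(1 / 2 + d l)) * e θ))) := by
  have hp0 : (p : ℂ) ≠ 0 := by exact_mod_cast hp.ne_zero
  have hpow : ∀ x y : ℂ, (p : ℂ) ^ (-(1 / 2 + x)) * (p : ℂ) ^ (-(1 / 2 + y)) =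
      (p : ℂ) ^ (-(1 + x + y)) := fun x y => by
    rw [← Complex.cpow_add _ _ hp0]; congr 1; ring
  unfold arithLocal localRatio localProd localIntegrand localZeta twistedLocalZeta
  simp only [hpow]
  simp only [inv_inv, Finset.prod_inv_distrib, div_eq_mul_inv, mul_inv]
  congr 1
  refine intervalIntegral.integral_congr fun θ _ => ?_
  simp only [mul_comm (e _)]
  ring

lemma norm_prime_cpow_le {p : ℕ} (hp : p.Prime) {δ : ℝ} {x : ℂ} (hx : -(1 / 4) + δ ≤ x.re) :
    ‖(p : ℂ) ^ (-(1 / 2 + x))‖ ≤ (p : ℝ) ^ (-(1 / 4 + δ)) := by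
  rw [Complex.norm_natCast_cpow_of_pos hp.pos]
  refine Real.rpow_le_rpow_of_exponent_le (by exact_mod_cast hp.one_le) ?_
  simp
  linarith

/-- The local factors are `1 + O(p^{-1-4δ})`. -/
lemma exists_bound_arithLocal (ι κ ρ σ : Type) [Fintype ι] [Fintype κ] [Fintype ρ] [Fintype σ]
    {δ : ℝ} (hδ : 0 ≤ δ) :
    ∃ C : ℝ, 0 ≤ C ∧ ∀ (p : Nat.Primes) (a : ι → ℂ) (b : κ → ℂ) (c : ρ → ℂ) (d : σ → ℂ),
      (∀ i, -(1 / 4) + δ ≤ (a i).re) → (∀ i, -(1 / 4) + δ ≤ (b i).re) →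
      (∀ i, -(1 / 4) + δ ≤ (c i).re) → (∀ i, -(1 / 4) + δ ≤ (d i).re) →
      ‖arithLocal p a b c d - 1‖ ≤ C * (p : ℝ) ^ (-(1 + 4 * δ)) := by
  -- The small parameter is q = p^(-1/4-δ), at most 2^(-1/4) for all primes at once, and q⁴ =
  -- p^(-1-4δ).
  have hq₀ : (2 : ℝ) ^ (-(1 / 4 : ℝ)) < 1 :=
    Real.rpow_lt_one_of_one_lt_of_neg (by norm_num) (by norm_num)
  obtain ⟨C, hC, h⟩ := exists_bound_ratio_mul_integral ι κ ρ σ hq₀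
  refine ⟨C, hC, fun p a b c d ha hb hc hd => ?_⟩
  have hp2 : (2 : ℝ) ≤ (p : ℕ) := by exact_mod_cast p.2.two_le
  have hp1 : (1 : ℝ) ≤ (p : ℕ) := by linarith
  have hp0 : (0 : ℝ) ≤ (p : ℕ) := by linarith
  have hq4 : ((p : ℕ) : ℝ) ^ (-(1 + 4 * δ)) = (((p : ℕ) : ℝ) ^ (-(1 / 4 + δ))) ^ 4 := by
    rw [← Real.rpow_natCast, ← Real.rpow_mul hp0]
    congr 1
    push_cast
    ring
  rw [arithLocal_eq p.2, hq4]
  refine h _ (by positivity) ?_ _ _ _ _ (fun i => norm_prime_cpow_le p.2 (ha i))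
    (fun i => norm_prime_cpow_le p.2 (hb i)) (fun i => norm_prime_cpow_le p.2 (hc i))
    (fun i => norm_prime_cpow_le p.2 (hd i))
  calc ((p : ℕ) : ℝ) ^ (-(1 / 4 + δ)) ≤ ((p : ℕ) : ℝ) ^ (-(1 / 4 : ℝ)) :=
        Real.rpow_le_rpow_of_exponent_le hp1 (by linarith)
    _ ≤ 2 ^ (-(1 / 4 : ℝ)) := Real.rpow_le_rpow_of_nonpos (by norm_num) hp2 (by norm_num)

lemma summable_primes_rpow {δ : ℝ} (hδ : 0 < δ) (C : ℝ) :
    Summable fun p : Nat.Primes => C * (p : ℝ) ^ (-(1 + 4 * δ)) :=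
  (Nat.Primes.summable_rpow.2 (by linarith)).mul_left C

end ArithLocal

/-! ### Zeros and holomorphy of ζ, 1/ζ, χ and z_p -/

section ZetaFunctions

lemma riemannZeta_ne_zero_of_half_lt_re (hRH : RiemannHypothesis) {s : ℂ} (hs : 1 / 2 < s.re) :
    riemannZeta s ≠ 0 := by
  intro h
  by_cases h1 : s = 1
  -- The Riemann Hypothesis says nothing at s = 1, where ζ has a default value; that value is
  -- nonzero.
  · exact riemannZeta_ne_zero_of_one_le_re (by simp [h1]) h
  · have := hRH s h ?_ h1
    · linarith
    · rintro ⟨n, rfl⟩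
      have h2 : (-2 * ((n : ℂ) + 1)).re = -2 * ((n : ℝ) + 1) := by simp
      rw [h2] at hs
      have : (0 : ℝ) ≤ n := Nat.cast_nonneg n
      linarith

lemma invZeta_eventuallyEq {s : ℂ} (hs : s ≠ 1) :
    invZeta =ᶠ[𝓝 s] fun x => (riemannZeta x)⁻¹ := by
  filter_upwards [isOpen_ne.mem_nhds hs] with x hx
  simp only [invZeta, if_neg (show ¬ x = 1 from hx)]

lemma invZeta_one : invZeta 1 = 0 := by simp [invZeta]

/-- The residue 1 of ζ makes the zero of 1/ζ simple with slope 1. These zeros select the derivatives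
that survive in the main term. -/
lemma hasDerivAt_invZeta_one : HasDerivAt invZeta 1 1 := by
  rw [hasDerivAt_iff_tendsto_slope]
  have h := (riemannZeta_residue_one).inv₀ one_ne_zero
  rw [inv_one] at h
  refine h.congr' ?_
  filter_upwards [self_mem_nhdsWithin] with x hx
  rw [slope_def_field, invZeta_one, sub_zero, invZeta, if_neg (show ¬ x = 1 from hx), mul_inv, div_eq_mul_inv,
    mul_comm]

lemma differentiableAt_invZeta (hRH : RiemannHypothesis) {s : ℂ} (hs : 1 / 2 < s.re) :
    DifferentiableAt ℂ invZeta s := by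
  rcases eq_or_ne s 1 with rfl | h
  · exact hasDerivAt_invZeta_one.differentiableAt
  · exact ((differentiableAt_riemannZeta h).inv
      (riemannZeta_ne_zero_of_half_lt_re hRH hs)).congr_of_eventuallyEq (invZeta_eventuallyEq h)

lemma differentiableAt_chi {s : ℂ} (hs : s.re < 1) : DifferentiableAt ℂ chi s := by
  have h2 : (2 * Real.pi : ℂ) ≠ 0 := by simp [Real.pi_ne_zero]
  have hG : DifferentiableAt ℂ (fun s : ℂ => Complex.Gamma (1 - s)) s := by
    refine DifferentiableAt.comp s (g := Complex.Gamma) (f := fun s => 1 - s)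
      (Complex.differentiableAt_Gamma _ fun m h => ?_) (by fun_prop)
    have h3 : (1 - s).re = -(m : ℝ) := by rw [h]; simp
    simp at h3
    have : (0 : ℝ) ≤ m := Nat.cast_nonneg m
    linarith
  have hP : DifferentiableAt ℂ (fun s : ℂ => (2 * Real.pi : ℂ) ^ (-(1 - s))) s :=
    DifferentiableAt.const_cpow (by fun_prop) (Or.inl h2)
  unfold chi
  exact ((hP.const_mul 2).mul hG).mul (by fun_prop)

lemma prime_cpow_norm_lt_one {p : ℕ} (hp : p.Prime) {s : ℂ} (hs : 0 < s.re) :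
    ‖(p : ℂ) ^ (-s)‖ < 1 := by
  rw [Complex.norm_natCast_cpow_of_pos hp.pos]
  exact Real.rpow_lt_one_of_one_lt_of_neg (by exact_mod_cast hp.one_lt) (by simpa using hs)

lemma differentiable_prime_cpow {p : ℕ} (hp : p.Prime) :
    Differentiable ℂ fun s : ℂ => (p : ℂ) ^ (-s) := fun s =>
  DifferentiableAt.const_cpow (by fun_prop) (Or.inl (by exact_mod_cast hp.ne_zero))

lemma one_sub_ne_zero_of_norm_lt {z : ℂ} (hz : ‖z‖ < 1) : 1 - z ≠ 0 := by
  intro h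
  rw [← sub_eq_zero.1 h, norm_one] at hz
  exact lt_irrefl _ hz

lemma localZeta_ne_zero {p : ℕ} (hp : p.Prime) {s : ℂ} (hs : 0 < s.re) : localZeta p s ≠ 0 :=
  inv_ne_zero (one_sub_ne_zero_of_norm_lt (prime_cpow_norm_lt_one hp hs))

lemma differentiableAt_localZeta {p : ℕ} (hp : p.Prime) {s : ℂ} (hs : 0 < s.re) :
    DifferentiableAt ℂ (localZeta p) s :=
  ((differentiable_prime_cpow hp s).const_sub 1).inv
    (one_sub_ne_zero_of_norm_lt (prime_cpow_norm_lt_one hp hs))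

lemma twistedLocalZeta_ne_zero {p : ℕ} (hp : p.Prime) (θ : ℝ) {s : ℂ} (hs : 0 < s.re) :
    twistedLocalZeta p θ s ≠ 0 := by
  refine inv_ne_zero (one_sub_ne_zero_of_norm_lt ?_)
  rw [norm_mul, norm_e, one_mul]
  exact prime_cpow_norm_lt_one hp hs

end ZetaFunctions

/-! ### Inverses and freezing of variables -/

section SepHolInverse

variable {P : Type*} [TopologicalSpace P] {ν : Type*} [Fintype ν] [DecidableEq ν]
  {Ω : Set (ν → ℂ)}

lemma SepHol.inv {K : P → (ν → ℂ) → ℂ} (hK : SepHol Ω K) (h : ∀ p, ∀ x ∈ Ω, K p x ≠ 0) :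
    SepHol Ω (fun p x => (K p x)⁻¹) :=
  ⟨hK.cont.inv₀ fun q hq => h q.1 q.2 hq.2, fun p x hx i =>
    (hK.diff p x hx i).fun_inv (by simpa using h p x hx)⟩

lemma Hol.comp_freeze {F : (ν → ℂ) → ℂ} (hF : Hol Ω F) (Q : Finset ν) (x₀ : ν → ℂ) :
    Hol (freeze Q x₀ ⁻¹' Ω) (fun x => F (freeze Q x₀ x)) := by
  constructor
  · exact (hF.continuousOn.comp (continuous_freeze Q x₀).continuousOn (fun x hx => hx)).comp
      continuousOn_snd (fun q hq => hq.2)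
  · intro _ x hx i
    by_cases hi : i ∈ Q
    · simp only [freeze_update x₀ x hi]
      have := hF.diff () _ hx i
      simpa [freeze, hi] using this
    · have : ∀ z, freeze Q x₀ (update x i z) = freeze Q x₀ x := by
        intro z; funext j
        by_cases hj : j ∈ Q
        · have : j ≠ i := fun h => hi (h ▸ hj)
          simp [freeze, hj, this]
        · simp [freeze, hj]
      simp only [this]
      exact differentiableAt_const _

end SepHolInverse

/-! ### Convergence and holomorphy of the Euler product -/

section ArithHolomorphy

variable {ν : Type*} [Fintype ν] [DecidableEq ν] {Ω : Set (ν → ℂ)}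
  {ι κ ρ σ : Type} [Fintype ι] [Fintype κ] [Fintype ρ] [Fintype σ]

/-- A family of shifts depending holomorphically on `x`, with real parts at least `r` on `Ω`. -/
structure HolShifts (Ω : Set (ν → ℂ)) (r : ℝ) (a : (ν → ℂ) → ι → ℂ) : Prop where
  diff : ∀ x ∈ Ω, ∀ i, DifferentiableAt ℂ (fun x => a x i) x
  re_ge : ∀ x ∈ Ω, ∀ i, r ≤ (a x i).re

lemma HolShifts.hol_cpow {r : ℝ} {a : (ν → ℂ) → ι → ℂ} (ha : HolShifts Ω r a) {p : ℕ}
    (hp : p.Prime) (i : ι) : Hol Ω (fun x => (p : ℂ) ^ (-(1 / 2 + a x i))) :=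
  hol_of_differentiableAt fun x hx =>
    DifferentiableAt.const_cpow (((ha.diff x hx i).const_add _).neg)
      (Or.inl (by exact_mod_cast hp.ne_zero))

lemma HolShifts.norm_cpow_lt {r : ℝ} (hr : -(1 / 2) < r) {a : (ν → ℂ) → ι → ℂ}
    (ha : HolShifts Ω r a) {p : ℕ} (hp : p.Prime) (i : ι) {x : ν → ℂ} (hx : x ∈ Ω) :
    ‖(p : ℂ) ^ (-(1 / 2 + a x i))‖ < 1 := by
  refine prime_cpow_norm_lt_one hp ?_
  have := ha.re_ge x hx i
  simp
  linarith

lemma hol_one_sub_mul {f g : (ν → ℂ) → ℂ} (hf : Hol Ω f) (hg : Hol Ω g) :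
    Hol Ω (fun x => 1 - f x * g x) :=
  SepHol.sub (SepHol.const _ continuous_const) (hf.mul hg)

lemma one_sub_mul_ne_zero {z w : ℂ} (hz : ‖z‖ < 1) (hw : ‖w‖ < 1) : 1 - z * w ≠ 0 :=
  one_sub_ne_zero_of_norm_lt (by
    rw [norm_mul]; exact mul_lt_one_of_nonneg_of_lt_one_left (norm_nonneg _) hz hw.le)

lemma hol_arithLocal (hΩ : IsOpen Ω) {r : ℝ} (hr : -(1 / 2) < r) {a : (ν → ℂ) → ι → ℂ}
    {b : (ν → ℂ) → κ → ℂ} {c : (ν → ℂ) → ρ → ℂ} {d : (ν → ℂ) → σ → ℂ} (ha : HolShifts Ω r a)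
    (hb : HolShifts Ω r b) (hc : HolShifts Ω r c) (hd : HolShifts Ω r d) {p : ℕ} (hp : p.Prime) :
    Hol Ω (fun x => arithLocal p (a x) (b x) (c x) (d x)) := by
  simp only [arithLocal_eq hp]
  have hneg : Continuous fun θ : Unit × ℝ => e (-θ.2) := continuous_e.comp continuous_snd.neg
  have hpos : Continuous fun θ : Unit × ℝ => e θ.2 := continuous_e.comp continuous_snd
  have hint : SepHol Ω (fun (θ : Unit × ℝ) x =>
      ((∏ i, (1 - (p : ℂ) ^ (-(1 / 2 + a x i)) * e (-θ.2))⁻¹) *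
        ∏ k, (1 - (p : ℂ) ^ (-(1 / 2 + c x k)) * e (-θ.2))) *
        ((∏ j, (1 - (p : ℂ) ^ (-(1 / 2 + b x j)) * e θ.2)⁻¹) *
          ∏ l, (1 - (p : ℂ) ^ (-(1 / 2 + d x l)) * e θ.2))) := by
    refine SepHol.mul (SepHol.mul ?_ ?_) (SepHol.mul ?_ ?_)
    · exact SepHol.finset_prod fun i _ => ((SepHol.const _ continuous_const).sub
        ((ha.hol_cpow hp i).param.mul (SepHol.const _ hneg))).inv fun θ x hx =>
          one_sub_ne_zero_of_norm_lt (by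
            rw [norm_mul, norm_e, mul_one]; exact ha.norm_cpow_lt hr hp i hx)
    · exact SepHol.finset_prod fun i _ => (SepHol.const _ continuous_const).sub
        ((hc.hol_cpow hp i).param.mul (SepHol.const _ hneg))
    · exact SepHol.finset_prod fun i _ => ((SepHol.const _ continuous_const).sub
        ((hb.hol_cpow hp i).param.mul (SepHol.const _ hpos))).inv fun θ x hx =>
          one_sub_ne_zero_of_norm_lt (by
            rw [norm_mul, norm_e, mul_one]; exact hb.norm_cpow_lt hr hp i hx)
    · exact SepHol.finset_prod fun i _ => (SepHol.const _ continuous_const).sub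
        ((hd.hol_cpow hp i).param.mul (SepHol.const _ hpos))
  refine SepHol.mul (SepHol.mul (SepHol.mul ?_ ?_) (SepHol.mul ?_ ?_)) (hint.integral hΩ 0 1)
  · exact SepHol.finset_prod fun i _ => SepHol.finset_prod fun j _ =>
      hol_one_sub_mul (ha.hol_cpow hp i) (hb.hol_cpow hp j)
  · exact SepHol.finset_prod fun i _ => SepHol.finset_prod fun j _ =>
      hol_one_sub_mul (hc.hol_cpow hp i) (hd.hol_cpow hp j)
  · exact SepHol.finset_prod fun i _ => SepHol.finset_prod fun j _ =>
      (hol_one_sub_mul (ha.hol_cpow hp i) (hd.hol_cpow hp j)).inv fun _ x hx =>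
        one_sub_mul_ne_zero (ha.norm_cpow_lt hr hp i hx) (hd.norm_cpow_lt hr hp j hx)
  · exact SepHol.finset_prod fun i _ => SepHol.finset_prod fun j _ =>
      (hol_one_sub_mul (hb.hol_cpow hp i) (hc.hol_cpow hp j)).inv fun _ x hx =>
        one_sub_mul_ne_zero (hb.norm_cpow_lt hr hp i hx) (hc.norm_cpow_lt hr hp j hx)

/-- The bound for the local factors minus 1 is summable over the primes and uniform in x, because
the real parts stay δ above -1/4. -/
lemma tendstoLocallyUniformlyOn_arith (hΩ : IsOpen Ω) {δ : ℝ} (hδ : 0 < δ)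
    {a : (ν → ℂ) → ι → ℂ} {b : (ν → ℂ) → κ → ℂ} {c : (ν → ℂ) → ρ → ℂ} {d : (ν → ℂ) → σ → ℂ}
    (ha : HolShifts Ω (-(1 / 4) + δ) a) (hb : HolShifts Ω (-(1 / 4) + δ) b)
    (hc : HolShifts Ω (-(1 / 4) + δ) c) (hd : HolShifts Ω (-(1 / 4) + δ) d) :
    TendstoLocallyUniformlyOn
      (fun (s : Finset Nat.Primes) x => ∏ p ∈ s, arithLocal p (a x) (b x) (c x) (d x))
      (fun x => arithFactor (a x) (b x) (c x) (d x)) atTop Ω := by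
  obtain ⟨C, hC, h⟩ := exists_bound_arithLocal ι κ ρ σ hδ.le
  have := Summable.hasProdLocallyUniformlyOn_one_add
    (f := fun (p : Nat.Primes) x => arithLocal p (a x) (b x) (c x) (d x) - 1) hΩ
    (summable_primes_rpow hδ C)
    (Eventually.of_forall fun p x hx => h p _ _ _ _ (ha.re_ge x hx) (hb.re_ge x hx)
      (hc.re_ge x hx) (hd.re_ge x hx))
    (fun p => ((hol_arithLocal hΩ (by linarith) ha hb hc hd p.2).continuousOn).sub
      continuousOn_const)
  rw [hasProdLocallyUniformlyOn_iff_tendstoLocallyUniformlyOn] at this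
  simpa [arithFactor] using this

lemma multipliable_arithLocal {a : ι → ℂ} {b : κ → ℂ} {c : ρ → ℂ} {d : σ → ℂ}
    {δ : ℝ} (hδ : 0 < δ)
    (ha : ∀ i, -(1 / 4) + δ ≤ (a i).re) (hb : ∀ i, -(1 / 4) + δ ≤ (b i).re)
    (hc : ∀ i, -(1 / 4) + δ ≤ (c i).re) (hd : ∀ i, -(1 / 4) + δ ≤ (d i).re) :
    Multipliable fun p : Nat.Primes => arithLocal p a b c d := by
  obtain ⟨C, hC, h⟩ := exists_bound_arithLocal ι κ ρ σ hδ.le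
  have := multipliable_one_add_of_summable (f := fun p : Nat.Primes => arithLocal p a b c d - 1)
    (Summable.of_nonneg_of_le (fun _ => norm_nonneg _) (fun p => h p a b c d ha hb hc hd)
      (summable_primes_rpow hδ C))
  simpa using this

lemma arithFactor_ne_zero {a : ι → ℂ} {b : κ → ℂ} {c : ρ → ℂ} {d : σ → ℂ} {δ : ℝ} (hδ : 0 < δ)
    (ha : ∀ i, -(1 / 4) + δ ≤ (a i).re) (hb : ∀ i, -(1 / 4) + δ ≤ (b i).re)
    (hc : ∀ i, -(1 / 4) + δ ≤ (c i).re) (hd : ∀ i, -(1 / 4) + δ ≤ (d i).re)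
    (hne : ∀ p : Nat.Primes, arithLocal p a b c d ≠ 0) : arithFactor a b c d ≠ 0 := by
  obtain ⟨C, hC, h⟩ := exists_bound_arithLocal ι κ ρ σ hδ.le
  have := tprod_one_add_ne_zero_of_summable
    (f := fun p : Nat.Primes => arithLocal p a b c d - 1) (by simpa using hne)
    (Summable.of_nonneg_of_le (fun _ => norm_nonneg _) (fun p => h p a b c d ha hb hc hd)
      (summable_primes_rpow hδ C))
  simpa [arithFactor] using this

end ArithHolomorphy

/-! ### Functions with a known logarithm of their jet -/

section LogHol

variable {ν : Type*} [Fintype ν] [DecidableEq ν]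

/-- `F` is holomorphic in each variable, and continuous, in a neighbourhood of `x`. -/
def HolAt (F : (ν → ℂ) → ℂ) (x : ν → ℂ) : Prop := ∃ Ω, IsOpen Ω ∧ x ∈ Ω ∧ Hol Ω F

lemma Hol.holAt {Ω : Set (ν → ℂ)} {F : (ν → ℂ) → ℂ} (hF : Hol Ω F) (hΩ : IsOpen Ω) {x : ν → ℂ}
    (hx : x ∈ Ω) : HolAt F x := ⟨Ω, hΩ, hx, hF⟩

lemma HolAt.exists_common {F G : (ν → ℂ) → ℂ} {x : ν → ℂ} (hF : HolAt F x) (hG : HolAt G x) :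
    ∃ Ω, IsOpen Ω ∧ x ∈ Ω ∧ Hol Ω F ∧ Hol Ω G := by
  obtain ⟨Ω, ho, hx, hF⟩ := hF
  obtain ⟨Ω', ho', hx', hG⟩ := hG
  exact ⟨Ω ∩ Ω', ho.inter ho', ⟨hx, hx'⟩, hF.mono inter_subset_left, hG.mono inter_subset_right⟩

lemma HolAt.mul {F G : (ν → ℂ) → ℂ} {x : ν → ℂ} (hF : HolAt F x) (hG : HolAt G x) :
    HolAt (fun y => F y * G y) x := by
  obtain ⟨Ω, ho, hx, hF, hG⟩ := hF.exists_common hG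
  exact ⟨Ω, ho, hx, SepHol.mul hF hG⟩

lemma jet_mul' {F G : (ν → ℂ) → ℂ} {x : ν → ℂ} (hF : HolAt F x) (hG : HolAt G x) :
    jet (fun y => F y * G y) x = subsetConv (jet F x) (jet G x) := by
  obtain ⟨Ω, ho, hx, hF, hG⟩ := hF.exists_common hG
  exact jet_mul ho hF hG hx

/-- `F` is holomorphic near `x`, and `κ` is the logarithm of its jet at `x`. -/
structure LogHol (U : Finset ν) (F : (ν → ℂ) → ℂ) (x : ν → ℂ) (κ : Finset ν → ℂ) : Prop where
  holAt : HolAt F x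
  isLogOn : IsLogOn U (jet F x) κ

lemma LogHol.mul {U : Finset ν} {F G : (ν → ℂ) → ℂ} {x : ν → ℂ} {κ l : Finset ν → ℂ}
    (hF : LogHol U F x κ) (hG : LogHol U G x l) :
    LogHol U (fun y => F y * G y) x (fun W => κ W + l W) := by
  refine ⟨hF.holAt.mul hG.holAt, ?_⟩
  rw [jet_mul' hF.holAt hG.holAt]
  exact hF.isLogOn.mul hG.isLogOn

lemma LogHol.congr {U : Finset ν} {F : (ν → ℂ) → ℂ} {x : ν → ℂ} {κ l : Finset ν → ℂ}
    (hF : LogHol U F x κ) (h : ∀ W ⊆ U, W.Nonempty → l W = κ W) : LogHol U F x l :=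
  ⟨hF.holAt, hF.isLogOn.congr (fun _ _ => rfl) h⟩

lemma logHol_const (U : Finset ν) (c : ℂ) (x : ν → ℂ) :
    LogHol U (fun _ => c) x (fun _ => 0) := by
  refine ⟨⟨univ, isOpen_univ, trivial, SepHol.const _ continuous_const⟩, ?_⟩
  have : jet (fun _ : ν → ℂ => c) x = fun X => if X = ∅ then c else 0 :=
    funext (jet_const c x)
  rw [this]
  exact isLogOn_const U c

lemma LogHol.prod {U : Finset ν} {τ : Type*} (s : Finset τ) {F : τ → (ν → ℂ) → ℂ} {x : ν → ℂ}
    {κ : τ → Finset ν → ℂ} (hF : ∀ k ∈ s, LogHol U (F k) x (κ k)) :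
    LogHol U (fun y => ∏ k ∈ s, F k y) x (fun W => ∑ k ∈ s, κ k W) := by
  classical
  induction s using Finset.induction_on with
  | empty => simpa using logHol_const U 1 x
  | insert a s ha ih =>
    simp only [Finset.prod_insert ha, Finset.sum_insert ha]
    exact (hF a (Finset.mem_insert_self _ _)).mul
      (ih fun k hk => hF k (Finset.mem_insert_of_mem hk))

/-- Adding w ∈ Q to the set of differentiations amounts to replacing φ by φ' = φ·(φ'/φ), and the
Leibniz rule for this product is the recursion that defines a logarithm. For w outside Q both sides
are 0. -/
lemma logHol_comp_sum (U Q : Finset ν) {φ : ℂ → ℂ} {x : ν → ℂ}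
    (hφ : ∀ᶠ z in 𝓝 (∑ k ∈ Q, x k), DifferentiableAt ℂ φ z) (hne : φ (∑ k ∈ Q, x k) ≠ 0) :
    LogHol U (fun y => φ (∑ k ∈ Q, y k)) x (fun W => if W ⊆ Q then
      iteratedDeriv (W.card - 1) (logDeriv φ) (∑ k ∈ Q, x k) else 0) := by
  have hcont : Continuous fun y : ν → ℂ => ∑ k ∈ Q, y k := by fun_prop
  have hdiff : ∀ y, DifferentiableAt ℂ (fun y : ν → ℂ => ∑ k ∈ Q, y k) y := fun y => by fun_prop
  have hev : ∀ᶠ z in 𝓝 (∑ k ∈ Q, x k), DifferentiableAt ℂ φ z ∧ φ z ≠ 0 :=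
    hφ.and (hφ.self_of_nhds.continuousAt.eventually_ne hne)
  obtain ⟨D, hD, hDo, hxD⟩ := eventually_nhds_iff.1 hev
  have hφD : DifferentiableOn ℂ φ D := fun z hz => (hD z hz).1.differentiableWithinAt
  have hLD : DifferentiableOn ℂ (logDeriv φ) D :=
    (hφD.deriv hDo).div hφD fun z hz => (hD z hz).2
  have hΩ : IsOpen ((fun y : ν → ℂ => ∑ k ∈ Q, y k) ⁻¹' D) := hDo.preimage hcont
  set Ω := (fun y : ν → ℂ => ∑ k ∈ Q, y k) ⁻¹' D
  have hF : Hol Ω (fun y => φ (∑ k ∈ Q, y k)) := hol_of_differentiableAt fun y hy =>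
    (hD _ hy).1.comp y (hdiff y)
  have hL : Hol Ω (fun y => logDeriv φ (∑ k ∈ Q, y k)) := hol_of_differentiableAt fun y hy =>
    (hLD.differentiableAt (hDo.mem_nhds hy)).comp y (hdiff y)
  refine ⟨hF.holAt hΩ hxD, fun V w hw _ => ?_⟩
  have hjet : jet (fun y => deriv φ (∑ k ∈ Q, y k)) x =
      subsetConv (jet (fun y => φ (∑ k ∈ Q, y k)) x)
        (jet (fun y => logDeriv φ (∑ k ∈ Q, y k)) x) := by
    rw [← jet_mul hΩ hF hL hxD]
    refine jet_congr hΩ (fun y hy => ?_) hxD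
    rw [logDeriv_apply, mul_div_cancel₀ _ (hD _ hy).2]
  rw [jet_comp_sum]
  by_cases hwQ : w ∈ Q
  · have hsub : insert w V ⊆ Q ↔ V ⊆ Q := by simp [Finset.insert_subset_iff, hwQ]
    simp only [hsub, Finset.card_insert_of_notMem hw]
    rw [iteratedDeriv_succ', ← jet_comp_sum, hjet]
    refine subsetConv_congr (fun _ _ => rfl) fun X hX => ?_
    have hwX : w ∉ X := fun h => hw (hX h)
    simp only [jet_comp_sum, Finset.insert_subset_iff, hwQ, true_and,
      Finset.card_insert_of_notMem hwX, Nat.add_sub_cancel]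
  · have h0 : ∀ X, ¬ (insert w X ⊆ Q) := fun X h => hwQ (h (Finset.mem_insert_self _ _))
    simp [h0, subsetConv]

lemma logHol_comp_single (U : Finset ν) (w : ν) {φ : ℂ → ℂ} {x : ν → ℂ}
    (hφ : ∀ᶠ z in 𝓝 (x w), DifferentiableAt ℂ φ z) (hne : φ (x w) ≠ 0) :
    LogHol U (fun y => φ (y w)) x (fun W => if W = {w} then logDeriv φ (x w) else 0) := by
  have := logHol_comp_sum U {w} (φ := φ) (x := x) (by simpa using hφ) (by simpa using hne)
  simp only [Finset.sum_singleton] at this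
  refine this.congr fun W _ hW => ?_
  simp only [Finset.subset_singleton_iff, hW.ne_empty, false_or]
  split_ifs with h
  · simp [h]
  · rfl

lemma logHol_comp_pair (U : Finset ν) {v w : ν} (hvw : v ≠ w) {φ : ℂ → ℂ} {x : ν → ℂ}
    (hφ : ∀ᶠ z in 𝓝 (x v + x w), DifferentiableAt ℂ φ z) (hne : φ (x v + x w) ≠ 0) :
    LogHol U (fun y => φ (y v + y w)) x (fun W =>
      (if W = {v} then logDeriv φ (x v + x w) else 0) +
      (if W = {w} then logDeriv φ (x v + x w) else 0) +
      (if W = {v, w} then deriv (logDeriv φ) (x v + x w) else 0)) := by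
  have := logHol_comp_sum U {v, w} (φ := φ) (x := x) (by rwa [Finset.sum_pair hvw])
    (by rwa [Finset.sum_pair hvw])
  simp only [Finset.sum_pair hvw] at this
  refine this.congr fun W _ hW => ?_
  have h12 : ({v} : Finset ν) ≠ {w} := by simpa using hvw
  have h13 : ({v} : Finset ν) ≠ {v, w} := fun h => by
    have := congrArg Finset.card h; rw [Finset.card_pair hvw] at this; simp at this
  have h23 : ({w} : Finset ν) ≠ {v, w} := fun h => by
    have := congrArg Finset.card h; rw [Finset.card_pair hvw] at this; simp at this
  by_cases h1 : W = {v}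
  · subst h1; simp [h12, h13]
  by_cases h2 : W = {w}
  · subst h2; simp [h12.symm, h23]
  by_cases h3 : W = {v, w}
  · subst h3; simp [h13.symm, h23.symm, Finset.card_pair hvw]
  have : ¬ W ⊆ {v, w} := by
    intro h
    by_cases hv : v ∈ W <;> by_cases hw : w ∈ W
    · exact h3 (h.antisymm (by simp [Finset.insert_subset_iff, hv, hw]))
    · refine h1 (Finset.eq_singleton_iff_unique_mem.2 ⟨hv, fun y hy => ?_⟩)
      rcases Finset.mem_insert.1 (h hy) with h | h
      · exact h
      · exact absurd (Finset.mem_singleton.1 h ▸ hy) hw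
    · refine h2 (Finset.eq_singleton_iff_unique_mem.2 ⟨hw, fun y hy => ?_⟩)
      rcases Finset.mem_insert.1 (h hy) with h | h
      · exact absurd (h ▸ hy) hv
      · exact Finset.mem_singleton.1 h
    · obtain ⟨y, hy⟩ := hW
      rcases Finset.mem_insert.1 (h hy) with h | h
      · exact hv (h ▸ hy)
      · exact hw (Finset.mem_singleton.1 h ▸ hy)
  simp [h1, h2, h3, this]

end LogHol

/-! ### The logarithm of the zeta factors -/

section PairFactors

variable {ι κ : Type} [Fintype ι] [Fintype κ] [DecidableEq ι] [DecidableEq κ]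

/-- `D` is an open set on which `f` is holomorphic without zeros, with inverse `g`. -/
structure InvPair (D : Set ℂ) (f g : ℂ → ℂ) : Prop where
  isOpen : IsOpen D
  diff : ∀ z ∈ D, DifferentiableAt ℂ f z
  ne_zero : ∀ z ∈ D, f z ≠ 0
  inv : ∀ z ∈ D, g z = (f z)⁻¹

lemma InvPair.symm {D : Set ℂ} {f g : ℂ → ℂ} (h : InvPair D f g) : InvPair D g f where
  isOpen := h.isOpen
  diff z hz := ((h.diff z hz).inv (h.ne_zero z hz)).congr_of_eventuallyEq (by
    filter_upwards [h.isOpen.mem_nhds hz] with y hy using h.inv y hy)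
  ne_zero z hz := by rw [h.inv z hz]; exact inv_ne_zero (h.ne_zero z hz)
  inv z hz := by rw [h.inv z hz, inv_inv]

lemma InvPair.mul_eq_one {D : Set ℂ} {f g : ℂ → ℂ} (h : InvPair D f g) {z : ℂ} (hz : z ∈ D) :
    f z * g z = 1 := by rw [h.inv z hz, mul_inv_cancel₀ (h.ne_zero z hz)]

lemma InvPair.logDeriv_eq {D : Set ℂ} {f g : ℂ → ℂ} (h : InvPair D f g) {z : ℂ} (hz : z ∈ D) :
    logDeriv g z = -logDeriv f z := by
  have h1 : g =ᶠ[𝓝 z] fun y => (f y)⁻¹ := by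
    filter_upwards [h.isOpen.mem_nhds hz] with y hy using h.inv y hy
  have h2 := h.ne_zero z hz
  rw [logDeriv_apply, h1.deriv_eq, h1.eq_of_nhds, deriv_fun_inv'' (h.diff z hz) h2, logDeriv_apply]
  field_simp

lemma logDeriv_comp_add_const (f : ℂ → ℂ) (a z : ℂ) :
    logDeriv (fun z => f (z + a)) z = logDeriv f (z + a) := by
  simp only [logDeriv_apply, deriv_comp_add_const]

lemma deriv_logDeriv_comp_add_const (f : ℂ → ℂ) (a z : ℂ) :
    deriv (logDeriv (fun z => f (z + a))) z = deriv (logDeriv f) (z + a) := by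
  have : logDeriv (fun z => f (z + a)) = fun z => logDeriv f (z + a) :=
    funext fun z => logDeriv_comp_add_const f a z
  rw [this, deriv_comp_add_const]

lemma InvPair.logHol_single {D : Set ℂ} {f g : ℂ → ℂ} (h : InvPair D f g) {ν : Type*} [Fintype ν]
    [DecidableEq ν] (U : Finset ν) (w : ν) (a : ℂ) {x : ν → ℂ} (hx : x w + a ∈ D) :
    LogHol U (fun y => f (y w + a)) x (fun W => if W = {w} then logDeriv f (x w + a) else 0) := by
  have := logHol_comp_single U w (φ := fun z => f (z + a)) (x := x) ?_ (h.ne_zero _ hx)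
  · simpa only [logDeriv_comp_add_const] using this
  · have : Tendsto (fun z => z + a) (𝓝 (x w)) (𝓝 (x w + a)) := by
      exact (continuous_id.add continuous_const).tendsto (x w)
    filter_upwards [this.eventually (h.isOpen.mem_nhds hx)] with z hz
    exact (h.diff _ hz).comp z (differentiableAt_id.add_const a)

lemma InvPair.logHol_pair {D : Set ℂ} {f g : ℂ → ℂ} (h : InvPair D f g) {ν : Type*} [Fintype ν]
    [DecidableEq ν] (U : Finset ν) {v w : ν} (hvw : v ≠ w) (a : ℂ) {x : ν → ℂ}
    (hx : x v + x w + a ∈ D) :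
    LogHol U (fun y => f (y v + y w + a)) x (fun W =>
      (if W = {v} then logDeriv f (x v + x w + a) else 0) +
      (if W = {w} then logDeriv f (x v + x w + a) else 0) +
      (if W = {v, w} then deriv (logDeriv f) (x v + x w + a) else 0)) := by
  have := logHol_comp_pair U hvw (φ := fun z => f (z + a)) (x := x) ?_ (h.ne_zero _ hx)
  · simpa only [logDeriv_comp_add_const, deriv_logDeriv_comp_add_const] using this
  · have : Tendsto (fun z => z + a) (𝓝 (x v + x w)) (𝓝 (x v + x w + a)) := by
      exact (continuous_id.add continuous_const).tendsto _
    filter_upwards [this.eventually (h.isOpen.mem_nhds hx)] with z hz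
    exact (h.diff _ hz).comp z (differentiableAt_id.add_const a)

/-- The factors of `Z(S̄+T⁻, T̄+S⁻; C, D)` that involve the variables in `S̄ + T̄`, for `S`, `T`, `C`
and `D` fixed, `f` in place of `ζ` and `g` in place of `1/ζ`. -/
noncomputable def variablePart (f g : ℂ → ℂ) (α : ι → ℂ) (β : κ → ℂ) (S : Finset ι) (T : Finset κ)
    (x : ι ⊕ κ → ℂ) : ℂ :=
  (∏ i ∈ Sᶜ, ((∏ k ∈ S, f (x (.inl i) + (1 - α k))) * ∏ l, g (x (.inl i) + (1 + β l)))) *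
    (∏ j ∈ Tᶜ, ((∏ k ∈ T, f (x (.inr j) + (1 - β k))) * ∏ l, g (x (.inr j) + (1 + α l)))) *
    ∏ i ∈ Sᶜ, ∏ j ∈ Tᶜ, f (x (.inl i) + x (.inr j) + 1)

/-- At a singleton α the factors 1/f run over all of B and the pair factors f over the complement of
T. Their contributions over that complement cancel at the base point and leave minus the sum over T.
Only the pair factors involve two variables, so they alone give second derivatives, and larger sets
give 0. -/
lemma logHol_variablePart {D : Set ℂ} {f g : ℂ → ℂ} (h : InvPair D f g) {α : ι → ℂ} {β : κ → ℂ}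
    {S : Finset ι} {T : Finset κ} (h₁ : ∀ i ∈ Sᶜ, ∀ k ∈ S, 1 + α i - α k ∈ D)
    (h₂ : ∀ j ∈ Tᶜ, ∀ k ∈ T, 1 + β j - β k ∈ D) (h₃ : ∀ i j, 1 + α i + β j ∈ D) :
    LogHol (Sᶜ.disjSum Tᶜ) (variablePart f g α β S T) (Sum.elim α β)
      (pairTerm (logDeriv f) α β S T) := by
  set U := Sᶜ.disjSum Tᶜ with hU
  set x₀ : ι ⊕ κ → ℂ := Sum.elim α β
  have e₁ : ∀ i k, x₀ (.inl i) + (1 - α k) = 1 + α i - α k := fun i k => by simp [x₀]; ring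
  have e₂ : ∀ i l, x₀ (.inl i) + (1 + β l) = 1 + α i + β l := fun i l => by simp [x₀]; ring
  have e₃ : ∀ j k, x₀ (.inr j) + (1 - β k) = 1 + β j - β k := fun j k => by simp [x₀]; ring
  have e₄ : ∀ j l, x₀ (.inr j) + (1 + α l) = 1 + α l + β j := fun j l => by simp [x₀]; ring
  have e₅ : ∀ i j, x₀ (.inl i) + x₀ (.inr j) + 1 = 1 + α i + β j := fun i j => by
    simp [x₀]; ring
  have l₁ : LogHol U (fun y => ∏ i ∈ Sᶜ, ((∏ k ∈ S, f (y (.inl i) + (1 - α k))) *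
      ∏ l, g (y (.inl i) + (1 + β l)))) x₀ (fun W => ∑ i ∈ Sᶜ,
        ((∑ k ∈ S, if W = {.inl i} then logDeriv f (1 + α i - α k) else 0) +
          ∑ l, if W = {.inl i} then logDeriv g (1 + α i + β l) else 0)) := by
    refine LogHol.prod _ fun i hi => LogHol.mul (LogHol.prod _ fun k hk => ?_)
      (LogHol.prod _ fun l _ => ?_)
    · have := h.logHol_single U (.inl i) (1 - α k) (x := x₀) (by rw [e₁]; exact h₁ i hi k hk)
      simpa only [e₁] using this
    · have := h.symm.logHol_single U (.inl i) (1 + β l) (x := x₀) (by rw [e₂]; exact h₃ i l)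
      simpa only [e₂] using this
  have l₂ : LogHol U (fun y => ∏ j ∈ Tᶜ, ((∏ k ∈ T, f (y (.inr j) + (1 - β k))) *
      ∏ l, g (y (.inr j) + (1 + α l)))) x₀ (fun W => ∑ j ∈ Tᶜ,
        ((∑ k ∈ T, if W = {.inr j} then logDeriv f (1 + β j - β k) else 0) +
          ∑ l, if W = {.inr j} then logDeriv g (1 + α l + β j) else 0)) := by
    refine LogHol.prod _ fun j hj => LogHol.mul (LogHol.prod _ fun k hk => ?_)
      (LogHol.prod _ fun l _ => ?_)
    · have := h.logHol_single U (.inr j) (1 - β k) (x := x₀) (by rw [e₃]; exact h₂ j hj k hk)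
      simpa only [e₃] using this
    · have := h.symm.logHol_single U (.inr j) (1 + α l) (x := x₀) (by rw [e₄]; exact h₃ l j)
      simpa only [e₄] using this
  have l₃ : LogHol U (fun y => ∏ i ∈ Sᶜ, ∏ j ∈ Tᶜ, f (y (.inl i) + y (.inr j) + 1)) x₀
      (fun W => ∑ i ∈ Sᶜ, ∑ j ∈ Tᶜ,
        ((if W = {.inl i} then logDeriv f (1 + α i + β j) else 0) +
        (if W = {.inr j} then logDeriv f (1 + α i + β j) else 0) +
        (if W = {.inl i, .inr j} then deriv (logDeriv f) (1 + α i + β j) else 0))) := by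
    refine LogHol.prod _ fun i hi => LogHol.prod _ fun j hj => ?_
    have := h.logHol_pair U (v := .inl i) (w := .inr j) Sum.inl_ne_inr 1 (x := x₀)
      (by rw [e₅]; exact h₃ i j)
    simpa only [e₅] using this
  refine ((l₁.mul l₂).mul l₃).congr fun W hW hne => ?_
  have hg : ∀ i j, logDeriv g (1 + α i + β j) = -logDeriv f (1 + α i + β j) := fun i j =>
    h.logDeriv_eq (h₃ i j)
  simp only [hg]
  -- The sum over the complement of T is the one that cancels against the pair factors.
  have hsplitL : ∀ (i : ι), i ∈ Sᶜ →
      ∑ j, logDeriv f (1 + α i + β j) = ∑ j ∈ T, logDeriv f (1 + α i + β j) +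
        ∑ j ∈ Tᶜ, logDeriv f (1 + α i + β j) := fun i _ => (Finset.sum_add_sum_compl T _).symm
  have hsplitR : ∀ (j : κ), j ∈ Tᶜ →
      ∑ i, logDeriv f (1 + α i + β j) = ∑ i ∈ S, logDeriv f (1 + α i + β j) +
        ∑ i ∈ Sᶜ, logDeriv f (1 + α i + β j) := fun j _ => (Finset.sum_add_sum_compl S _).symm
  have hWe : W.toLeft.disjSum W.toRight = W := Finset.toLeft_disjSum_toRight
  have hA : W.toLeft ⊆ Sᶜ := fun i hi => by
    have := hW (Finset.mem_toLeft.1 hi); simpa [hU] using this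
  have hB : W.toRight ⊆ Tᶜ := fun i hi => by
    have := hW (Finset.mem_toRight.1 hi); simpa [hU] using this
  unfold pairTerm
  by_cases c₁ : W.toLeft.card = 1 ∧ W.toRight.card = 0
  · obtain ⟨i, hi⟩ := Finset.card_eq_one.1 c₁.1
    have hr := Finset.card_eq_zero.1 c₁.2
    have hWi : W = {Sum.inl i} := by
      rw [← hWe, hi, hr]; ext x; cases x <;> simp
    have hiS : i ∈ Sᶜ := hA (by simp [hi])
    have hpair : ∀ (a : ι) (b : κ), ({Sum.inl i} : Finset (ι ⊕ κ)) ≠ {Sum.inl a, Sum.inr b} := by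
      intro a b h
      have : (Sum.inr b : ι ⊕ κ) ∈ ({Sum.inl i} : Finset (ι ⊕ κ)) := by rw [h]; simp
      simp at this
    rw [if_pos c₁, hi]
    subst hWi
    simp only [Finset.sum_singleton, Finset.singleton_inj, Sum.inl.injEq, reduceCtorEq, if_false,
      hpair, Finset.sum_const_zero, add_zero]
    rw [Finset.sum_eq_single_of_mem i hiS, Finset.sum_eq_single_of_mem i hiS]
    · simp only [if_true, Finset.sum_neg_distrib]
      rw [hsplitL i hiS]; ring
    · intro a _ ha; simp [ha.symm]
    · intro a _ ha; simp [ha.symm]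
  by_cases c₂ : W.toLeft.card = 0 ∧ W.toRight.card = 1
  · obtain ⟨j, hj⟩ := Finset.card_eq_one.1 c₂.2
    have hr := Finset.card_eq_zero.1 c₂.1
    have hWi : W = {Sum.inr j} := by
      rw [← hWe, hj, hr]; ext x; cases x <;> simp
    have hjT : j ∈ Tᶜ := hB (by simp [hj])
    have hpair : ∀ (a : ι) (b : κ), ({Sum.inr j} : Finset (ι ⊕ κ)) ≠ {Sum.inl a, Sum.inr b} := by
      intro a b h
      have : (Sum.inl a : ι ⊕ κ) ∈ ({Sum.inr j} : Finset (ι ⊕ κ)) := by rw [h]; simp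
      simp at this
    rw [if_neg c₁, if_pos c₂, hj]
    subst hWi
    simp only [Finset.sum_singleton, Finset.singleton_inj, Sum.inr.injEq, reduceCtorEq, if_false,
      hpair, Finset.sum_const_zero, add_zero, zero_add]
    rw [Finset.sum_comm, Finset.sum_eq_single_of_mem j hjT, Finset.sum_eq_single_of_mem j hjT]
    · simp only [if_true, Finset.sum_neg_distrib]
      rw [hsplitR j hjT]
      have : ∀ i', 1 + β j + α i' = 1 + α i' + β j := fun i' => by ring
      simp only [this]
      ring
    · intro a _ ha; simp [ha.symm]
    · intro a _ ha; simp [ha.symm]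
  have n₁ : ∀ i, W ≠ {Sum.inl i} := by
    rintro i rfl
    refine c₁ ⟨?_, ?_⟩
    · rw [show ({Sum.inl i} : Finset (ι ⊕ κ)).toLeft = {i} by ext; simp]; simp
    · rw [show ({Sum.inl i} : Finset (ι ⊕ κ)).toRight = ∅ by ext; simp]; simp
  have n₂ : ∀ j, W ≠ {Sum.inr j} := by
    rintro j rfl
    refine c₂ ⟨?_, ?_⟩
    · rw [show ({Sum.inr j} : Finset (ι ⊕ κ)).toLeft = ∅ by ext; simp]; simp
    · rw [show ({Sum.inr j} : Finset (ι ⊕ κ)).toRight = {j} by ext; simp]; simp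
  simp only [n₁, n₂, if_false, Finset.sum_const_zero, add_zero, zero_add]
  rw [if_neg c₁, if_neg c₂]
  by_cases c₃ : W.toLeft.card = 1 ∧ W.toRight.card = 1
  · obtain ⟨i, hi⟩ := Finset.card_eq_one.1 c₃.1
    obtain ⟨j, hj⟩ := Finset.card_eq_one.1 c₃.2
    have hWi : W = {Sum.inl i, Sum.inr j} := by
      rw [← hWe, hi, hj]; ext x; cases x <;> simp
    have hpair : ∀ (a : ι) (b : κ), ({Sum.inl i, Sum.inr j} : Finset (ι ⊕ κ)) =
        {Sum.inl a, Sum.inr b} ↔ i = a ∧ j = b := by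
      intro a b
      constructor
      · intro h
        have h1 : (Sum.inl i : ι ⊕ κ) ∈ ({Sum.inl a, Sum.inr b} : Finset (ι ⊕ κ)) := by
          rw [← h]; simp
        have h2 : (Sum.inr j : ι ⊕ κ) ∈ ({Sum.inl a, Sum.inr b} : Finset (ι ⊕ κ)) := by
          rw [← h]; simp
        simpa using And.intro h1 h2
      · rintro ⟨rfl, rfl⟩; rfl
    rw [if_pos c₃, hi, hj]
    simp only [hWi, hpair, Finset.sum_singleton]
    rw [Finset.sum_eq_single_of_mem i (hA (by simp [hi])),
      Finset.sum_eq_single_of_mem j (hB (by simp [hj]))]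
    · simp
    · intro b _ hb; simp [hb.symm]
    · intro a _ ha; simp [ha.symm]
  · rw [if_neg c₃]
    symm
    refine Finset.sum_eq_zero fun i _ => Finset.sum_eq_zero fun j _ => if_neg ?_
    rintro rfl
    refine c₃ ⟨?_, ?_⟩
    · rw [show ({Sum.inl i, Sum.inr j} : Finset (ι ⊕ κ)).toLeft = {i} by ext; simp]; simp
    · rw [show ({Sum.inl i, Sum.inr j} : Finset (ι ⊕ κ)).toRight = {j} by ext; simp]; simp

end PairFactors

/-! ### Regrouping the ratio Z(S̄+T⁻, T̄+S⁻; A, B) -/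

section RatioAlgebra

/-- The product of `f(1+α+β)` over all `α ∈ A`, `β ∈ B`. -/
noncomputable def pairProd {ι κ : Type} [Fintype ι] [Fintype κ] (f : ℂ → ℂ) (a : ι → ℂ)
    (b : κ → ℂ) : ℂ := ∏ i, ∏ j, f (1 + a i + b j)

variable {ι κ : Type} [Fintype ι] [Fintype κ] [DecidableEq ι] [DecidableEq κ]

lemma prod_prod_mul_eq_one {τ υ : Type*} {s : Finset τ} {t : Finset υ} {f g : τ → υ → ℂ}
    (h : ∀ i ∈ s, ∀ j ∈ t, f i j * g i j = 1) :
    (∏ i ∈ s, ∏ j ∈ t, f i j) * ∏ i ∈ s, ∏ j ∈ t, g i j = 1 := by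
  rw [← Finset.prod_mul_distrib]
  refine Finset.prod_eq_one fun i hi => ?_
  rw [← Finset.prod_mul_distrib]
  exact Finset.prod_eq_one fun j hj => h i hi j hj

lemma prod_prod_mul_comm_eq_one {τ υ : Type*} {s : Finset τ} {t : Finset υ} {f : τ → υ → ℂ}
    {g : υ → τ → ℂ} (h : ∀ i ∈ s, ∀ j ∈ t, f i j * g j i = 1) :
    (∏ i ∈ s, ∏ j ∈ t, f i j) * ∏ j ∈ t, ∏ i ∈ s, g j i = 1 := by
  rw [Finset.prod_comm (s := t)]
  exact prod_prod_mul_eq_one h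

/-- The factors `1/ζ(1+γ-α)` and `1/ζ(1+δ-β)`, `α ∈ S`, `β ∈ T`, in which `γ`, `δ` are the numbers
of `C`, `D` corresponding to `α`, `β`. -/
noncomputable def diagPart (g : ℂ → ℂ) (α : ι → ℂ) (β : κ → ℂ) (S : Finset ι) (T : Finset κ)
    (x : ι ⊕ κ → ℂ) : ℂ :=
  (∏ j ∈ T, g (1 + -x (.inr j) + β j)) * ∏ i ∈ S, g (1 + -x (.inl i) + α i)

/-- All factors of `Z(S̄+T⁻, T̄+S⁻; C, D)` but those in `diagPart`. -/
noncomputable def offDiagPart (f g : ℂ → ℂ) (α : ι → ℂ) (β : κ → ℂ) (S : Finset ι) (T : Finset κ)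
    (x : ι ⊕ κ → ℂ) : ℂ :=
  ((∏ i ∈ Sᶜ, ∏ j ∈ Tᶜ, f (1 + x (.inl i) + x (.inr j))) *
      (∏ i ∈ Sᶜ, ∏ k ∈ S, f (1 + x (.inl i) + -x (.inl k))) *
      ((∏ j ∈ T, ∏ l ∈ Tᶜ, f (1 + -x (.inr j) + x (.inr l))) *
      ∏ j ∈ T, ∏ k ∈ S, f (1 + -x (.inr j) + -x (.inl k)))) * pairProd f α β *
    (((∏ i ∈ Sᶜ, ∏ l, g (1 + x (.inl i) + β l)) *
      ∏ j ∈ T, ∏ l ∈ Finset.univ.erase j, g (1 + -x (.inr j) + β l)) *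
    ((∏ j ∈ Tᶜ, ∏ k, g (1 + x (.inr j) + α k)) *
      ∏ i ∈ S, ∏ k ∈ Finset.univ.erase i, g (1 + -x (.inl i) + α k)))

/-- A pure rearrangement, valid for arbitrary f and g. It serves both for ζ with 1/ζ and for 1/z_p
with z_p. -/
lemma pairProd_swapped (f g : ℂ → ℂ) (α : ι → ℂ) (β : κ → ℂ) (S : Finset ι) (T : Finset κ)
    (x : ι ⊕ κ → ℂ) :
    pairProd f (swapped (x ∘ .inl) (x ∘ .inr) S T) (swapped (x ∘ .inr) (x ∘ .inl) T S) *
      pairProd f α β * (pairProd g (swapped (x ∘ .inl) (x ∘ .inr) S T) β *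
        pairProd g (swapped (x ∘ .inr) (x ∘ .inl) T S) α) =
      diagPart g α β S T x * offDiagPart f g α β S T x := by
  have e₁ : pairProd f (swapped (x ∘ .inl) (x ∘ .inr) S T) (swapped (x ∘ .inr) (x ∘ .inl) T S) =
      ((∏ i ∈ Sᶜ, ∏ j ∈ Tᶜ, f (1 + x (.inl i) + x (.inr j))) *
      (∏ i ∈ Sᶜ, ∏ k ∈ S, f (1 + x (.inl i) + -x (.inl k))) *
      ((∏ j ∈ T, ∏ l ∈ Tᶜ, f (1 + -x (.inr j) + x (.inr l))) *
      ∏ j ∈ T, ∏ k ∈ S, f (1 + -x (.inr j) + -x (.inl k)))) := by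
    unfold pairProd
    rw [Fintype.prod_sum_type]
    simp only [Fintype.prod_sum_type, Finset.prod_mul_distrib]
    simp only [swapped, Sum.elim_inl, Sum.elim_inr, comp_apply]
    have q : ∀ {τ υ : Type} (s : Finset τ) (t : Finset υ) (h : τ → υ → ℂ),
        ∏ i : s, ∏ j : t, h i j = ∏ i ∈ s, ∏ j ∈ t, h i j := fun s t h => by
      rw [← Finset.prod_coe_sort s]
      exact Finset.prod_congr rfl fun i _ => Finset.prod_coe_sort t (h i)
    rw [q Sᶜ Tᶜ fun i j => f (1 + x (.inl i) + x (.inr j)),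
      q Sᶜ S fun i k => f (1 + x (.inl i) + -x (.inl k)),
      q T Tᶜ fun j l => f (1 + -x (.inr j) + x (.inr l)),
      q T S fun j k => f (1 + -x (.inr j) + -x (.inl k))]
  have e₂ : pairProd g (swapped (x ∘ .inl) (x ∘ .inr) S T) β =
      (∏ j ∈ T, g (1 + -x (.inr j) + β j)) * ((∏ i ∈ Sᶜ, ∏ l, g (1 + x (.inl i) + β l)) *
      ∏ j ∈ T, ∏ l ∈ Finset.univ.erase j, g (1 + -x (.inr j) + β l)) := by
    rw [mul_left_comm, ← Finset.prod_mul_distrib,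
      ← Finset.prod_coe_sort Sᶜ fun i => ∏ l, g (1 + x (.inl i) + β l)]
    unfold pairProd
    rw [Fintype.prod_sum_type]
    congr 1
    rw [← Finset.prod_coe_sort T]
    refine Finset.prod_congr rfl fun j _ => ?_
    exact (Finset.mul_prod_erase _ (fun l => g (1 + -x (.inr j) + β l)) (Finset.mem_univ _)).symm
  have e₃ : pairProd g (swapped (x ∘ .inr) (x ∘ .inl) T S) α =
      (∏ i ∈ S, g (1 + -x (.inl i) + α i)) * ((∏ j ∈ Tᶜ, ∏ k, g (1 + x (.inr j) + α k)) *
      ∏ i ∈ S, ∏ k ∈ Finset.univ.erase i, g (1 + -x (.inl i) + α k)) := by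
    rw [mul_left_comm, ← Finset.prod_mul_distrib,
      ← Finset.prod_coe_sort Tᶜ fun i => ∏ l, g (1 + x (.inr i) + α l)]
    unfold pairProd
    rw [Fintype.prod_sum_type]
    congr 1
    rw [← Finset.prod_coe_sort S]
    refine Finset.prod_congr rfl fun j _ => ?_
    exact (Finset.mul_prod_erase _ (fun l => g (1 + -x (.inl j) + α l)) (Finset.mem_univ _)).symm
  rw [e₁, e₂, e₃]
  unfold diagPart offDiagPart
  ring

/-- The constant factor of `offDiagPart` when the variables in `S + T` are frozen. -/
noncomputable def frozenConst (f g : ℂ → ℂ) (α : ι → ℂ) (β : κ → ℂ) (S : Finset ι)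
    (T : Finset κ) : ℂ :=
  (∏ j ∈ T, ∏ k ∈ S, f (1 + -β j + -α k)) * pairProd f α β *
    ((∏ j ∈ T, ∏ l ∈ Finset.univ.erase j, g (1 + -β j + β l)) *
      ∏ i ∈ S, ∏ k ∈ Finset.univ.erase i, g (1 + -α i + α k))

lemma freeze_inl_of_mem {α : ι → ℂ} {β : κ → ℂ} {S : Finset ι} {T : Finset κ} (x : ι ⊕ κ → ℂ)
    {i : ι} (hi : i ∈ S) : freeze (Sᶜ.disjSum Tᶜ) (Sum.elim α β) x (.inl i) = α i := by
  simp [freeze, hi]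

lemma freeze_inl_of_mem_compl {α : ι → ℂ} {β : κ → ℂ} {S : Finset ι} {T : Finset κ}
    (x : ι ⊕ κ → ℂ) {i : ι} (hi : i ∈ Sᶜ) :
    freeze (Sᶜ.disjSum Tᶜ) (Sum.elim α β) x (.inl i) = x (.inl i) := by
  have : i ∉ S := by simpa using hi
  simp [freeze, this]

lemma freeze_inr_of_mem {α : ι → ℂ} {β : κ → ℂ} {S : Finset ι} {T : Finset κ} (x : ι ⊕ κ → ℂ)
    {j : κ} (hj : j ∈ T) : freeze (Sᶜ.disjSum Tᶜ) (Sum.elim α β) x (.inr j) = β j := by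
  simp [freeze, hj]

lemma freeze_inr_of_mem_compl {α : ι → ℂ} {β : κ → ℂ} {S : Finset ι} {T : Finset κ}
    (x : ι ⊕ κ → ℂ) {j : κ} (hj : j ∈ Tᶜ) :
    freeze (Sᶜ.disjSum Tᶜ) (Sum.elim α β) x (.inr j) = x (.inr j) := by
  have : j ∉ T := by simpa using hj
  simp [freeze, this]

/-- For z_p this is a harmless constant. For 1/ζ it is 0 as soon as S or T is nonempty, which is why
these factors are split off before the ζ-part is frozen. -/
lemma diagPart_freeze (g : ℂ → ℂ) (α : ι → ℂ) (β : κ → ℂ) (S : Finset ι) (T : Finset κ)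
    (x : ι ⊕ κ → ℂ) : diagPart g α β S T (freeze (Sᶜ.disjSum Tᶜ) (Sum.elim α β) x) =
      (∏ _j ∈ T, g 1) * ∏ _i ∈ S, g 1 := by
  unfold diagPart
  congr 1
  · exact Finset.prod_congr rfl fun j hj => by rw [freeze_inr_of_mem x hj]; congr 1; ring
  · exact Finset.prod_congr rfl fun j hj => by rw [freeze_inl_of_mem x hj]; congr 1; ring

lemma offDiagPart_freeze (f g : ℂ → ℂ) (α : ι → ℂ) (β : κ → ℂ) (S : Finset ι) (T : Finset κ)
    (x : ι ⊕ κ → ℂ) : offDiagPart f g α β S T (freeze (Sᶜ.disjSum Tᶜ) (Sum.elim α β) x) =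
      frozenConst f g α β S T * variablePart f g α β S T x := by
  have hL : ∀ i ∈ S, freeze (Sᶜ.disjSum Tᶜ) (Sum.elim α β) x (.inl i) = α i := fun i hi =>
    freeze_inl_of_mem x hi
  have hLc : ∀ i ∈ Sᶜ, freeze (Sᶜ.disjSum Tᶜ) (Sum.elim α β) x (.inl i) = x (.inl i) :=
    fun i hi => freeze_inl_of_mem_compl x hi
  have hR : ∀ j ∈ T, freeze (Sᶜ.disjSum Tᶜ) (Sum.elim α β) x (.inr j) = β j := fun j hj =>
    freeze_inr_of_mem x hj
  have hRc : ∀ j ∈ Tᶜ, freeze (Sᶜ.disjSum Tᶜ) (Sum.elim α β) x (.inr j) = x (.inr j) :=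
    fun j hj => freeze_inr_of_mem_compl x hj
  generalize freeze (Sᶜ.disjSum Tᶜ) (Sum.elim α β) x = y at hL hLc hR hRc ⊢
  have t₁ : ∏ i ∈ Sᶜ, ∏ j ∈ Tᶜ, f (1 + y (.inl i) + y (.inr j)) =
      ∏ i ∈ Sᶜ, ∏ j ∈ Tᶜ, f (x (.inl i) + x (.inr j) + 1) :=
    Finset.prod_congr rfl fun i hi => Finset.prod_congr rfl fun j hj => by
      rw [hLc _ hi, hRc _ hj]; congr 1; ring
  have t₂ : ∏ i ∈ Sᶜ, ∏ k ∈ S, f (1 + y (.inl i) + -y (.inl k)) =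
      ∏ i ∈ Sᶜ, ∏ k ∈ S, f (x (.inl i) + (1 - α k)) :=
    Finset.prod_congr rfl fun i hi => Finset.prod_congr rfl fun j hj => by
      rw [hLc _ hi, hL _ hj]; congr 1; ring
  have t₃ : ∏ j ∈ T, ∏ l ∈ Tᶜ, f (1 + -y (.inr j) + y (.inr l)) =
      ∏ j ∈ Tᶜ, ∏ k ∈ T, f (x (.inr j) + (1 - β k)) := by
    rw [Finset.prod_comm]
    exact Finset.prod_congr rfl fun i hi => Finset.prod_congr rfl fun j hj => by
      rw [hRc _ hi, hR _ hj]; congr 1; ring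
  have t₄ : ∏ j ∈ T, ∏ k ∈ S, f (1 + -y (.inr j) + -y (.inl k)) =
      ∏ j ∈ T, ∏ k ∈ S, f (1 + -β j + -α k) :=
    Finset.prod_congr rfl fun i hi => Finset.prod_congr rfl fun j hj => by
      rw [hR _ hi, hL _ hj]
  have t₅ : ∏ i ∈ Sᶜ, ∏ l, g (1 + y (.inl i) + β l) = ∏ i ∈ Sᶜ, ∏ l, g (x (.inl i) + (1 + β l)) :=
    Finset.prod_congr rfl fun i hi => Finset.prod_congr rfl fun j hj => by
      rw [hLc _ hi]; congr 1; ring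
  have t₆ : ∏ i ∈ Tᶜ, ∏ l, g (1 + y (.inr i) + α l) = ∏ i ∈ Tᶜ, ∏ l, g (x (.inr i) + (1 + α l)) :=
    Finset.prod_congr rfl fun i hi => Finset.prod_congr rfl fun j hj => by
      rw [hRc _ hi]; congr 1; ring
  have t₇ : ∏ j ∈ T, ∏ l ∈ Finset.univ.erase j, g (1 + -y (.inr j) + β l) =
      ∏ j ∈ T, ∏ l ∈ Finset.univ.erase j, g (1 + -β j + β l) :=
    Finset.prod_congr rfl fun i hi => Finset.prod_congr rfl fun j hj => by
      rw [hR _ hi]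
  have t₈ : ∏ j ∈ S, ∏ l ∈ Finset.univ.erase j, g (1 + -y (.inl j) + α l) =
      ∏ j ∈ S, ∏ l ∈ Finset.univ.erase j, g (1 + -α j + α l) :=
    Finset.prod_congr rfl fun i hi => Finset.prod_congr rfl fun j hj => by
      rw [hL _ hi]
  unfold offDiagPart
  rw [t₁, t₂, t₃, t₄, t₅, t₆, t₇, t₈]
  unfold frozenConst variablePart
  simp only [Finset.prod_mul_distrib]
  ring

lemma prod_univ_erase_eq {τ : Type*} [Fintype τ] [DecidableEq τ] {S : Finset τ} {i : τ}
    (hi : i ∈ S) (F : τ → ℂ) :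
    ∏ k ∈ Finset.univ.erase i, F k = (∏ k ∈ S.erase i, F k) * ∏ k ∈ Sᶜ, F k := by
  rw [← Finset.prod_union]
  · refine Finset.prod_congr ?_ fun _ _ => rfl
    ext k
    simp only [Finset.mem_erase, Finset.mem_univ, and_true, Finset.mem_union, Finset.mem_compl]
    by_cases hk : k ∈ S
    · simp [hk]
    · have : k ≠ i := fun h => hk (h ▸ hi)
      simp [hk, this]
  · rw [Finset.disjoint_left]
    intro k hk
    simp [Finset.mem_of_mem_erase hk]

/-- The value at the base point. -/
lemma frozenConst_mul_variablePart {D : Set ℂ} {f g : ℂ → ℂ} (h : InvPair D f g) {α : ι → ℂ}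
    {β : κ → ℂ} {S : Finset ι} {T : Finset κ} (h₁ : ∀ i ∈ Sᶜ, ∀ k ∈ S, 1 + α i - α k ∈ D)
    (h₂ : ∀ j ∈ Tᶜ, ∀ k ∈ T, 1 + β j - β k ∈ D) (h₃ : ∀ i j, 1 + α i + β j ∈ D) :
    frozenConst f g α β S T * variablePart f g α β S T (Sum.elim α β) =
      (∏ j ∈ T, ∏ k ∈ S, f (1 + -β j + -α k)) * (∏ i ∈ S, ∏ j ∈ T, f (1 + α i + β j)) *
        ((∏ j ∈ T, ∏ l ∈ T.erase j, g (1 + -β j + β l)) *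
          ∏ i ∈ S, ∏ k ∈ S.erase i, g (1 + -α i + α k)) := by
  have d₁ : pairProd f α β = (∏ i ∈ S, ∏ j ∈ T, f (1 + α i + β j)) *
      (∏ i ∈ S, ∏ j ∈ Tᶜ, f (1 + α i + β j)) * ∏ i ∈ Sᶜ, ∏ j, f (1 + α i + β j) := by
    unfold pairProd
    rw [← Finset.prod_mul_prod_compl S]
    congr 1
    rw [← Finset.prod_mul_distrib]
    exact Finset.prod_congr rfl fun i _ => (Finset.prod_mul_prod_compl T _).symm
  have d₂ : ∏ j ∈ T, ∏ l ∈ Finset.univ.erase j, g (1 + -β j + β l) =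
      (∏ j ∈ T, ∏ l ∈ T.erase j, g (1 + -β j + β l)) * ∏ j ∈ T, ∏ l ∈ Tᶜ, g (1 + -β j + β l) := by
    rw [← Finset.prod_mul_distrib]
    exact Finset.prod_congr rfl fun j hj => prod_univ_erase_eq hj _
  have d₃ : ∏ j ∈ S, ∏ l ∈ Finset.univ.erase j, g (1 + -α j + α l) =
      (∏ j ∈ S, ∏ l ∈ S.erase j, g (1 + -α j + α l)) * ∏ j ∈ S, ∏ l ∈ Sᶜ, g (1 + -α j + α l) := by
    rw [← Finset.prod_mul_distrib]
    exact Finset.prod_congr rfl fun j hj => prod_univ_erase_eq hj _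
  have d₄ : ∏ j ∈ Tᶜ, ∏ i, g (β j + (1 + α i)) = (∏ j ∈ Tᶜ, ∏ i ∈ S, g (β j + (1 + α i))) *
      ∏ j ∈ Tᶜ, ∏ i ∈ Sᶜ, g (β j + (1 + α i)) := by
    rw [← Finset.prod_mul_distrib]
    exact Finset.prod_congr rfl fun i _ => (Finset.prod_mul_prod_compl S _).symm
  -- Every factor with an index outside S and T meets its inverse, in the five groups `c₁` to `c₅`.
  -- Only pairs within S+T survive.
  have c₁ : (∏ i ∈ Sᶜ, ∏ j, f (1 + α i + β j)) * ∏ i ∈ Sᶜ, ∏ j, g (α i + (1 + β j)) = 1 :=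
    prod_prod_mul_eq_one fun i _ j _ => by
      rw [show α i + (1 + β j) = 1 + α i + β j by ring]; exact h.mul_eq_one (h₃ i j)
  have c₂ : (∏ i ∈ S, ∏ j ∈ Tᶜ, f (1 + α i + β j)) * ∏ j ∈ Tᶜ, ∏ i ∈ S, g (β j + (1 + α i)) = 1 :=
    prod_prod_mul_comm_eq_one fun i _ j _ => by
      rw [show β j + (1 + α i) = 1 + α i + β j by ring]; exact h.mul_eq_one (h₃ i j)
  have c₃ : (∏ i ∈ Sᶜ, ∏ j ∈ Tᶜ, f (α i + β j + 1)) *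
      ∏ j ∈ Tᶜ, ∏ i ∈ Sᶜ, g (β j + (1 + α i)) = 1 :=
    prod_prod_mul_comm_eq_one fun i _ j _ => by
      rw [show β j + (1 + α i) = 1 + α i + β j by ring,
        show α i + β j + 1 = 1 + α i + β j by ring]
      exact h.mul_eq_one (h₃ i j)
  have c₄ : (∏ j ∈ Tᶜ, ∏ k ∈ T, f (β j + (1 - β k))) * ∏ j ∈ T, ∏ l ∈ Tᶜ, g (1 + -β j + β l) = 1 :=
    prod_prod_mul_comm_eq_one fun j hj k hk => by
      rw [show β j + (1 - β k) = 1 + β j - β k by ring,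
        show 1 + -β k + β j = 1 + β j - β k by ring]
      exact h.mul_eq_one (h₂ j hj k hk)
  have c₅ : (∏ j ∈ Sᶜ, ∏ k ∈ S, f (α j + (1 - α k))) * ∏ j ∈ S, ∏ l ∈ Sᶜ, g (1 + -α j + α l) = 1 :=
    prod_prod_mul_comm_eq_one fun j hj k hk => by
      rw [show α j + (1 - α k) = 1 + α j - α k by ring,
        show 1 + -α k + α j = 1 + α j - α k by ring]
      exact h.mul_eq_one (h₁ j hj k hk)
  unfold frozenConst variablePart
  simp only [Sum.elim_inl, Sum.elim_inr, Finset.prod_mul_distrib]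
  rw [d₁, d₂, d₃, d₄]
  set P₁ := ∏ j ∈ T, ∏ k ∈ S, f (1 + -β j + -α k)
  set P₂ := ∏ i ∈ S, ∏ j ∈ T, f (1 + α i + β j)
  set P₃ := ∏ j ∈ T, ∏ l ∈ T.erase j, g (1 + -β j + β l)
  set P₄ := ∏ j ∈ S, ∏ l ∈ S.erase j, g (1 + -α j + α l)
  calc _ = P₁ * P₂ * (P₃ * P₄) *
      (((∏ i ∈ Sᶜ, ∏ j, f (1 + α i + β j)) * ∏ i ∈ Sᶜ, ∏ j, g (α i + (1 + β j))) *
      ((∏ i ∈ S, ∏ j ∈ Tᶜ, f (1 + α i + β j)) * ∏ j ∈ Tᶜ, ∏ i ∈ S, g (β j + (1 + α i))) *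
      ((∏ i ∈ Sᶜ, ∏ j ∈ Tᶜ, f (α i + β j + 1)) * ∏ j ∈ Tᶜ, ∏ i ∈ Sᶜ, g (β j + (1 + α i))) *
      ((∏ j ∈ Tᶜ, ∏ k ∈ T, f (β j + (1 - β k))) * ∏ j ∈ T, ∏ l ∈ Tᶜ, g (1 + -β j + β l)) *
      ((∏ j ∈ Sᶜ, ∏ k ∈ S, f (α j + (1 - α k))) *
        ∏ j ∈ S, ∏ l ∈ Sᶜ, g (1 + -α j + α l))) := by ring
    _ = _ := by rw [c₁, c₂, c₃, c₄, c₅]; ring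

end RatioAlgebra

/-! ### Auxiliary rules for jets, cumulants and logarithmic derivatives -/

section Auxiliary

variable {ν : Type*} [Fintype ν] [DecidableEq ν]

lemma iterDeriv_const_mul (c : ℂ) (F : (ν → ℂ) → ℂ) (l : List ν) (X : Finset ν) :
    iterDeriv l X (fun x => c * F x) = fun x => c * iterDeriv l X F x := by
  induction l with
  | nil => rfl
  | cons i l ih =>
    by_cases hi : i ∈ X
    · rw [iterDeriv_cons_mem hi, iterDeriv_cons_mem hi, ih]
      funext x
      exact deriv_const_mul_field c
    · rw [iterDeriv_cons_notMem hi, iterDeriv_cons_notMem hi, ih]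

lemma jet_const_mul (c : ℂ) (F : (ν → ℂ) → ℂ) (x : ν → ℂ) (X : Finset ν) :
    jet (fun y => c * F y) x X = c * jet F x X := by
  unfold jet
  rw [iterDeriv_const_mul]

lemma cumulants_congr {m m' : Finset ν → ℂ} {W : Finset ν} (h : ∀ X ⊆ W, m X = m' X) :
    cumulants m W = cumulants m' W := by
  unfold cumulants partitionSum
  refine Finset.sum_congr rfl fun P _ => ?_
  exact congrArg _ (Finset.prod_congr rfl fun X hX => h X (P.le hX))

/-- There is no exceptional point: at zeros of f, and where f is not differentiable, both sides are
0 by convention. -/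
lemma logDeriv_inv_fun (f : ℂ → ℂ) : (logDeriv fun z => (f z)⁻¹) = fun z => -logDeriv f z := by
  funext z
  by_cases h0 : f z = 0
  · simp [logDeriv_apply, h0]
  by_cases hd : DifferentiableAt ℂ f z
  · rw [logDeriv_apply, deriv_fun_inv'' hd h0, logDeriv_apply]
    field_simp
  · have : ¬ DifferentiableAt ℂ (fun z => (f z)⁻¹) z := fun h => hd (by
      simpa using h.fun_inv (inv_ne_zero h0))
    simp [logDeriv_apply, deriv_zero_of_not_differentiableAt hd,
      deriv_zero_of_not_differentiableAt this]

end Auxiliary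

/-! ### The pair terms and the value at the base point -/

section PairTerms

variable {ι κ : Type} [Fintype ι] [Fintype κ] [DecidableEq ι] [DecidableEq κ]

/-- At p the function 1/z_p takes the place of ζ; this is the source of the minus sign of H_{p,1}.
-/
lemma pairTerm_neg (L : ℂ → ℂ) (α : ι → ℂ) (β : κ → ℂ) (S : Finset ι) (T : Finset κ)
    (W : Finset (ι ⊕ κ)) : pairTerm (fun z => -L z) α β S T W = -pairTerm L α β S T W := by
  unfold pairTerm
  split_ifs
  · simp only [← Finset.sum_neg_distrib, neg_sub]
    exact Finset.sum_congr rfl fun i _ => by rw [Finset.sum_neg_distrib, Finset.sum_neg_distrib]; ring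
  · simp only [← Finset.sum_neg_distrib, neg_sub]
    exact Finset.sum_congr rfl fun i _ => by rw [Finset.sum_neg_distrib, Finset.sum_neg_distrib]; ring
  · simp only [deriv.fun_neg, Finset.sum_neg_distrib]
  · simp

lemma pairProd_restrict (f : ℂ → ℂ) {τ υ : Type} (S : Finset τ) (T : Finset υ) (a : τ → ℂ)
    (b : υ → ℂ) : pairProd f (S.restrict a) (T.restrict b) =
      ∏ i ∈ S, ∏ j ∈ T, f (1 + a i + b j) := by
  unfold pairProd
  rw [← Finset.prod_coe_sort S]
  exact Finset.prod_congr rfl fun i _ => Finset.prod_coe_sort T fun j => f (1 + a i + b j)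

/-- The value at the base point of the ratio of products of `f` and `g`. -/
lemma diagPart_mul_offDiagPart_base {D : Set ℂ} {f g : ℂ → ℂ} (h : InvPair D f g) {α : ι → ℂ}
    {β : κ → ℂ} {S : Finset ι} {T : Finset κ} (h₁ : ∀ i ∈ Sᶜ, ∀ k ∈ S, 1 + α i - α k ∈ D)
    (h₂ : ∀ j ∈ Tᶜ, ∀ k ∈ T, 1 + β j - β k ∈ D) (h₃ : ∀ i j, 1 + α i + β j ∈ D) :
    diagPart g α β S T (Sum.elim α β) * offDiagPart f g α β S T (Sum.elim α β) =
      pairProd f (-T.restrict β) (-S.restrict α) * pairProd f (S.restrict α) (T.restrict β) *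
        (pairProd g (-T.restrict β) (T.restrict β) * pairProd g (-S.restrict α) (S.restrict α)) := by
  have hd := diagPart_freeze g α β S T (Sum.elim α β)
  have ho := offDiagPart_freeze f g α β S T (Sum.elim α β)
  rw [freeze_self] at hd ho
  rw [hd, ho, frozenConst_mul_variablePart h h₁ h₂ h₃]
  have r₁ : pairProd f (-T.restrict β) (-S.restrict α) =
      ∏ j ∈ T, ∏ k ∈ S, f (1 + -β j + -α k) := pairProd_restrict f T S (-β) (-α)
  have r₂ := pairProd_restrict f S T α β
  have r₃ : pairProd g (-T.restrict β) (T.restrict β) =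
      (∏ _j ∈ T, g 1) * ∏ j ∈ T, ∏ l ∈ T.erase j, g (1 + -β j + β l) := by
    rw [show pairProd g (-T.restrict β) (T.restrict β) = ∏ j ∈ T, ∏ l ∈ T, g (1 + -β j + β l) from
      pairProd_restrict g T T (-β) β, ← Finset.prod_mul_distrib]
    refine Finset.prod_congr rfl fun j hj => ?_
    rw [← Finset.mul_prod_erase T _ hj]
    congr 2; ring
  have r₄ : pairProd g (-S.restrict α) (S.restrict α) =
      (∏ _j ∈ S, g 1) * ∏ j ∈ S, ∏ l ∈ S.erase j, g (1 + -α j + α l) := by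
    rw [show pairProd g (-S.restrict α) (S.restrict α) = ∏ j ∈ S, ∏ l ∈ S, g (1 + -α j + α l) from
      pairProd_restrict g S S (-α) α, ← Finset.prod_mul_distrib]
    refine Finset.prod_congr rfl fun j hj => ?_
    rw [← Finset.mul_prod_erase S _ hj]
    congr 2; ring
  rw [r₁, r₂, r₃, r₄]
  ring

end PairTerms

/-! ### The integral over θ and its cumulants -/

section LocalPart

variable {ι κ ρ σ : Type} [Fintype ι] [Fintype κ] [Fintype ρ] [Fintype σ]

lemma localRatio_eq (p : ℕ) (a : ι → ℂ) (b : κ → ℂ) (c : ρ → ℂ) (d : σ → ℂ) :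
    localRatio p a b c d = pairProd (fun z => (localZeta p z)⁻¹) a b *
      pairProd (fun z => (localZeta p z)⁻¹) c d *
        (pairProd (localZeta p) a d * pairProd (localZeta p) b c) := by
  unfold localRatio localProd pairProd
  simp only [Finset.prod_inv_distrib, div_eq_mul_inv, mul_inv, inv_inv]

lemma invPair_localZeta {p : ℕ} (hp : p.Prime) :
    InvPair {z | 0 < z.re} (fun z => (localZeta p z)⁻¹) (localZeta p) where
  isOpen := isOpen_lt continuous_const Complex.continuous_re
  diff _ hz := (differentiableAt_localZeta hp hz).fun_inv (localZeta_ne_zero hp hz)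
  ne_zero _ hz := inv_ne_zero (localZeta_ne_zero hp hz)
  inv _ _ := (inv_inv _).symm

variable [DecidableEq ι] [DecidableEq κ]

/-- The dependence of `𝒜_{p,θ}(S̄+T⁻, T̄+S⁻; A, B)` on the variable with index `k`, normalized at the
base point. -/
noncomputable def localVariable (p : ℕ) (θ : ℝ) (α : ι → ℂ) (β : κ → ℂ) : ι ⊕ κ → ℂ → ℂ :=
  Sum.elim (fun i z => twistedLocalZeta p (-θ) (1 / 2 + z) / twistedLocalZeta p (-θ) (1 / 2 + α i))
    fun j z => twistedLocalZeta p θ (1 / 2 + z) / twistedLocalZeta p θ (1 / 2 + β j)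

/-- Dividing each free numerator factor by the denominator factor with the same index separates the
free variables. The indices in S and T are left over, and they form 𝒜_{p,θ}(S,T). -/
lemma localIntegrand_freeze (p : ℕ) (θ : ℝ) (α : ι → ℂ) (β : κ → ℂ) (S : Finset ι) (T : Finset κ)
    (x : ι ⊕ κ → ℂ) {y : ι ⊕ κ → ℂ} (hy : freeze (Sᶜ.disjSum Tᶜ) (Sum.elim α β) x = y) :
    localIntegrand p θ (swapped (y ∘ .inl) (y ∘ .inr) S T) (swapped (y ∘ .inr) (y ∘ .inl) T S) α β =
      localWeight p θ α β S T * ∏ k ∈ Sᶜ.disjSum Tᶜ, localVariable p θ α β k (x k) := by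
  have hL : ∀ i ∈ S, y (.inl i) = α i := fun i hi => hy ▸ freeze_inl_of_mem x hi
  have hLc : ∀ i ∈ Sᶜ, y (.inl i) = x (.inl i) := fun i hi => hy ▸ freeze_inl_of_mem_compl x hi
  have hR : ∀ j ∈ T, y (.inr j) = β j := fun j hj => hy ▸ freeze_inr_of_mem x hj
  have hRc : ∀ j ∈ Tᶜ, y (.inr j) = x (.inr j) := fun j hj => hy ▸ freeze_inr_of_mem_compl x hj
  have s₁ : ∏ i, twistedLocalZeta p (-θ) (1 / 2 + swapped (y ∘ .inl) (y ∘ .inr) S T i) =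
      (∏ i ∈ Sᶜ, twistedLocalZeta p (-θ) (1 / 2 + x (.inl i))) *
        ∏ j ∈ T, twistedLocalZeta p (-θ) (1 / 2 + -β j) := by
    rw [Fintype.prod_sum_type, ← Finset.prod_coe_sort Sᶜ, ← Finset.prod_coe_sort T]
    congr 1
    · exact Finset.prod_congr rfl fun i _ => by simp [swapped, hLc i i.2]
    · exact Finset.prod_congr rfl fun i _ => by simp [swapped, hR i i.2]
  have s₂ : ∏ i, twistedLocalZeta p θ (1 / 2 + swapped (y ∘ .inr) (y ∘ .inl) T S i) =
      (∏ i ∈ Tᶜ, twistedLocalZeta p θ (1 / 2 + x (.inr i))) *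
        ∏ j ∈ S, twistedLocalZeta p θ (1 / 2 + -α j) := by
    rw [Fintype.prod_sum_type, ← Finset.prod_coe_sort Tᶜ, ← Finset.prod_coe_sort S]
    congr 1
    · exact Finset.prod_congr rfl fun i _ => by simp [swapped, hRc i i.2]
    · exact Finset.prod_congr rfl fun i _ => by simp [swapped, hL i i.2]
  have w : localWeight p θ α β S T =
      ((∏ j ∈ T, twistedLocalZeta p (-θ) (1 / 2 + -β j)) *
        ∏ j ∈ S, twistedLocalZeta p θ (1 / 2 + -α j)) /
      ((∏ j ∈ S, twistedLocalZeta p (-θ) (1 / 2 + α j)) *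
        ∏ j ∈ T, twistedLocalZeta p θ (1 / 2 + β j)) := by
    unfold localWeight localIntegrand
    rw [← Finset.prod_coe_sort S, ← Finset.prod_coe_sort T, ← Finset.prod_coe_sort S,
      ← Finset.prod_coe_sort T]
    rfl
  unfold localIntegrand
  rw [s₁, s₂, w, Finset.prod_disjSum,
    ← Finset.prod_mul_prod_compl S fun k => twistedLocalZeta p (-θ) (1 / 2 + α k),
    ← Finset.prod_mul_prod_compl T fun k => twistedLocalZeta p θ (1 / 2 + β k)]
  simp only [localVariable, Sum.elim_inl, Sum.elim_inr, div_eq_mul_inv, mul_inv,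
    Finset.prod_mul_distrib, Finset.prod_inv_distrib]
  ring

lemma localVariable_base {p : ℕ} (hp : p.Prime) (θ : ℝ) {α : ι → ℂ} {β : κ → ℂ}
    (hα : ∀ i, 0 < (α i).re) (hβ : ∀ j, 0 < (β j).re) (k : ι ⊕ κ) :
    localVariable p θ α β k (Sum.elim α β k) = 1 := by
  cases k with
  | inl i => exact div_self (twistedLocalZeta_ne_zero hp _ (by have := hα i; simp; linarith))
  | inr j => exact div_self (twistedLocalZeta_ne_zero hp _ (by have := hβ j; simp; linarith))

lemma deriv_localVariable_inl (p : ℕ) (θ : ℝ) (α : ι → ℂ) (β : κ → ℂ) (i : ι) :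
    deriv (localVariable p θ α β (.inl i)) (α i) =
      logDeriv (twistedLocalZeta p (-θ)) (1 / 2 + α i) := by
  simp only [localVariable, Sum.elim_inl, deriv_div_const, logDeriv_apply]
  rw [deriv_comp_const_add]

lemma deriv_localVariable_inr (p : ℕ) (θ : ℝ) (α : ι → ℂ) (β : κ → ℂ) (j : κ) :
    deriv (localVariable p θ α β (.inr j)) (β j) =
      logDeriv (twistedLocalZeta p θ) (1 / 2 + β j) := by
  simp only [localVariable, Sum.elim_inr, deriv_div_const, logDeriv_apply]
  rw [deriv_comp_const_add]

/-- The integrand of the moments of the cumulants. -/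
lemma jet_localIntegrand {p : ℕ} (hp : p.Prime) (θ : ℝ) {α : ι → ℂ} {β : κ → ℂ}
    (hα : ∀ i, 0 < (α i).re) (hβ : ∀ j, 0 < (β j).re) {S : Finset ι} {T : Finset κ}
    {X : Finset (ι ⊕ κ)} (hX : X ⊆ Sᶜ.disjSum Tᶜ) :
    jet (fun x => localWeight p θ α β S T * ∏ k ∈ Sᶜ.disjSum Tᶜ, localVariable p θ α β k (x k))
      (Sum.elim α β) X = localWeight p θ α β S T *
        (∏ i ∈ X.toLeft, logDeriv (twistedLocalZeta p (-θ)) (1 / 2 + α i)) *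
          ∏ j ∈ X.toRight, logDeriv (twistedLocalZeta p θ) (1 / 2 + β j) := by
  rw [jet_const_mul, jet_prod, if_pos hX, mul_assoc]
  simp only [localVariable_base hp θ hα hβ]
  rw [Finset.prod_ite, Finset.prod_const_one, mul_one, Finset.filter_mem_eq_inter,
    Finset.inter_eq_right.2 hX]
  congr 1
  conv_lhs => rw [← Finset.toLeft_disjSum_toRight (u := X), Finset.prod_disjSum]
  simp only [Sum.elim_inl, Sum.elim_inr, deriv_localVariable_inl, deriv_localVariable_inr]

lemma one_sub_e_mul_ne_zero {p : ℕ} (hp : p.Prime) (θ : ℝ) {z : ℂ} (hz : 0 < z.re) :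
    1 - e θ * (p : ℂ) ^ (-z) ≠ 0 := fun h =>
  twistedLocalZeta_ne_zero hp θ hz (by rw [twistedLocalZeta, h, inv_zero])

lemma continuous_twistedLocalZeta {p : ℕ} (hp : p.Prime) {z : ℂ} (hz : 0 < z.re) :
    Continuous fun θ : ℝ => twistedLocalZeta p θ z := by
  unfold twistedLocalZeta
  refine Continuous.inv₀ (by have := continuous_e; fun_prop) fun θ => ?_
  exact one_sub_e_mul_ne_zero hp θ hz

lemma continuous_localWeight {p : ℕ} (hp : p.Prime) {α : ι → ℂ} {β : κ → ℂ}
    (hα : ∀ i, 0 < (α i).re ∧ (α i).re < 1 / 4) (hβ : ∀ j, 0 < (β j).re ∧ (β j).re < 1 / 4)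
    (S : Finset ι) (T : Finset κ) : Continuous fun θ => localWeight p θ α β S T := by
  unfold localWeight localIntegrand
  have c₁ : ∀ i, 0 < (1 / 2 + α i).re := fun i => by have := (hα i).1; simp; linarith
  have c₂ : ∀ i, 0 < (1 / 2 + β i).re := fun i => by have := (hβ i).1; simp; linarith
  have c₃ : ∀ i, 0 < (1 / 2 + -α i).re := fun i => by have := (hα i).2; simp; linarith
  have c₄ : ∀ i, 0 < (1 / 2 + -β i).re := fun i => by have := (hβ i).2; simp; linarith
  refine Continuous.div ?_ ?_ fun θ => mul_ne_zero ?_ ?_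
  · refine Continuous.mul (continuous_finsetProd _ fun j _ => ?_)
      (continuous_finsetProd _ fun i _ => continuous_twistedLocalZeta hp (c₃ i))
    exact (continuous_twistedLocalZeta hp (c₄ j)).comp continuous_neg
  · refine Continuous.mul (continuous_finsetProd _ fun j _ => ?_)
      (continuous_finsetProd _ fun i _ => continuous_twistedLocalZeta hp (c₂ i))
    exact (continuous_twistedLocalZeta hp (c₁ j)).comp continuous_neg
  · exact Finset.prod_ne_zero_iff.2 fun i _ => twistedLocalZeta_ne_zero hp _ (c₁ i)
  · exact Finset.prod_ne_zero_iff.2 fun i _ => twistedLocalZeta_ne_zero hp _ (c₂ i)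

lemma isOpen_forall_lt_re {ν : Type*} [Finite ν] (r : ℝ) :
    IsOpen {x : ν → ℂ | ∀ k, r < (x k).re} := by
  have : {x : ν → ℂ | ∀ k, r < (x k).re} = ⋂ k, {x | r < (x k).re} := by ext; simp
  rw [this]
  exact isOpen_iInter_of_finite fun k =>
    isOpen_lt continuous_const (Complex.continuous_re.comp (continuous_apply k))

lemma sepHol_twistedLocalZeta {ν : Type*} [Fintype ν] [DecidableEq ν] {p : ℕ} (hp : p.Prime)
    (k : ν) {g : Unit × ℝ → ℝ} (hg : Continuous g) :
    SepHol {x : ν → ℂ | ∀ k, -(1 / 2) < (x k).re}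
      (fun q x => twistedLocalZeta p (g q) (1 / 2 + x k)) := by
  refine SepHol.inv (SepHol.sub (SepHol.const _ continuous_const) (SepHol.mul
    (SepHol.const _ (continuous_e.comp hg)) (Hol.param (hol_of_differentiableAt fun x _ => ?_))))
    fun q x hx => ?_
  · exact (differentiable_prime_cpow hp _).comp x (by fun_prop)
  · exact one_sub_e_mul_ne_zero hp (g q) (by have := hx k; simp; linarith)

lemma sepHol_localIntegrand {p : ℕ} (hp : p.Prime) {α : ι → ℂ} {β : κ → ℂ}
    (hα : ∀ i, 0 < (α i).re ∧ (α i).re < 1 / 4) (hβ : ∀ j, 0 < (β j).re ∧ (β j).re < 1 / 4)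
    (S : Finset ι) (T : Finset κ) :
    SepHol {x : ι ⊕ κ → ℂ | ∀ k, -(1 / 2) < (x k).re} (fun (q : Unit × ℝ) x =>
      localWeight p q.2 α β S T * ∏ k ∈ Sᶜ.disjSum Tᶜ, localVariable p q.2 α β k (x k)) := by
  refine SepHol.mul (SepHol.const _ ((continuous_localWeight hp hα hβ S T).comp continuous_snd))
    (SepHol.finset_prod fun k _ => ?_)
  have c₁ : ∀ i, 0 < (1 / 2 + α i).re := fun i => by have := (hα i).1; simp; linarith
  have c₂ : ∀ i, 0 < (1 / 2 + β i).re := fun i => by have := (hβ i).1; simp; linarith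
  cases k with
  | inl i =>
    simp only [localVariable, Sum.elim_inl, div_eq_mul_inv]
    have c : Continuous fun q : Unit × ℝ => -q.2 := continuous_snd.neg
    have h := (continuous_twistedLocalZeta hp (c₁ i)).comp c
    exact SepHol.mul (sepHol_twistedLocalZeta hp (Sum.inl i : ι ⊕ κ) c) (SepHol.const _
      (h.inv₀ fun q => twistedLocalZeta_ne_zero hp (-q.2) (c₁ i)))
  | inr j =>
    simp only [localVariable, Sum.elim_inr, div_eq_mul_inv]
    have c : Continuous fun q : Unit × ℝ => q.2 := continuous_snd
    have h := (continuous_twistedLocalZeta hp (c₂ j)).comp c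
    exact SepHol.mul (sepHol_twistedLocalZeta hp (Sum.inr j : ι ⊕ κ) c) (SepHol.const _
      (h.inv₀ fun q => twistedLocalZeta_ne_zero hp q.2 (c₂ j)))

/-- Differentiation under the integral turns the jet into the numerators of c_{S,T}, whose common
denominator is the value at ∅. So the logarithm given by the cumulants of the normalized jet is
H_{p,2}. -/
lemma logHol_integral_localIntegrand {p : ℕ} (hp : p.Prime) {α : ι → ℂ} {β : κ → ℂ}
    (hα : ∀ i, 0 < (α i).re ∧ (α i).re < 1 / 4) (hβ : ∀ j, 0 < (β j).re ∧ (β j).re < 1 / 4)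
    {S : Finset ι} {T : Finset κ} (hne : (∫ θ in (0 : ℝ)..1, localWeight p θ α β S T) ≠ 0) :
    LogHol (Sᶜ.disjSum Tᶜ) (fun x => ∫ θ in (0 : ℝ)..1, localWeight p θ α β S T *
      ∏ k ∈ Sᶜ.disjSum Tᶜ, localVariable p θ α β k (x k)) (Sum.elim α β)
      (cumulantTerm p α β S T) := by
  have hΩ : IsOpen {x : ι ⊕ κ → ℂ | ∀ k, -(1 / 2) < (x k).re} := isOpen_forall_lt_re _
  have hx : Sum.elim α β ∈ {x : ι ⊕ κ → ℂ | ∀ k, -(1 / 2) < (x k).re} := by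
    rintro (i | j)
    · have := (hα i).1; simp; linarith
    · have := (hβ j).1; simp; linarith
  have hK := sepHol_localIntegrand hp hα hβ S T
  have hjet : ∀ X ⊆ Sᶜ.disjSum Tᶜ, jet (fun x => ∫ θ in (0 : ℝ)..1, localWeight p θ α β S T *
      ∏ k ∈ Sᶜ.disjSum Tᶜ, localVariable p θ α β k (x k)) (Sum.elim α β) X =
      ∫ θ in (0 : ℝ)..1, localWeight p θ α β S T *
        (∏ i ∈ X.toLeft, logDeriv (twistedLocalZeta p (-θ)) (1 / 2 + α i)) *
          ∏ j ∈ X.toRight, logDeriv (twistedLocalZeta p θ) (1 / 2 + β j) := fun X hX => by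
    rw [jet_integral hΩ (hK.comp_param (g := fun θ : ℝ => ((), θ)) (by fun_prop)) 0 1 hx]
    simp only [jet_localIntegrand hp _ (fun i => (hα i).1) (fun j => (hβ j).1) hX]
  have h0 : jet (fun x => ∫ θ in (0 : ℝ)..1, localWeight p θ α β S T *
      ∏ k ∈ Sᶜ.disjSum Tᶜ, localVariable p θ α β k (x k)) (Sum.elim α β) ∅ =
      ∫ θ in (0 : ℝ)..1, localWeight p θ α β S T := by
    rw [hjet ∅ (Finset.empty_subset _), show (∅ : Finset (ι ⊕ κ)).toLeft = ∅ by ext; simp,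
      show (∅ : Finset (ι ⊕ κ)).toRight = ∅ by ext; simp]
    simp only [Finset.prod_empty, mul_one]
  refine ⟨((hK.integral hΩ 0 1).hol ()).holAt hΩ hx, ?_⟩
  refine (isLogOn_cumulants_div (by rw [h0]; exact hne) _).congr (fun _ _ => rfl)
    fun W hW _ => ?_
  refine (cumulants_congr (m := cumulantMoment p α β S T) fun X hX => ?_)
  rw [hjet X (hX.trans hW), h0]
  rfl

end LocalPart

/-! ### The logarithm of the local factor at p -/

section PrimeFactor

variable {ι κ : Type} [Fintype ι] [Fintype κ] [DecidableEq ι] [DecidableEq κ]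

/-- The factor at `p` of the Euler product in the term with `S`, `T` of the main term, as a function
of the numerator shifts. -/
noncomputable def swapLocal (p : ℕ) (α : ι → ℂ) (β : κ → ℂ) (S : Finset ι) (T : Finset κ)
    (x : ι ⊕ κ → ℂ) : ℂ :=
  arithLocal p (swapped (x ∘ .inl) (x ∘ .inr) S T) (swapped (x ∘ .inr) (x ∘ .inl) T S) α β

lemma swapLocal_freeze (p : ℕ) (α : ι → ℂ) (β : κ → ℂ) (S : Finset ι) (T : Finset κ)
    (x : ι ⊕ κ → ℂ) :
    swapLocal p α β S T (freeze (Sᶜ.disjSum Tᶜ) (Sum.elim α β) x) =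
      ((∏ _j ∈ T, localZeta p 1) * ∏ _i ∈ S, localZeta p 1) *
        frozenConst (fun z => (localZeta p z)⁻¹) (localZeta p) α β S T *
        variablePart (fun z => (localZeta p z)⁻¹) (localZeta p) α β S T x *
        ∫ θ in (0 : ℝ)..1, localWeight p θ α β S T *
          ∏ k ∈ Sᶜ.disjSum Tᶜ, localVariable p θ α β k (x k) := by
  unfold swapLocal arithLocal
  rw [localRatio_eq, pairProd_swapped, diagPart_freeze, offDiagPart_freeze]
  simp only [localIntegrand_freeze p _ α β S T x rfl]
  ring

/-- The frozen factor is a constant times the variable part for 1/z_p, which contributes -H_{p,1},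
times the integral over θ, which contributes H_{p,2}. -/
lemma logHol_swapLocal {p : ℕ} (hp : p.Prime) {α : ι → ℂ} {β : κ → ℂ}
    (hα : ∀ i, 0 < (α i).re ∧ (α i).re < 1 / 4) (hβ : ∀ j, 0 < (β j).re ∧ (β j).re < 1 / 4)
    {S : Finset ι} {T : Finset κ} (hne : (∫ θ in (0 : ℝ)..1, localWeight p θ α β S T) ≠ 0) :
    LogHol (Sᶜ.disjSum Tᶜ) (fun x => swapLocal p α β S T
      (freeze (Sᶜ.disjSum Tᶜ) (Sum.elim α β) x)) (Sum.elim α β) (primeTerm p α β S T) := by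
  have h₁ : ∀ i ∈ Sᶜ, ∀ k ∈ S, 1 + α i - α k ∈ {z : ℂ | 0 < z.re} := fun i _ k _ => by
    have := (hα i).1; have := (hα k).2; simp; linarith
  have h₂ : ∀ i ∈ Tᶜ, ∀ k ∈ T, 1 + β i - β k ∈ {z : ℂ | 0 < z.re} := fun i _ k _ => by
    have := (hβ i).1; have := (hβ k).2; simp; linarith
  have h₃ : ∀ i j, 1 + α i + β j ∈ {z : ℂ | 0 < z.re} := fun i j => by
    have := (hα i).1; have := (hβ j).1; simp; linarith
  have := ((logHol_const (Sᶜ.disjSum Tᶜ) (((∏ _j ∈ T, localZeta p 1) * ∏ _i ∈ S, localZeta p 1) *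
    frozenConst (fun z => (localZeta p z)⁻¹) (localZeta p) α β S T) (Sum.elim α β)).mul
    (logHol_variablePart (invPair_localZeta hp) h₁ h₂ h₃)).mul
    (logHol_integral_localIntegrand hp hα hβ hne)
  simp only [swapLocal_freeze]
  refine this.congr fun W _ _ => ?_
  rw [logDeriv_inv_fun, pairTerm_neg]
  unfold primeTerm
  ring

lemma swapLocal_base {p : ℕ} (hp : p.Prime) {α : ι → ℂ} {β : κ → ℂ}
    (hα : ∀ i, 0 < (α i).re ∧ (α i).re < 1 / 4) (hβ : ∀ j, 0 < (β j).re ∧ (β j).re < 1 / 4)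
    (S : Finset ι) (T : Finset κ) :
    swapLocal p α β S T (Sum.elim α β) =
      arithLocal p (-T.restrict β) (-S.restrict α) (S.restrict α) (T.restrict β) := by
  have h₁ : ∀ i ∈ Sᶜ, ∀ k ∈ S, 1 + α i - α k ∈ {z : ℂ | 0 < z.re} := fun i _ k _ => by
    have := (hα i).1; have := (hα k).2; simp; linarith
  have h₂ : ∀ i ∈ Tᶜ, ∀ k ∈ T, 1 + β i - β k ∈ {z : ℂ | 0 < z.re} := fun i _ k _ => by
    have := (hβ i).1; have := (hβ k).2; simp; linarith
  have h₃ : ∀ i j, 1 + α i + β j ∈ {z : ℂ | 0 < z.re} := fun i j => by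
    have := (hα i).1; have := (hβ j).1; simp; linarith
  unfold swapLocal arithLocal
  rw [localRatio_eq, pairProd_swapped, localRatio_eq,
    diagPart_mul_offDiagPart_base (invPair_localZeta hp) h₁ h₂ h₃]
  congr 2
  funext θ
  rw [localIntegrand_freeze p θ α β S T (Sum.elim α β) (freeze_self _ _)]
  simp only [localVariable_base hp θ (fun i => (hα i).1) fun j => (hβ j).1, Finset.prod_const_one,
    mul_one]
  rfl

lemma swapLocal_base_ne_zero {p : ℕ} (hp : p.Prime) {α : ι → ℂ} {β : κ → ℂ}
    (hα : ∀ i, 0 < (α i).re ∧ (α i).re < 1 / 4) (hβ : ∀ j, 0 < (β j).re ∧ (β j).re < 1 / 4)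
    {S : Finset ι} {T : Finset κ} (hne : (∫ θ in (0 : ℝ)..1, localWeight p θ α β S T) ≠ 0) :
    swapLocal p α β S T (Sum.elim α β) ≠ 0 := by
  rw [swapLocal_base hp hα hβ]
  have hpos : ∀ {z : ℂ}, 0 < z.re → localZeta p z ≠ 0 := fun h => localZeta_ne_zero hp h
  refine mul_ne_zero ?_ hne
  rw [localRatio_eq]
  refine mul_ne_zero (mul_ne_zero ?_ ?_) (mul_ne_zero ?_ ?_) <;>
    refine Finset.prod_ne_zero_iff.2 fun i _ => Finset.prod_ne_zero_iff.2 fun j _ => ?_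
  · have := (hβ i).2; have := (hα j).2
    exact inv_ne_zero (hpos (by simp; linarith))
  · have := (hα i).1; have := (hβ j).1
    exact inv_ne_zero (hpos (by simp; linarith))
  · have := (hβ i).2; have := (hβ j).1
    exact hpos (by simp; linarith)
  · have := (hα i).2; have := (hα j).1
    exact hpos (by simp; linarith)

end PrimeFactor

/-! ### The logarithm of the Euler product -/

section EulerProduct

variable {ι κ : Type} [Fintype ι] [Fintype κ] [DecidableEq ι] [DecidableEq κ]

/-- The factor `𝒜_ζ(S̄+T⁻, T̄+S⁻; A, B)` as a function of the numerator shifts. -/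
noncomputable def swapArith (α : ι → ℂ) (β : κ → ℂ) (S : Finset ι) (T : Finset κ)
    (x : ι ⊕ κ → ℂ) : ℂ :=
  arithFactor (swapped (x ∘ .inl) (x ∘ .inr) S T) (swapped (x ∘ .inr) (x ∘ .inl) T S) α β

/-- The real parts are in `(-r, r)`. -/
def reBall (ν : Type*) (r : ℝ) : Set (ν → ℂ) := {x | ∀ k, |(x k).re| < r}

lemma isOpen_reBall {ν : Type*} [Finite ν] (r : ℝ) : IsOpen (reBall ν r) := by
  have : reBall ν r = ⋂ k, {x | |(x k).re| < r} := by ext; simp [reBall]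
  rw [this]
  exact isOpen_iInter_of_finite fun k =>
    isOpen_lt ((Complex.continuous_re.comp (continuous_apply k)).abs) continuous_const

lemma exists_mem_reBall {ν : Type*} [Finite ν] {x : ν → ℂ} {R : ℝ} (h : ∀ k, |(x k).re| < R) :
    ∃ r < R, x ∈ reBall ν r := by
  cases nonempty_fintype ν
  obtain ⟨r, hr, hrR⟩ : ∃ r, (∀ k ∈ Finset.univ, |(x k).re| < r) ∧ r < R := by
    by_cases hν : Nonempty ν
    · obtain ⟨k, -, hk⟩ := Finset.exists_max_image Finset.univ (fun k => |(x k).re|)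
        Finset.univ_nonempty
      obtain ⟨r, h1, h2⟩ := exists_between (h k)
      exact ⟨r, fun l hl => (hk l hl).trans_lt h1, h2⟩
    -- Without coordinates any r < R will do, even a negative one.
    · exact ⟨R - 1, fun k _ => (hν ⟨k⟩).elim, by linarith⟩
  exact ⟨r, hrR, fun k => hr k (Finset.mem_univ k)⟩

lemma holShifts_swapped (S : Finset ι) (T : Finset κ) (r : ℝ) :
    HolShifts (reBall (ι ⊕ κ) r) (-r)
      (fun x : ι ⊕ κ → ℂ => swapped (x ∘ .inl) (x ∘ .inr) S T) where
  diff x _ k := by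
    cases k
    · simp only [swapped, Sum.elim_inl, comp_apply]; fun_prop
    · simp only [swapped, Sum.elim_inr, comp_apply]; fun_prop
  re_ge x hx k := by
    cases k with
    | inl i => exact (abs_lt.1 (hx (.inl i))).1.le
    | inr j =>
      have := (abs_lt.1 (hx (.inr j))).2
      simp [swapped]; linarith

lemma holShifts_swapped' (S : Finset ι) (T : Finset κ) (r : ℝ) :
    HolShifts (reBall (ι ⊕ κ) r) (-r)
      (fun x : ι ⊕ κ → ℂ => swapped (x ∘ .inr) (x ∘ .inl) T S) where
  diff x _ k := by
    cases k
    · simp only [swapped, Sum.elim_inl, comp_apply]; fun_prop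
    · simp only [swapped, Sum.elim_inr, comp_apply]; fun_prop
  re_ge x hx k := by
    cases k with
    | inl i => exact (abs_lt.1 (hx (.inr i))).1.le
    | inr j =>
      have := (abs_lt.1 (hx (.inl j))).2
      simp [swapped]; linarith

lemma holShifts_const {ν τ : Type} [Fintype ν] [DecidableEq ν] {Ω : Set (ν → ℂ)} {r : ℝ}
    {a : τ → ℂ} (ha : ∀ i, r ≤ (a i).re) : HolShifts Ω r (fun _ => a) :=
  ⟨fun _ _ _ => differentiableAt_const _, fun _ _ => ha⟩

/-- The set `reBall` of radius 1/4 leaves no margin, but each of its points lies in a smaller one of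
radius r < 1/4. There the Euler product converges with δ = 1/4 - max(r, 0). -/
lemma tendstoLocallyUniformlyOn_swapLocal {α : ι → ℂ} {β : κ → ℂ} (hα : ∀ i, 0 < (α i).re)
    (hβ : ∀ j, 0 < (β j).re) (S : Finset ι) (T : Finset κ) :
    TendstoLocallyUniformlyOn
      (fun (s : Finset Nat.Primes) x => ∏ p ∈ s, swapLocal p α β S T x)
      (swapArith α β S T) atTop (reBall (ι ⊕ κ) (1 / 4)) := by
  intro u hu x hx
  obtain ⟨r, hr, hxr⟩ := exists_mem_reBall hx
  have hmax : max r 0 < 1 / 4 := max_lt hr (by norm_num)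
  have hδ : (0 : ℝ) < 1 / 4 - max r 0 := by linarith
  have hsub : reBall (ι ⊕ κ) r ⊆ reBall (ι ⊕ κ) (max r 0) := fun y hy k =>
    (hy k).trans_le (le_max_left _ _)
  have e : -(1 / 4) + (1 / 4 - max r 0) = -max r 0 := by ring
  have hc : ∀ {τ : Type} {a : τ → ℂ}, (∀ i, 0 < (a i).re) → ∀ i, -max r 0 ≤ (a i).re :=
    fun h i => by have := h i; have := le_max_right r 0; linarith
  have := tendstoLocallyUniformlyOn_arith (isOpen_reBall (ν := ι ⊕ κ) (max r 0)) hδ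
    (by rw [e]; exact holShifts_swapped S T _) (by rw [e]; exact holShifts_swapped' S T _)
    (by rw [e]; exact holShifts_const (hc hα)) (by rw [e]; exact holShifts_const (hc hβ))
  obtain ⟨t, ht, h⟩ := this u hu x (hsub hxr)
  rw [(isOpen_reBall _).nhdsWithin_eq (hsub hxr)] at ht
  exact ⟨t, mem_nhdsWithin_of_mem_nhds ht, h⟩

lemma hol_prod_swapLocal {α : ι → ℂ} {β : κ → ℂ} (hα : ∀ i, 0 < (α i).re)
    (hβ : ∀ j, 0 < (β j).re) (S : Finset ι) (T : Finset κ) (s : Finset Nat.Primes) :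
    Hol (reBall (ι ⊕ κ) (1 / 4)) (fun x => ∏ p ∈ s, swapLocal p α β S T x) := by
  refine SepHol.finset_prod fun p _ => ?_
  refine hol_arithLocal (isOpen_reBall _) (r := -(1 / 4)) (by norm_num) (holShifts_swapped S T _)
    (holShifts_swapped' S T _) (holShifts_const fun i => ?_) (holShifts_const fun i => ?_) p.2
  · have := hα i; linarith
  · have := hβ i; linarith

lemma hol_swapArith {α : ι → ℂ} {β : κ → ℂ} (hα : ∀ i, 0 < (α i).re)
    (hβ : ∀ j, 0 < (β j).re) (S : Finset ι) (T : Finset κ) :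
    Hol (reBall (ι ⊕ κ) (1 / 4)) (swapArith α β S T) :=
  hol_of_tendstoLocallyUniformlyOn (isOpen_reBall _)
    (Eventually.of_forall fun s => hol_prod_swapLocal hα hβ S T s)
    (tendstoLocallyUniformlyOn_swapLocal hα hβ S T)

lemma exists_margin {τ υ : Type} [Finite τ] [Finite υ] {α : τ → ℂ} {β : υ → ℂ}
    (hα : ∀ i, 0 < (α i).re ∧ (α i).re < 1 / 4) (hβ : ∀ j, 0 < (β j).re ∧ (β j).re < 1 / 4) :
    ∃ δ : ℝ, 0 < δ ∧ δ ≤ 1 / 4 ∧ (∀ i, (α i).re ≤ 1 / 4 - δ) ∧ ∀ j, (β j).re ≤ 1 / 4 - δ := by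
  obtain ⟨r, hr, h⟩ := exists_mem_reBall (x := Sum.elim α β) (R := 1 / 4) (by
    rintro (i | j)
    · exact abs_lt.2 ⟨by have := (hα i).1; simp; linarith, (hα i).2⟩
    · exact abs_lt.2 ⟨by have := (hβ j).1; simp; linarith, (hβ j).2⟩)
  have hmax : max r 0 < 1 / 4 := max_lt hr (by norm_num)
  refine ⟨1 / 4 - max r 0, by linarith, by have := le_max_right r 0; linarith, fun i => ?_,
    fun j => ?_⟩
  · have : (α i).re < r := (abs_lt.1 (h (.inl i))).2
    have := le_max_left r 0; linarith
  · have : (β j).re < r := (abs_lt.1 (h (.inr j))).2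
    have := le_max_left r 0; linarith

lemma multipliable_arithLocal_base {α : ι → ℂ} {β : κ → ℂ}
    (hα : ∀ i, 0 < (α i).re ∧ (α i).re < 1 / 4) (hβ : ∀ j, 0 < (β j).re ∧ (β j).re < 1 / 4)
    (S : Finset ι) (T : Finset κ) : Multipliable fun p : Nat.Primes =>
      arithLocal p (-T.restrict β) (-S.restrict α) (S.restrict α) (T.restrict β) := by
  obtain ⟨δ, hδ, hδ', h₁, h₂⟩ := exists_margin hα hβ
  refine multipliable_arithLocal hδ (fun i => ?_) (fun i => ?_) (fun i => ?_) fun i => ?_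
  · have := h₂ i; simp; linarith
  · have := h₁ i; simp; linarith
  · have := (hα i).1; simp; linarith
  · have := (hβ i).1; simp; linarith

lemma swapArith_base {α : ι → ℂ} {β : κ → ℂ}
    (hα : ∀ i, 0 < (α i).re ∧ (α i).re < 1 / 4) (hβ : ∀ j, 0 < (β j).re ∧ (β j).re < 1 / 4)
    (S : Finset ι) (T : Finset κ) : swapArith α β S T (Sum.elim α β) =
      arithFactor (-T.restrict β) (-S.restrict α) (S.restrict α) (T.restrict β) :=
  tprod_congr fun p => swapLocal_base p.2 hα hβ S T

lemma swapArith_base_ne_zero {α : ι → ℂ} {β : κ → ℂ}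
    (hα : ∀ i, 0 < (α i).re ∧ (α i).re < 1 / 4) (hβ : ∀ j, 0 < (β j).re ∧ (β j).re < 1 / 4)
    {S : Finset ι} {T : Finset κ}
    (hne : ∀ p : Nat.Primes, (∫ θ in (0 : ℝ)..1, localWeight p θ α β S T) ≠ 0) :
    swapArith α β S T (Sum.elim α β) ≠ 0 := by
  rw [swapArith_base hα hβ]
  obtain ⟨δ, hδ, hδ', h₁, h₂⟩ := exists_margin hα hβ
  refine arithFactor_ne_zero hδ (fun i => ?_) (fun i => ?_) (fun i => ?_) (fun i => ?_) fun p => ?_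
  · have := h₂ i; simp; linarith
  · have := h₁ i; simp; linarith
  · have := (hα i).1; simp; linarith
  · have := (hβ i).1; simp; linarith
  · rw [← swapLocal_base p.2 hα hβ]
    exact swapLocal_base_ne_zero p.2 hα hβ (hne p)

lemma mem_reBall_base {α : ι → ℂ} {β : κ → ℂ}
    (hα : ∀ i, 0 < (α i).re ∧ (α i).re < 1 / 4) (hβ : ∀ j, 0 < (β j).re ∧ (β j).re < 1 / 4) :
    Sum.elim α β ∈ reBall (ι ⊕ κ) (1 / 4) := by
  rintro (i | j)
  · exact abs_lt.2 ⟨by have := (hα i).1; simp; linarith, (hα i).2⟩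
  · exact abs_lt.2 ⟨by have := (hβ j).1; simp; linarith, (hβ j).2⟩

/-- The product over a finite set of primes has as logarithm the corresponding partial sum of
`primeTerm`. The products converge with their derivatives to a function that does not vanish at the
base point, so these partial sums converge along all finite sets of primes, which is unconditional
convergence. -/
lemma hasSum_primeTerm {α : ι → ℂ} {β : κ → ℂ}
    (hα : ∀ i, 0 < (α i).re ∧ (α i).re < 1 / 4) (hβ : ∀ j, 0 < (β j).re ∧ (β j).re < 1 / 4)
    {S : Finset ι} {T : Finset κ}
    (hne : ∀ p : Nat.Primes, (∫ θ in (0 : ℝ)..1, localWeight p θ α β S T) ≠ 0) :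
    ∀ W ⊆ Sᶜ.disjSum Tᶜ, W.Nonempty → HasSum (fun p : Nat.Primes => primeTerm p α β S T W)
      (cumulants (fun X => jet (swapArith α β S T) (Sum.elim α β) X /
        jet (swapArith α β S T) (Sum.elim α β) ∅) W) := by
  refine IsLogOn.tendsto (l := atTop) (U := Sᶜ.disjSum Tᶜ)
    (f := fun (s : Finset Nat.Primes) =>
      jet (fun x => ∏ p ∈ s, swapLocal p α β S T x) (Sum.elim α β))
    (κ := fun s W => ∑ p ∈ s, primeTerm p α β S T W) (fun s => ?_) (fun X => ?_) ?_
  · refine (LogHol.prod s fun p _ =>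
      logHol_swapLocal p.2 hα hβ (hne p)).isLogOn.congr (fun X hX => ?_) fun _ _ _ => rfl
    exact (jet_freeze hX (Sum.elim α β) fun x => ∏ p ∈ s, swapLocal p α β S T x).symm
  · exact tendsto_jet (isOpen_reBall _)
      (Eventually.of_forall fun s => hol_prod_swapLocal (fun i => (hα i).1) (fun j => (hβ j).1) S T s)
      (tendstoLocallyUniformlyOn_swapLocal (fun i => (hα i).1) (fun j => (hβ j).1) S T)
      (mem_reBall_base hα hβ) X
  · rw [jet_empty]; exact swapArith_base_ne_zero hα hβ hne

/-- If the complements of S and T are empty the assertion is void, so the local integrals need not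
be nonzero in that case. -/
lemma isLogOn_swapArith {α : ι → ℂ} {β : κ → ℂ}
    (hα : ∀ i, 0 < (α i).re ∧ (α i).re < 1 / 4) (hβ : ∀ j, 0 < (β j).re ∧ (β j).re < 1 / 4)
    {S : Finset ι} {T : Finset κ} (hne : (Sᶜ.disjSum Tᶜ).Nonempty →
      ∀ p : Nat.Primes, (∫ θ in (0 : ℝ)..1, localWeight p θ α β S T) ≠ 0) :
    IsLogOn (Sᶜ.disjSum Tᶜ) (jet (swapArith α β S T) (Sum.elim α β))
      (fun W => ∑' p : Nat.Primes, primeTerm p α β S T W) := by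
  by_cases hU : (Sᶜ.disjSum Tᶜ).Nonempty
  · refine (isLogOn_cumulants_div ?_ _).congr (fun _ _ => rfl) fun W hW hW' =>
      (hasSum_primeTerm hα hβ (hne hU) W hW hW').tsum_eq
    rw [jet_empty]; exact swapArith_base_ne_zero hα hβ (hne hU)
  · rw [Finset.not_nonempty_iff_eq_empty.1 hU]
    exact fun V w _ h => absurd (h (Finset.mem_insert_self _ _)) (Finset.notMem_empty _)

end EulerProduct

/-! ### Composition with holomorphic functions -/

section Composition

variable {P : Type*} [TopologicalSpace P] {ν : Type*} [Fintype ν] [DecidableEq ν]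
  {Ω : Set (ν → ℂ)}

lemma SepHol.comp {D : Set ℂ} {φ : ℂ → ℂ} (hφ : ∀ z ∈ D, DifferentiableAt ℂ φ z)
    {K : P → (ν → ℂ) → ℂ} (hK : SepHol Ω K) (hm : ∀ p, ∀ x ∈ Ω, K p x ∈ D) :
    SepHol Ω (fun p x => φ (K p x)) where
  cont := (show ContinuousOn φ D from fun z hz =>
    (hφ z hz).continuousAt.continuousWithinAt).comp hK.cont fun q hq => hm q.1 q.2 hq.2
  diff p x hx i := by
    have h : DifferentiableAt ℂ φ (K p (update x i (x i))) := by
      rw [update_eq_self]; exact hφ _ (hm p x hx)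
    exact h.comp (x i) (hK.diff p x hx i)

lemma sepHol_coord (k : ν) : SepHol Ω (fun (_ : P) x => x k) :=
  Hol.param (hol_of_differentiableAt fun x _ => by fun_prop)

end Composition

/-! ### The domain of the numerator shifts and the main term on it -/

section Domain

variable {ι κ : Type} [Fintype ι] [Fintype κ] [DecidableEq ι] [DecidableEq κ]

/-- The region in which the Ratios Conjecture is applied to the numerator shifts. -/
def shiftDomain (ι κ : Type) : Set (ι ⊕ κ → ℂ) :=
  {x | (∀ k, 0 < (x k).re ∧ (x k).re < 1 / 4) ∧ Injective (x ∘ Sum.inl) ∧ Injective (x ∘ Sum.inr)}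

lemma isOpen_injective_comp {ν τ : Type*} [Finite τ] (f : τ → ν) :
    IsOpen {x : ν → ℂ | Injective (x ∘ f)} := by
  have : {x : ν → ℂ | Injective (x ∘ f)} = ⋂ i, ⋂ j, {x | i ≠ j → x (f i) ≠ x (f j)} := by
    ext x
    simp only [mem_ofPred_eq, mem_iInter, Injective, comp_apply]
    exact ⟨fun h i j hij e => hij (h e), fun h i j e => by_contra fun hij => h i j hij e⟩
  rw [this]
  refine isOpen_iInter_of_finite fun i => isOpen_iInter_of_finite fun j => ?_
  by_cases hij : i = j
  · simp [hij]
  · simp only [hij, ne_eq, not_false_eq_true, true_imp_iff]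
    exact isOpen_ne_fun (continuous_apply _) (continuous_apply _)

lemma isOpen_shiftDomain : IsOpen (shiftDomain ι κ) := by
  have : shiftDomain ι κ = (⋂ k, {x | 0 < (x k).re ∧ (x k).re < 1 / 4}) ∩
      ({x | Injective (x ∘ Sum.inl)} ∩ {x | Injective (x ∘ Sum.inr)}) := by
    ext; simp [shiftDomain]
  rw [this]
  refine IsOpen.inter (isOpen_iInter_of_finite fun k => ?_)
    ((isOpen_injective_comp _).inter (isOpen_injective_comp _))
  have : Continuous fun x : ι ⊕ κ → ℂ => (x k).re :=
    Complex.continuous_re.comp (continuous_apply k)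
  exact (isOpen_lt continuous_const this).inter (isOpen_lt this continuous_const)

lemma shiftDomain_subset_reBall : shiftDomain ι κ ⊆ reBall (ι ⊕ κ) (1 / 4) := fun x hx k =>
  abs_lt.2 ⟨by have := (hx.1 k).1; linarith, (hx.1 k).2⟩

lemma elim_mem_shiftDomain {α : ι → ℂ} {β : κ → ℂ} (hαi : Injective α) (hβi : Injective β)
    (hα : ∀ i, 0 < (α i).re ∧ (α i).re < 1 / 4) (hβ : ∀ j, 0 < (β j).re ∧ (β j).re < 1 / 4) :
    Sum.elim α β ∈ shiftDomain ι κ :=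
  ⟨by rintro (i | j); exacts [hα i, hβ j], hαi, hβi⟩

lemma invPair_zeta (hRH : RiemannHypothesis) :
    InvPair {z | 1 / 2 < z.re ∧ z ≠ 1} riemannZeta invZeta where
  isOpen := (isOpen_lt continuous_const Complex.continuous_re).inter isOpen_ne
  diff _ hz := differentiableAt_riemannZeta hz.2
  ne_zero _ hz := riemannZeta_ne_zero_of_half_lt_re hRH hz.1
  inv _ hz := if_neg hz.2

lemma hol_comp_zeta {f : (ι ⊕ κ → ℂ) → ℂ} (hf : Differentiable ℂ f)
    (hne : ∀ x ∈ shiftDomain ι κ, f x ≠ 1) :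
    Hol (shiftDomain ι κ) (fun x => riemannZeta (f x)) :=
  hol_of_differentiableAt fun x hx => (differentiableAt_riemannZeta (hne x hx)).comp x (hf x)

lemma hol_comp_invZeta (hRH : RiemannHypothesis) {f : (ι ⊕ κ → ℂ) → ℂ} (hf : Differentiable ℂ f)
    (hre : ∀ x ∈ shiftDomain ι κ, 1 / 2 < (f x).re) :
    Hol (shiftDomain ι κ) (fun x => invZeta (f x)) :=
  hol_of_differentiableAt fun x hx => (differentiableAt_invZeta hRH (hre x hx)).comp x (hf x)

lemma hol_diagPart (hRH : RiemannHypothesis) {α : ι → ℂ} {β : κ → ℂ} (hα : ∀ i, 0 < (α i).re)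
    (hβ : ∀ j, 0 < (β j).re) (S : Finset ι) (T : Finset κ) :
    Hol (shiftDomain ι κ) (diagPart invZeta α β S T) := by
  refine SepHol.mul (SepHol.finset_prod fun j _ => hol_comp_invZeta hRH (by fun_prop)
    fun x hx => ?_) (SepHol.finset_prod fun i _ => hol_comp_invZeta hRH (by fun_prop) fun x hx => ?_)
  · have := (hx.1 (.inr j)).2; have := hβ j; simp; linarith
  · have := (hx.1 (.inl i)).2; have := hα i; simp; linarith

lemma hol_offDiagPart (hRH : RiemannHypothesis) {α : ι → ℂ} {β : κ → ℂ} (hα : ∀ i, 0 < (α i).re)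
    (hβ : ∀ j, 0 < (β j).re) (S : Finset ι) (T : Finset κ) :
    Hol (shiftDomain ι κ) (offDiagPart riemannZeta invZeta α β S T) := by
  have hre : ∀ {z : ℂ}, z.re ≠ 1 → z ≠ 1 := fun h h' => h (by rw [h']; rfl)
  refine SepHol.mul (SepHol.mul (SepHol.mul (SepHol.mul ?_ ?_) (SepHol.mul ?_ ?_))
    (SepHol.const _ continuous_const)) (SepHol.mul (SepHol.mul ?_ ?_) (SepHol.mul ?_ ?_)) <;>
    refine SepHol.finset_prod fun i hi => SepHol.finset_prod fun j hj => ?_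
  · refine hol_comp_zeta (by fun_prop) fun x hx => hre ?_
    have := (hx.1 (.inl i)).1; have := (hx.1 (.inr j)).1; simp; linarith
  -- The argument 1 + x_i - x_k is kept off the pole of ζ only by the distinctness of the shifts.
  · refine hol_comp_zeta (by fun_prop) fun x hx h => ?_
    have : x (.inl i) = x (.inl j) := by linear_combination h
    rw [Finset.mem_compl] at hi
    exact hi (hx.2.1 this ▸ hj)
  · refine hol_comp_zeta (by fun_prop) fun x hx h => ?_
    have : x (.inr i) = x (.inr j) := by linear_combination -h
    rw [Finset.mem_compl] at hj
    exact hj (hx.2.2 this ▸ hi)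
  · refine hol_comp_zeta (by fun_prop) fun x hx => hre ?_
    have := (hx.1 (.inr i)).1; have := (hx.1 (.inl j)).1; simp; linarith
  · refine hol_comp_invZeta hRH (by fun_prop) fun x hx => ?_
    have := (hx.1 (.inl i)).1; have := hβ j; simp; linarith
  · refine hol_comp_invZeta hRH (by fun_prop) fun x hx => ?_
    have := (hx.1 (.inr i)).2; have := hβ j; simp; linarith
  · refine hol_comp_invZeta hRH (by fun_prop) fun x hx => ?_
    have := (hx.1 (.inr i)).1; have := hα j; simp; linarith
  · refine hol_comp_invZeta hRH (by fun_prop) fun x hx => ?_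
    have := (hx.1 (.inl i)).2; have := hα j; simp; linarith

lemma sepHol_chiFactor (S : Finset ι) (T : Finset κ) :
    SepHol (shiftDomain ι κ) (fun (t : ℝ) x => chiFactor t (x ∘ .inl) (x ∘ .inr) S T) := by
  refine SepHol.mul (SepHol.finset_prod fun i _ => ?_) (SepHol.finset_prod fun j _ => ?_)
  · refine SepHol.comp (D := {z | z.re < 1}) (fun z hz => differentiableAt_chi hz)
      (SepHol.add (SepHol.const _ (by fun_prop)) (sepHol_coord (Sum.inl i : ι ⊕ κ))) fun t x hx => ?_
    have := (hx.1 (.inl i)).2; simp; linarith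
  · refine SepHol.comp (D := {z | z.re < 1}) (fun z hz => differentiableAt_chi hz)
      (SepHol.add (SepHol.const _ (by fun_prop)) (sepHol_coord (Sum.inr j : ι ⊕ κ))) fun t x hx => ?_
    have := (hx.1 (.inr j)).2; simp; linarith

/-- The term of `ℛ_{ζ,t}` with `S` and `T`, without the factors in `diagPart`. -/
noncomputable def mainRest (t : ℝ) (α : ι → ℂ) (β : κ → ℂ) (S : Finset ι) (T : Finset κ)
    (x : ι ⊕ κ → ℂ) : ℂ :=
  chiFactor t (x ∘ .inl) (x ∘ .inr) S T * offDiagPart riemannZeta invZeta α β S T x *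
    swapArith α β S T x

lemma ratiosMain_eq (t : ℝ) (α : ι → ℂ) (β : κ → ℂ) (x : ι ⊕ κ → ℂ) :
    ratiosMain t (x ∘ .inl) (x ∘ .inr) α β = ∑ S : Finset ι, ∑ T : Finset κ with S.card = T.card,
      diagPart invZeta α β S T x * mainRest t α β S T x := by
  refine Finset.sum_congr rfl fun S _ => Finset.sum_congr rfl fun T _ => ?_
  have h : zetaRatio (swapped (x ∘ .inl) (x ∘ .inr) S T) (swapped (x ∘ .inr) (x ∘ .inl) T S) α β =
      diagPart invZeta α β S T x * offDiagPart riemannZeta invZeta α β S T x :=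
    pairProd_swapped riemannZeta invZeta α β S T x
  rw [h]
  unfold mainRest swapArith
  ring

lemma sepHol_mainRest (hRH : RiemannHypothesis) {α : ι → ℂ} {β : κ → ℂ} (hα : ∀ i, 0 < (α i).re)
    (hβ : ∀ j, 0 < (β j).re) (S : Finset ι) (T : Finset κ) :
    SepHol (shiftDomain ι κ) (fun t => mainRest t α β S T) :=
  ((sepHol_chiFactor S T).mul (hol_offDiagPart hRH hα hβ S T).param).mul
    (Hol.param ((hol_swapArith hα hβ S T).mono shiftDomain_subset_reBall))

lemma sepHol_ratiosMain (hRH : RiemannHypothesis) {α : ι → ℂ} {β : κ → ℂ} (hα : ∀ i, 0 < (α i).re)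
    (hβ : ∀ j, 0 < (β j).re) :
    SepHol (shiftDomain ι κ) (fun t x => ratiosMain t (x ∘ .inl) (x ∘ .inr) α β) := by
  simp only [ratiosMain_eq]
  exact SepHol.finset_sum fun S _ => SepHol.finset_sum fun T _ =>
    (hol_diagPart hRH hα hβ S T).param.mul (sepHol_mainRest hRH hα hβ S T)

end Domain

/-! ### The mixed derivative of the main term -/

section Jets

variable {ι κ : Type} [Fintype ι] [Fintype κ] [DecidableEq ι] [DecidableEq κ]

/-- One factor with a simple zero for each coordinate of S+T: any derivative that misses one of them
leaves a zero. Each slope is -1, since the variable enters with a minus sign, and |S| = |T| makes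
their number even. -/
lemma jet_diagPart (α : ι → ℂ) (β : κ → ℂ) {S : Finset ι} {T : Finset κ}
    (hST : S.card = T.card) (X : Finset (ι ⊕ κ)) :
    jet (diagPart invZeta α β S T) (Sum.elim α β) X = if X = S.disjSum T then 1 else 0 := by
  set φ : ι ⊕ κ → ℂ → ℂ := fun k z => invZeta (1 + -z + Sum.elim α β k) with hφ
  have h : diagPart invZeta α β S T = fun x => ∏ k ∈ S.disjSum T, φ k (x k) := by
    funext x
    rw [Finset.prod_disjSum, mul_comm]
    rfl
  have h0 : ∀ k, φ k (Sum.elim α β k) = 0 := fun k => by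
    simp only [hφ]
    rw [show 1 + -Sum.elim α β k + Sum.elim α β k = 1 by ring, invZeta_one]
  have h1 : ∀ k, deriv (φ k) (Sum.elim α β k) = -1 := fun k => by
    have e : 1 + -Sum.elim α β k + Sum.elim α β k = 1 := by ring
    have hin : HasDerivAt (fun z : ℂ => 1 + -z + Sum.elim α β k) (-1) (Sum.elim α β k) :=
      ((hasDerivAt_id _).neg.const_add 1).add_const _
    have hz : HasDerivAt invZeta 1 (1 + -Sum.elim α β k + Sum.elim α β k) := by
      rw [e]; exact hasDerivAt_invZeta_one
    have h := (HasDerivAt.comp (h := fun z => 1 + -z + Sum.elim α β k) _ hz hin).deriv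
    rw [one_mul] at h
    exact h
  rw [h, jet_prod]
  simp only [h0, h1]
  by_cases hX : X = S.disjSum T
  · subst hX
    rw [if_pos subset_rfl, if_pos rfl, Finset.prod_congr rfl fun k hk => if_pos hk,
      Finset.prod_const, Finset.card_disjSum, hST, ← two_mul, pow_mul]
    simp
  · rw [if_neg hX]
    split_ifs with hsub
    · obtain ⟨k, hk, hkX⟩ := Finset.exists_of_ssubset (hsub.ssubset_of_ne hX)
      exact Finset.prod_eq_zero hk (if_neg hkX)
    · rfl

/-- In the Leibniz rule only the term survives in which the zero factors receive exactly the
variables of S+T. -/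
lemma jet_diagPart_mul {α : ι → ℂ} {β : κ → ℂ} {S : Finset ι} {T : Finset κ}
    (hST : S.card = T.card) {G : (ι ⊕ κ → ℂ) → ℂ}
    (hD : HolAt (diagPart invZeta α β S T) (Sum.elim α β)) (hG : HolAt G (Sum.elim α β)) :
    jet (fun x => diagPart invZeta α β S T x * G x) (Sum.elim α β) Finset.univ =
      jet G (Sum.elim α β) (Sᶜ.disjSum Tᶜ) := by
  have hc : Finset.univ \ S.disjSum T = Sᶜ.disjSum Tᶜ := by
    ext k; cases k <;> simp
  rw [jet_mul' hD hG, subsetConv, Finset.sum_eq_single (S.disjSum T)]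
  · rw [jet_diagPart α β hST, if_pos rfl, one_mul, hc]
  · intro Y _ hY
    rw [jet_diagPart α β hST, if_neg hY, zero_mul]
  · simp

lemma chiFactor_freeze (t : ℝ) (α : ι → ℂ) (β : κ → ℂ) (S : Finset ι) (T : Finset κ)
    {x y : ι ⊕ κ → ℂ} (hy : freeze (Sᶜ.disjSum Tᶜ) (Sum.elim α β) x = y) :
    chiFactor t (y ∘ .inl) (y ∘ .inr) S T = chiFactor t α β S T := by
  subst hy
  unfold chiFactor
  congr 1
  · exact Finset.prod_congr rfl fun i hi => by rw [comp_apply, freeze_inl_of_mem x hi]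
  · exact Finset.prod_congr rfl fun i hi => by rw [comp_apply, freeze_inr_of_mem x hi]

lemma prod_erase_comm {τ : Type*} [DecidableEq τ] (S : Finset τ) (F : τ → τ → ℂ) :
    ∏ i ∈ S, ∏ k ∈ S.erase i, F i k = ∏ i ∈ S, ∏ k ∈ S.erase i, F k i :=
  Finset.prod_comm' fun i k => by
    simp only [Finset.mem_erase, ne_comm]; tauto

/-- As the numbers are distinct, the factors that the dagger removes are exactly the diagonal ones.
-/
lemma zetaProdDagger_restrict {τ : Type} [DecidableEq τ] (S : Finset τ) {a : τ → ℂ}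
    (ha : Injective a) : zetaProdDagger (S.restrict a) (-S.restrict a) =
      ∏ i ∈ S, ∏ k ∈ S.erase i, riemannZeta (1 + -a i + a k) := by
  have h : zetaProdDagger (S.restrict a) (-S.restrict a) =
      ∏ i ∈ S, ∏ k ∈ S, if a i + -a k = 0 then 1 else riemannZeta (1 + a i + -a k) := by
    unfold zetaProdDagger
    rw [← Finset.prod_coe_sort S]
    exact Finset.prod_congr rfl fun i _ => Finset.prod_coe_sort S
      fun k => if a i + -a k = 0 then 1 else riemannZeta (1 + a i + -a k)
  rw [h, prod_erase_comm]
  refine Finset.prod_congr rfl fun i hi => ?_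
  rw [← Finset.mul_prod_erase S _ hi, if_pos (by ring), one_mul]
  refine Finset.prod_congr rfl fun k hk => ?_
  rw [if_neg fun h => (Finset.ne_of_mem_erase hk) (ha (by linear_combination -h))]
  congr 1; ring

lemma prod_invZeta_erase {τ : Type} [DecidableEq τ] (S : Finset τ) {a : τ → ℂ}
    (ha : Injective a) : ∏ i ∈ S, ∏ k ∈ S.erase i, invZeta (1 + -a i + a k) =
      (zetaProdDagger (S.restrict a) (-S.restrict a))⁻¹ := by
  rw [zetaProdDagger_restrict S ha]
  simp only [← Finset.prod_inv_distrib]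
  refine Finset.prod_congr rfl fun i _ => Finset.prod_congr rfl fun k hk => if_neg fun h =>
    (Finset.ne_of_mem_erase hk) (ha (by linear_combination h))

/-- The mixed derivative of a term of `ℛ_{ζ,t}`. -/
lemma jet_mainRest (hRH : RiemannHypothesis) (t : ℝ) {α : ι → ℂ} {β : κ → ℂ}
    (hαi : Injective α) (hβi : Injective β)
    (hα : ∀ i, 0 < (α i).re ∧ (α i).re < 1 / 4) (hβ : ∀ j, 0 < (β j).re ∧ (β j).re < 1 / 4)
    {S : Finset ι} {T : Finset κ} (hne : (Sᶜ.disjSum Tᶜ).Nonempty →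
      ∀ p : Nat.Primes, (∫ θ in (0 : ℝ)..1, localWeight p θ α β S T) ≠ 0) :
    jet (mainRest t α β S T) (Sum.elim α β) (Sᶜ.disjSum Tᶜ) =
      chiFactor t α β S T *
      (zetaProd (S.restrict α) (T.restrict β) * zetaProd (-S.restrict α) (-T.restrict β) /
        (zetaProdDagger (S.restrict α) (-S.restrict α) *
          zetaProdDagger (T.restrict β) (-T.restrict β))) *
      arithFactor (-T.restrict β) (-S.restrict α) (S.restrict α) (T.restrict β) *
      ∑ P : Finpartition (Sᶜ.disjSum Tᶜ), ∏ W ∈ P.parts, calH α β S T W := by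
  have h₁ : ∀ i ∈ Sᶜ, ∀ k ∈ S, 1 + α i - α k ∈ {z : ℂ | 1 / 2 < z.re ∧ z ≠ 1} :=
    fun i hi k hk => by
      refine ⟨?_, fun h => ?_⟩
      · have := (hα i).1; have := (hα k).2; simp; linarith
      · have : α i = α k := by linear_combination h
        exact (Finset.mem_compl.1 hi) (hαi this ▸ hk)
  have h₂ : ∀ i ∈ Tᶜ, ∀ k ∈ T, 1 + β i - β k ∈ {z : ℂ | 1 / 2 < z.re ∧ z ≠ 1} :=
    fun i hi k hk => by
      refine ⟨?_, fun h => ?_⟩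
      · have := (hβ i).1; have := (hβ k).2; simp; linarith
      · have : β i = β k := by linear_combination h
        exact (Finset.mem_compl.1 hi) (hβi this ▸ hk)
  have h₃ : ∀ i j, 1 + α i + β j ∈ {z : ℂ | 1 / 2 < z.re ∧ z ≠ 1} := fun i j => by
    have hre : (1 + α i + β j).re = 1 + (α i).re + (β j).re := by simp
    have := (hα i).1; have := (hβ j).1
    refine ⟨by rw [hre]; linarith, fun h => ?_⟩
    rw [h, Complex.one_re] at hre
    linarith
  set U := Sᶜ.disjSum Tᶜ with hU
  set x₀ : ι ⊕ κ → ℂ := Sum.elim α β with hx₀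
  have hA : LogHol U (fun x => swapArith α β S T (freeze U x₀ x)) x₀
      (fun W => ∑' p : Nat.Primes, primeTerm p α β S T W) := by
    refine ⟨?_, (isLogOn_swapArith hα hβ hne).congr (fun X hX => jet_freeze hX _ _)
      fun _ _ _ => rfl⟩
    refine ((hol_swapArith (fun i => (hα i).1) (fun j => (hβ j).1) S T).comp_freeze U x₀).holAt
      ((isOpen_reBall _).preimage (continuous_freeze U x₀)) ?_
    rw [mem_preimage, freeze_self]
    exact mem_reBall_base hα hβ
  have hlog := ((logHol_const U (chiFactor t α β S T *
    frozenConst riemannZeta invZeta α β S T) x₀).mul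
    (logHol_variablePart (invPair_zeta hRH) h₁ h₂ h₃)).mul hA
  have hfr : ∀ x, mainRest t α β S T (freeze U x₀ x) = chiFactor t α β S T *
      frozenConst riemannZeta invZeta α β S T * variablePart riemannZeta invZeta α β S T x *
        swapArith α β S T (freeze U x₀ x) := fun x => by
    unfold mainRest
    rw [chiFactor_freeze t α β S T rfl, offDiagPart_freeze, ← mul_assoc]
  -- Only the variables of the complements are still to be differentiated, so the others may be
  -- frozen. This makes all the remaining factors nonzero except possibly the constant.
  rw [← jet_freeze subset_rfl x₀ (mainRest t α β S T)]
  simp only [hfr]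
  -- The exponential formula: the value at the base point times the sum over set partitions.
  rw [hlog.isLogOn.eq_partitionSum U subset_rfl, jet_empty, freeze_self]
  congr 1
  · rw [mul_assoc (chiFactor t α β S T), hx₀,
      frozenConst_mul_variablePart (invPair_zeta hRH) h₁ h₂ h₃, prod_invZeta_erase T hβi,
      prod_invZeta_erase S hαi, swapArith_base hα hβ]
    have r₁ : zetaProd (-S.restrict α) (-T.restrict β) =
        ∏ j ∈ T, ∏ k ∈ S, riemannZeta (1 + -β j + -α k) := by
      rw [Finset.prod_comm]
      refine (pairProd_restrict riemannZeta S T (-α) (-β)).trans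
        (Finset.prod_congr rfl fun i _ => Finset.prod_congr rfl fun j _ => ?_)
      simp only [Pi.neg_apply]; congr 1; ring
    have r₂ : zetaProd (S.restrict α) (T.restrict β) =
        ∏ i ∈ S, ∏ j ∈ T, riemannZeta (1 + α i + β j) := pairProd_restrict riemannZeta S T α β
    rw [r₁, r₂, div_eq_mul_inv, mul_inv]
    ring
  · refine Finset.sum_congr rfl fun P _ => Finset.prod_congr rfl fun W _ => ?_
    unfold calH
    ring

/-- `J*_{ζ,t}(A;B;∅)`. -/
noncomputable def jStarSum (t : ℝ) (α : ι → ℂ) (β : κ → ℂ) : ℂ :=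
  ∑ S : Finset ι, ∑ T : Finset κ with S.card = T.card,
    chiFactor t α β S T *
      (zetaProd (S.restrict α) (T.restrict β) * zetaProd (-S.restrict α) (-T.restrict β) /
        (zetaProdDagger (S.restrict α) (-S.restrict α) *
          zetaProdDagger (T.restrict β) (-T.restrict β))) *
      arithFactor (-T.restrict β) (-S.restrict α) (S.restrict α) (T.restrict β) *
      ∑ P : Finpartition (Sᶜ.disjSum Tᶜ), ∏ W ∈ P.parts, calH α β S T W

lemma jet_finset_sum {ν τ : Type*} [Fintype ν] [DecidableEq ν] {Ω : Set (ν → ℂ)} (hΩ : IsOpen Ω)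
    {s : Finset τ} {F : τ → (ν → ℂ) → ℂ} (hF : ∀ k ∈ s, Hol Ω (F k)) {x : ν → ℂ} (hx : x ∈ Ω)
    (X : Finset ν) : jet (fun x => ∑ k ∈ s, F k x) x X = ∑ k ∈ s, jet (F k) x X :=
  iterDeriv_finset_sum hΩ hF _ X x hx

lemma jet_ratiosMain (hRH : RiemannHypothesis) (t : ℝ) {α : ι → ℂ} {β : κ → ℂ}
    (hαi : Injective α) (hβi : Injective β)
    (hα : ∀ i, 0 < (α i).re ∧ (α i).re < 1 / 4) (hβ : ∀ j, 0 < (β j).re ∧ (β j).re < 1 / 4)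
    (hne : LocalNonvanishing α β) :
    jet (fun x => ratiosMain t (x ∘ .inl) (x ∘ .inr) α β) (Sum.elim α β) Finset.univ =
      jStarSum t α β := by
  have hx := elim_mem_shiftDomain hαi hβi hα hβ
  have hD := fun S T => hol_diagPart hRH (fun i => (hα i).1) (fun j => (hβ j).1) S T
  have hM := fun S T => (sepHol_mainRest hRH (fun i => (hα i).1) (fun j => (hβ j).1) S T).hol t
  simp only [ratiosMain_eq]
  rw [jet_finset_sum isOpen_shiftDomain (fun S _ => SepHol.finset_sum fun T _ =>
    (hD S T).mul (hM S T)) hx]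
  refine Finset.sum_congr rfl fun S _ => ?_
  rw [jet_finset_sum isOpen_shiftDomain (fun T _ => (hD S T).mul (hM S T)) hx]
  refine Finset.sum_congr rfl fun T hT => ?_
  have hST : S.card = T.card := (Finset.mem_filter.1 hT).2
  rw [jet_diagPart_mul hST ((hD S T).holAt isOpen_shiftDomain hx)
    ((hM S T).holAt isOpen_shiftDomain hx),
    jet_mainRest hRH t hαi hβi hα hβ fun hU p => hne p S T hST hU]

end Jets

/-! ### The mixed derivative of the ratio of zeta functions -/

section Integrand

variable {ι κ : Type} [Fintype ι] [Fintype κ] [DecidableEq ι] [DecidableEq κ]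

/-- The factor with index `k` of the numerator of the ratio of zeta functions. -/
noncomputable def lineZeta (t : ℝ) : ι ⊕ κ → ℂ → ℂ :=
  Sum.elim (fun _ z => riemannZeta (1 / 2 + Complex.I * t + z))
    fun _ z => riemannZeta (1 / 2 - Complex.I * t + z)

lemma ratiosIntegrand_eq (t : ℝ) (α : ι → ℂ) (β : κ → ℂ) (x : ι ⊕ κ → ℂ) :
    ratiosIntegrand t (x ∘ .inl) (x ∘ .inr) α β =
      (∏ k, lineZeta t k (Sum.elim α β k))⁻¹ * ∏ k, lineZeta t k (x k) := by
  rw [Fintype.prod_sum_type, Fintype.prod_sum_type, ratiosIntegrand, div_eq_inv_mul]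
  rfl

lemma lineZeta_ne_zero (hRH : RiemannHypothesis) (t : ℝ) (k : ι ⊕ κ) {z : ℂ} (hz : 0 < z.re) :
    lineZeta t k z ≠ 0 := by
  cases k <;> exact riemannZeta_ne_zero_of_half_lt_re hRH (by simpa using hz)

lemma sepHol_lineZeta (k : ι ⊕ κ) :
    SepHol (shiftDomain ι κ) (fun (t : ℝ) x => lineZeta t k (x k)) := by
  have hre : ∀ {z : ℂ}, z.re ≠ 1 → z ≠ 1 := fun h h' => h (by rw [h']; rfl)
  cases k with
  | inl i =>
    refine SepHol.comp (D := {z | z ≠ 1}) (fun z hz => differentiableAt_riemannZeta hz)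
      (SepHol.add (SepHol.const _ (by fun_prop)) (sepHol_coord (Sum.inl i : ι ⊕ κ))) fun t x hx => hre ?_
    have := (hx.1 (.inl i)).2
    refine ne_of_lt ?_
    simp; linarith
  | inr j =>
    refine SepHol.comp (D := {z | z ≠ 1}) (fun z hz => differentiableAt_riemannZeta hz)
      (SepHol.add (SepHol.const _ (by fun_prop)) (sepHol_coord (Sum.inr j : ι ⊕ κ))) fun t x hx => hre ?_
    have := (hx.1 (.inr j)).2
    refine ne_of_lt ?_
    simp; linarith

lemma sepHol_ratiosIntegrand (hRH : RiemannHypothesis) {α : ι → ℂ} {β : κ → ℂ}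
    (hx : Sum.elim α β ∈ shiftDomain ι κ) :
    SepHol (shiftDomain ι κ) (fun t x => ratiosIntegrand t (x ∘ .inl) (x ∘ .inr) α β) := by
  simp only [ratiosIntegrand_eq]
  refine SepHol.mul (SepHol.const _ (Continuous.inv₀ ?_ fun t => ?_))
    (SepHol.finset_prod fun k _ => sepHol_lineZeta k)
  · exact continuous_finsetProd _ fun k _ => (sepHol_lineZeta k).continuous_param hx
  · exact Finset.prod_ne_zero_iff.2 fun k _ => lineZeta_ne_zero hRH t k (hx.1 k).1

/-- The denominators do not involve x, and each variable occurs in one numerator factor. Every ζ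
becomes ζ' and is divided by ζ at the same point. -/
lemma jet_ratiosIntegrand (t : ℝ) (α : ι → ℂ) (β : κ → ℂ) :
    jet (fun x => ratiosIntegrand t (x ∘ .inl) (x ∘ .inr) α β) (Sum.elim α β) Finset.univ =
      (∏ i, logDeriv riemannZeta (1 / 2 + Complex.I * t + α i)) *
        ∏ j, logDeriv riemannZeta (1 / 2 - Complex.I * t + β j) := by
  simp only [ratiosIntegrand_eq]
  rw [jet_const_mul, jet_prod, if_pos subset_rfl]
  simp only [Finset.mem_univ, if_true]
  rw [inv_mul_eq_div, ← Finset.prod_div_distrib, Fintype.prod_sum_type]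
  congr 1
  · exact Finset.prod_congr rfl fun i _ => by
      simp only [lineZeta, Sum.elim_inl, logDeriv_apply, deriv_comp_const_add]
  · exact Finset.prod_congr rfl fun i _ => by
      simp only [lineZeta, Sum.elim_inr, logDeriv_apply, deriv_comp_const_add]

end Integrand

/-! ### Cauchy's estimate across finitely many removable points -/

section Cauchy

/-- Finitely many singularities of a bounded holomorphic function are removable. -/
lemma exists_extension_of_bounded {D : Set ℂ} (hD : IsOpen D) {M : ℝ} (E : Finset ℂ) :
    ∀ {f : ℂ → ℂ}, DifferentiableOn ℂ f (D \ E) → (∀ z ∈ D \ E, ‖f z‖ ≤ M) →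
      ∃ g : ℂ → ℂ, DifferentiableOn ℂ g D ∧ (∀ z ∈ D, ‖g z‖ ≤ M) ∧ ∀ z ∈ D \ E, g z = f z := by
  induction E using Finset.induction_on with
  | empty => exact fun {f} hf hM => ⟨f, by simpa using hf, by simpa using hM, fun _ _ => rfl⟩
  | insert c E hc ih =>
    intro f hf hM
    have hset : D \ (insert c E : Finset ℂ) = (D \ E) \ {c} := by
      ext z; simp only [Finset.coe_insert, Set.mem_sdiff, mem_insert_iff, mem_singleton_iff]; tauto
    rw [hset] at hf hM ⊢
    have ho : IsOpen (D \ (E : Set ℂ)) := hD.sdiff E.finite_toSet.isClosed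
    by_cases hcD : c ∈ D \ (E : Set ℂ)
    · have hd := Complex.differentiableOn_update_limUnder_of_bddAbove (ho.mem_nhds hcD) hf
        ⟨M, by rintro _ ⟨z, hz, rfl⟩; exact hM z hz⟩
      set g := update f c (limUnder (𝓝[≠] c) f)
      have hgf : ∀ z ∈ (D \ (E : Set ℂ)) \ {c}, g z = f z := fun z hz => update_of_ne hz.2 _ _
      -- The bound extends to the filled-in point by continuity.
      have hgc : ‖g c‖ ≤ M := by
        have hcont : Tendsto (fun z => ‖g z‖) (𝓝[≠] c) (𝓝 ‖g c‖) :=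
          ((hd.differentiableAt (ho.mem_nhds hcD)).continuousAt.norm.tendsto).mono_left
            nhdsWithin_le_nhds
        refine le_of_tendsto hcont ?_
        filter_upwards [mem_nhdsWithin_of_mem_nhds (ho.mem_nhds hcD), self_mem_nhdsWithin]
          with z hz hzc
        rw [hgf z ⟨hz, hzc⟩]
        exact hM z ⟨hz, hzc⟩
      obtain ⟨h, h₁, h₂, h₃⟩ := ih hd fun z hz => by
        by_cases hzc : z = c
        · rw [hzc]; exact hgc
        · rw [hgf z ⟨hz, hzc⟩]; exact hM z ⟨hz, hzc⟩
      exact ⟨h, h₁, h₂, fun z hz => (h₃ z hz.1).trans (hgf z hz)⟩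
    · rw [sdiff_singleton_eq_self hcD] at hf hM ⊢
      exact ih hf hM

lemma norm_deriv_le_of_finite {f : ℂ → ℂ} {z₀ : ℂ} {r M : ℝ} (hr : 0 < r) {E : Set ℂ}
    (hE : E.Finite) (hz₀ : z₀ ∉ E) (hf : DifferentiableOn ℂ f (Metric.ball z₀ r \ E))
    (hM : ∀ z ∈ Metric.ball z₀ r \ E, ‖f z‖ ≤ M) : ‖deriv f z₀‖ ≤ M * (2 / r) := by
  obtain ⟨E, rfl⟩ := hE.exists_finset_coe
  obtain ⟨g, hg, hgM, hgf⟩ := exists_extension_of_bounded Metric.isOpen_ball E hf hM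
  have ho : IsOpen (Metric.ball z₀ r \ (E : Set ℂ)) :=
    Metric.isOpen_ball.sdiff E.finite_toSet.isClosed
  have he : g =ᶠ[𝓝 z₀] f := by
    filter_upwards [ho.mem_nhds ⟨Metric.mem_ball_self hr, hz₀⟩] with z hz using hgf z hz
  rw [← he.deriv_eq]
  -- The estimate is applied on the circle of radius r/2, because nothing is assumed on the boundary
  -- of the disc of radius r. This gives the factor 2/r.
  have hsub : Metric.closedBall z₀ (r / 2) ⊆ Metric.ball z₀ r :=
    Metric.closedBall_subset_ball (by linarith)
  refine (Complex.norm_deriv_le_of_forall_mem_sphere_norm_le (C := M) (half_pos hr) ?_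
    fun z hz => hgM z (hsub (Metric.sphere_subset_closedBall hz))).trans_eq (by field_simp)
  refine (hg.mono ?_).diffContOnCl
  rw [closure_ball z₀ (half_pos hr).ne']
  exact hsub

variable {ν : Type*} [Fintype ν] [DecidableEq ν] {Ω : Set (ν → ℂ)}

/-- Cauchy's estimate for mixed derivatives, for a domain whose intersection with each coordinate
disc misses only finitely many points. -/
lemma norm_iterDeriv_le (hΩ : IsOpen Ω) {F : (ν → ℂ) → ℂ} (hF : Hol Ω F) {x₀ : ν → ℂ} {r M : ℝ}
    (hr : 0 < r)
    (hfin : ∀ x ∈ Ω, (∀ w, x w ∈ Metric.ball (x₀ w) r) → ∀ i,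
      {z ∈ Metric.ball (x₀ i) r | update x i z ∉ Ω}.Finite)
    (hM : ∀ x ∈ Ω, (∀ w, x w ∈ Metric.ball (x₀ w) r) → ‖F x‖ ≤ M) (l : List ν) (hl : l.Nodup) :
    ∀ x ∈ Ω, (∀ w, x w ∈ Metric.ball (x₀ w) r) → (∀ w ∈ l, x w = x₀ w) →
      ‖iterDeriv l Finset.univ F x‖ ≤ M * (2 / r) ^ l.length := by
  induction l with
  | nil => intro x hx hw _; simpa using hM x hx hw
  | cons i l ih =>
    intro x hx hw hxl
    rw [List.nodup_cons] at hl
    rw [iterDeriv_cons_mem (Finset.mem_univ i), List.length_cons, pow_succ, ← mul_assoc]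
    have hxi : x i = x₀ i := hxl i List.mem_cons_self
    have hslice := (hF.iterDeriv hΩ l Finset.univ).differentiableOn_slice () x i
    refine norm_deriv_le_of_finite (E := {z ∈ Metric.ball (x₀ i) r | update x i z ∉ Ω}) hr
      (hfin x hx hw i) ?_ (hslice.mono ?_) ?_
    · exact fun h => h.2 (by simpa using hx)
    · rintro z ⟨hz, hzE⟩
      rw [hxi] at hz
      by_contra h
      exact hzE ⟨hz, h⟩
    · rintro z ⟨hz, hzE⟩
      rw [hxi] at hz
      -- Coordinates already differentiated may be anywhere in their discs; only those still in the
      -- list have to sit at the centre. Since i is not in l, moving x_i does not violate this.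
      refine ih hl.2 _ (by_contra fun h => hzE ⟨hz, h⟩) (fun w => ?_) fun w hwl => ?_
      · by_cases hwi : w = i
        · subst hwi; simpa using hz
        · rw [update_of_ne hwi]; exact hw w
      · have hwi : w ≠ i := fun h => hl.1 (h ▸ hwl)
        rw [update_of_ne hwi]
        exact hxl w (List.mem_cons_of_mem _ hwl)

lemma norm_jet_univ_le (hΩ : IsOpen Ω) {F : (ν → ℂ) → ℂ} (hF : Hol Ω F) {x₀ : ν → ℂ} {r M : ℝ}
    (hr : 0 < r) (hx₀ : x₀ ∈ Ω)
    (hfin : ∀ x ∈ Ω, (∀ w, x w ∈ Metric.ball (x₀ w) r) → ∀ i,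
      {z ∈ Metric.ball (x₀ i) r | update x i z ∉ Ω}.Finite)
    (hM : ∀ x ∈ Ω, (∀ w, x w ∈ Metric.ball (x₀ w) r) → ‖F x‖ ≤ M) :
    ‖jet F x₀ Finset.univ‖ ≤ M * (2 / r) ^ Fintype.card ν := by
  have := norm_iterDeriv_le hΩ hF hr hfin hM Finset.univ.toList (Finset.nodup_toList _) x₀ hx₀
    (fun w => Metric.mem_ball_self hr) fun _ _ => rfl
  rwa [Finset.length_toList] at this

end Cauchy

/-! ### The theorem for empty U -/

section Differentiation

variable {ι κ : Type} [Fintype ι] [Fintype κ] [DecidableEq ι] [DecidableEq κ]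

lemma abs_re_sub_lt_of_mem_ball {z w : ℂ} {r : ℝ} (h : z ∈ Metric.ball w r) :
    |z.re - w.re| < r := by
  rw [Metric.mem_ball, dist_eq_norm] at h
  exact (Complex.sub_re z w ▸ Complex.abs_re_le_norm (z - w)).trans_lt h

lemma abs_im_sub_lt_of_mem_ball {z w : ℂ} {r : ℝ} (h : z ∈ Metric.ball w r) :
    |z.im - w.im| < r := by
  rw [Metric.mem_ball, dist_eq_norm] at h
  exact (Complex.sub_im z w ▸ Complex.abs_im_le_norm (z - w)).trans_lt h

/-- On the disc the conditions on the real parts hold automatically, so a point is excluded only if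
it equals another coordinate of x. -/
lemma finite_notMem_shiftDomain {x₀ : ι ⊕ κ → ℂ} {r : ℝ}
    (h : ∀ k, r ≤ (x₀ k).re ∧ (x₀ k).re ≤ 1 / 4 - r) {x : ι ⊕ κ → ℂ} (hx : x ∈ shiftDomain ι κ)
    (i : ι ⊕ κ) : {z ∈ Metric.ball (x₀ i) r | update x i z ∉ shiftDomain ι κ}.Finite := by
  refine (finite_range x).subset ?_
  rintro z ⟨hz, hzΩ⟩
  by_contra hzr
  refine hzΩ ⟨fun k => ?_, fun a b hab => ?_, fun a b hab => ?_⟩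
  · by_cases hk : k = i
    · subst hk
      have h1 := abs_lt.1 (abs_re_sub_lt_of_mem_ball hz)
      have h2 := h k
      rw [update_self]
      constructor <;> linarith
    · rw [update_of_ne hk]; exact hx.1 k
  · by_contra hne
    simp only [comp_apply, update_apply] at hab
    split_ifs at hab with h1 h2 h3
    · exact hne (Sum.inl.inj (h1.trans h2.symm))
    · exact hzr ⟨_, hab.symm⟩
    · exact hzr ⟨_, hab⟩
    · exact hne (hx.2.1 hab)
  · by_contra hne
    simp only [comp_apply, update_apply] at hab
    split_ifs at hab with h1 h2 h3
    · exact hne (Sum.inr.inj (h1.trans h2.symm))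
    · exact hzr ⟨_, hab.symm⟩
    · exact hzr ⟨_, hab⟩
    · exact hne (hx.2.2 hab)

/-- The mixed derivative of the error in the Ratios Conjecture. -/
lemma jet_ratios_error (hRH : RiemannHypothesis) (a b : ℝ) {α : ι → ℂ} {β : κ → ℂ}
    (hαi : Injective α) (hβi : Injective β)
    (hα : ∀ i, 0 < (α i).re ∧ (α i).re < 1 / 4) (hβ : ∀ j, 0 < (β j).re ∧ (β j).re < 1 / 4)
    (hne : LocalNonvanishing α β) :
    jet (fun x => (∫ t in a..b, ratiosIntegrand t (x ∘ .inl) (x ∘ .inr) α β) -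
      ∫ t in a..b, ratiosMain t (x ∘ .inl) (x ∘ .inr) α β) (Sum.elim α β) Finset.univ =
      (∫ t in a..b, (∏ i, logDeriv riemannZeta (1 / 2 + Complex.I * t + α i)) *
        ∏ j, logDeriv riemannZeta (1 / 2 - Complex.I * t + β j)) -
      ∫ t in a..b, jStarSum t α β := by
  have hx := elim_mem_shiftDomain hαi hβi hα hβ
  have h₁ := sepHol_ratiosIntegrand hRH hx
  have h₂ := sepHol_ratiosMain hRH (fun i => (hα i).1) fun j => (hβ j).1
  have g : Continuous fun q : Unit × ℝ => q.2 := continuous_snd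
  have i₁ := ((h₁.comp_param g).integral isOpen_shiftDomain a b).hol ()
  have i₂ := ((h₂.comp_param g).integral isOpen_shiftDomain a b).hol ()
  have := iterDeriv_sub isOpen_shiftDomain i₁ i₂ Finset.univ.toList Finset.univ _ hx
  refine this.trans (congrArg₂ _ ?_ ?_)
  · refine (jet_integral isOpen_shiftDomain h₁ a b hx Finset.univ).trans ?_
    simp only [jet_ratiosIntegrand]
  · refine (jet_integral isOpen_shiftDomain h₂ a b hx Finset.univ).trans ?_
    simp only [jet_ratiosMain hRH _ hαi hβi hα hβ hne]

lemma hol_ratios_error (hRH : RiemannHypothesis) (a b : ℝ) {α : ι → ℂ} {β : κ → ℂ}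
    (hx : Sum.elim α β ∈ shiftDomain ι κ) :
    Hol (shiftDomain ι κ) (fun x => (∫ t in a..b, ratiosIntegrand t (x ∘ .inl) (x ∘ .inr) α β) -
      ∫ t in a..b, ratiosMain t (x ∘ .inl) (x ∘ .inr) α β) := by
  have h₁ := sepHol_ratiosIntegrand hRH hx
  have h₂ := sepHol_ratiosMain (α := α) (β := β) hRH (fun i => (hx.1 (.inl i)).1)
    fun j => (hx.1 (.inr j)).1
  have g : Continuous fun q : Unit × ℝ => q.2 := continuous_snd
  exact (((h₁.comp_param g).integral isOpen_shiftDomain a b).hol ()).sub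
    (((h₂.comp_param g).integral isOpen_shiftDomain a b).hol ())

/-- The case `U = ∅`, with an error that is uniform up to powers of `log T`. -/
theorem norm_integral_logDeriv_sub_jStarSum_le {ϑ η : ℝ} (hϑ₀ : 0 ≤ ϑ)
    (hRH : RiemannHypothesis) (hRatios : RatiosConjecture ϑ η) (m n : ℕ) {ε c K : ℝ}
    (hε : 0 < ε) (hc : 0 < c) (hK : 0 < K) : ∃ C : ℝ, 0 ≤ C ∧
      ∀ T a b : ℝ, 2 ≤ T → -T ≤ a → b ≤ T → T ^ η ≤ b - a →
      ∀ (α : Fin m → ℂ) (β : Fin n → ℂ), α.Injective → β.Injective →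
        (∀ i, c / Real.log T ≤ (α i).re ∧ (α i).re ≤ 1 / 4 - c ∧ |(α i).im| ≤ K * T ^ ϑ) →
        (∀ j, c / Real.log T ≤ (β j).re ∧ (β j).re ≤ 1 / 4 - c ∧ |(β j).im| ≤ K * T ^ ϑ) →
        LocalNonvanishing α β →
        ‖(∫ t in a..b, (∏ i, logDeriv riemannZeta (1 / 2 + Complex.I * t + α i)) *
            ∏ j, logDeriv riemannZeta (1 / 2 - Complex.I * t + β j)) -
          ∫ t in a..b, jStarSum t α β‖ ≤
          C * Real.log T ^ (m + n) * (b - a) ^ (1 / 2 + ε) := by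
  -- The numerator shifts move by less than c, so their imaginary parts may grow to (K + c) T^ϑ.
  obtain ⟨C, hC⟩ := hRatios m n m n ε c (K + c) hε hc (by linarith)
  refine ⟨|C| * (4 / c) ^ (m + n), by positivity, ?_⟩
  intro T a b hT ha hb hab α β hαi hβi hα hβ hne
  have hlog : 1 / 2 < Real.log T := by
    have := Real.log_two_gt_d9
    have := Real.log_le_log (by norm_num) hT
    linarith
  have hlog0 : 0 < Real.log T := by linarith
  have hTϑ : 1 ≤ T ^ ϑ := Real.one_le_rpow (by linarith) hϑ₀
  have hba : 0 ≤ b - a := (Real.rpow_nonneg (by linarith) η).trans hab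
  -- Half the lower bound for the real parts, so shifts in the discs keep positive real parts. As
  -- log T > 1/2 we have r ≤ c, and they also stay below 1/4.
  set r := c / (2 * Real.log T) with hr
  have hr0 : 0 < r := by positivity
  have hrc : r ≤ c := div_le_self hc.le (by linarith)
  have hrl : c / Real.log T = 2 * r := by rw [hr]; field_simp
  have hα' : ∀ i, 0 < (α i).re ∧ (α i).re < 1 / 4 := fun i =>
    ⟨by have := (hα i).1; linarith, by have := (hα i).2.1; linarith⟩
  have hβ' : ∀ i, 0 < (β i).re ∧ (β i).re < 1 / 4 := fun i =>
    ⟨by have := (hβ i).1; linarith, by have := (hβ i).2.1; linarith⟩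
  have hx := elim_mem_shiftDomain hαi hβi hα' hβ'
  have hb0 : ∀ k, 2 * r ≤ (Sum.elim α β k).re ∧ (Sum.elim α β k).re ≤ 1 / 4 - c ∧
      |(Sum.elim α β k).im| ≤ K * T ^ ϑ := by
    rw [← hrl]
    rintro (i | j)
    exacts [hα i, hβ j]
  have him : ∀ {y : ℝ}, |y| ≤ K * T ^ ϑ → |y| ≤ (K + c) * T ^ ϑ := fun h => by
    nlinarith
  rw [← jet_ratios_error hRH a b hαi hβi hα' hβ' hne]
  refine (norm_jet_univ_le (M := |C| * (b - a) ^ (1 / 2 + ε)) isOpen_shiftDomain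
    (hol_ratios_error hRH a b hx) hr0 hx
    (fun x hx' _ i => finite_notMem_shiftDomain (fun k => ⟨by have := (hb0 k).1; linarith,
      by have := (hb0 k).2.1; linarith⟩) hx' i) fun x hxΩ hxr => ?_).trans_eq ?_
  · have hxk : ∀ k, 0 < (x k).re ∧ (x k).re < 1 / 4 ∧ |(x k).im| ≤ (K + c) * T ^ ϑ := fun k => by
      refine ⟨(hxΩ.1 k).1, (hxΩ.1 k).2, ?_⟩
      have h1 := abs_im_sub_lt_of_mem_ball (hxr k)
      have h2 := (hb0 k).2.2
      have h3 := abs_sub_abs_le_abs_sub (x k).im (Sum.elim α β k).im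
      nlinarith
    refine (hC T a b hT ha hb hab (x ∘ .inl) (x ∘ .inr) α β hxΩ.2.1 hxΩ.2.2 hαi hβi
      (fun i => hxk _) (fun i => hxk _) (fun i => ⟨(hα i).1, (hα' i).2, him (hα i).2.2⟩)
      fun i => ⟨(hβ i).1, (hβ' i).2, him (hβ i).2.2⟩).trans ?_
    exact mul_le_mul_of_nonneg_right (le_abs_self C) (Real.rpow_nonneg hba _)
  · rw [Fintype.card_sum, Fintype.card_fin, Fintype.card_fin, hr]
    -- The factor 2/r = (4/c) log T occurs once for each of the m + n variables.
    rw [show 2 / (c / (2 * Real.log T)) = 4 / c * Real.log T by field_simp; ring, mul_pow]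
    ring

end Differentiation

/-! ### The digamma function in a right half-plane -/

section Digamma

/-- In Euler's integral over [0, n] the factor (1 - x/n)^n is at most exp(-x), so the integral is
dominated by that of the real Gamma function. -/
lemma norm_GammaSeq_le {s : ℂ} (hs : 0 < s.re) {n : ℕ} (hn : n ≠ 0) :
    ‖Complex.GammaSeq s n‖ ≤ Real.Gamma s.re := by
  have hn0 : (0 : ℝ) < n := by positivity
  rw [Complex.GammaSeq_eq_approx_Gamma_integral hs hn, intervalIntegral.integral_of_le hn0.le,
    Real.Gamma_eq_integral hs]
  have hint := Real.GammaIntegral_convergent hs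
  refine (norm_integral_le_of_norm_le
    (hint.mono_set (Ioc_subset_Ioi_self : Ioc (0 : ℝ) n ⊆ Ioi 0)) ?_).trans
    (setIntegral_mono_set hint ?_ (LE.le.eventuallyLE Ioc_subset_Ioi_self))
  · refine (ae_restrict_iff' measurableSet_Ioc).2 (Eventually.of_forall fun x hx => ?_)
    rw [norm_mul, Complex.norm_cpow_eq_rpow_re_of_pos hx.1, Complex.norm_real, Real.norm_eq_abs,
      abs_of_nonneg (pow_nonneg (by rw [sub_nonneg, div_le_one hn0]; exact hx.2) n)]
    simp only [Complex.sub_re, Complex.one_re]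
    exact mul_le_mul_of_nonneg_right (Real.one_sub_div_pow_le_exp_neg hx.2)
      (Real.rpow_nonneg hx.1.le _)
  · refine (ae_restrict_iff' measurableSet_Ioi).2 (Eventually.of_forall fun x hx => ?_)
    exact mul_nonneg (Real.exp_pos _).le (Real.rpow_nonneg (le_of_lt hx) _)

/-- Pointwise limits of uniformly bounded holomorphic functions may be differentiated. -/
lemma tendsto_deriv_of_bounded {f : ℕ → ℂ → ℂ} {g : ℂ → ℂ} {c : ℂ} {R M : ℝ} (hR : 0 < R)
    (hf : ∀ᶠ n in atTop, DifferentiableOn ℂ (f n) (Metric.closedBall c R))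
    (hg : DifferentiableOn ℂ g (Metric.closedBall c R))
    (hM : ∀ᶠ n in atTop, ∀ z ∈ Metric.closedBall c R, ‖f n z‖ ≤ M)
    (h : ∀ z ∈ Metric.closedBall c R, Tendsto (fun n => f n z) atTop (𝓝 (g z))) :
    Tendsto (fun n => deriv (f n) c) atTop (𝓝 (deriv g c)) := by
  have hcm : ∀ θ, circleMap c R θ ∈ Metric.closedBall c R := fun θ =>
    circleMap_mem_closedBall c hR.le θ
  have hint : ∀ {φ : ℂ → ℂ}, DifferentiableOn ℂ φ (Metric.closedBall c R) → deriv φ c =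
      (2 * Real.pi * Complex.I : ℂ)⁻¹ • ∮ z in C(c, R), (z - c)⁻¹ ^ 2 • φ z := fun hφ => by
    have h := hφ.deriv_eq_smul_circleIntegral hR
    simp only [one_div, ← inv_pow] at h
    rw [h, inv_smul_smul₀ Complex.two_pi_I_ne_zero]
  rw [hint hg]
  have he : (fun n => deriv (f n) c) =ᶠ[atTop] fun n =>
      (2 * Real.pi * Complex.I : ℂ)⁻¹ • ∮ z in C(c, R), (z - c)⁻¹ ^ 2 • f n z := by
    filter_upwards [hf] with n hn using hint hn
  rw [tendsto_congr' he]
  refine Tendsto.const_smul ?_ _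
  unfold circleIntegral
  refine intervalIntegral.tendsto_integral_filter_of_dominated_convergence
    (fun _ => R * (R⁻¹ ^ 2 * M)) ?_ ?_ intervalIntegrable_const ?_
  · filter_upwards [hf] with n hn
    refine Continuous.aestronglyMeasurable ?_
    have h1 : Continuous fun θ => f n (circleMap c R θ) :=
      hn.continuousOn.comp_continuous (continuous_circleMap c R) hcm
    have h2 : Continuous fun θ => (circleMap c R θ - c)⁻¹ ^ 2 :=
      (((continuous_circleMap c R).sub continuous_const).inv₀ fun θ => by
        simp [circleMap, hR.ne']).pow 2
    have h3 : Continuous fun θ => deriv (circleMap c R) θ := by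
      simp only [deriv_circleMap]; fun_prop
    exact h3.smul (h2.smul h1)
  · filter_upwards [hM] with n hn
    refine Eventually.of_forall fun θ _ => ?_
    have h1 : ‖circleMap c R θ - c‖ = R := by simp [circleMap, abs_of_pos hR]
    rw [norm_smul, norm_smul, norm_pow, norm_inv, h1, deriv_circleMap, norm_mul, Complex.norm_I, mul_one]
    rw [show ‖circleMap 0 R θ‖ = R by simp [circleMap, abs_of_pos hR]]
    gcongr
    exact hn _ (hcm θ)
  · refine Eventually.of_forall fun θ _ => ?_
    exact ((h _ (hcm θ)).const_smul _).const_smul _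

lemma add_natCast_ne_zero {s : ℂ} (hs : 0 < s.re) (j : ℕ) : s + j ≠ 0 := fun h => by
  have := congrArg Complex.re h
  simp only [Complex.add_re, Complex.natCast_re, Complex.zero_re] at this
  have : (0 : ℝ) ≤ j := Nat.cast_nonneg j
  linarith

lemma hasDerivAt_GammaSeq {s : ℂ} (hs : 0 < s.re) {n : ℕ} (hn : n ≠ 0) :
    HasDerivAt (fun s => Complex.GammaSeq s n)
      (Complex.GammaSeq s n * (Complex.log n - ∑ j ∈ Finset.range (n + 1), (s + j)⁻¹)) s := by
  have hn0 : (n : ℂ) ≠ 0 := by exact_mod_cast hn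
  have hp : ∏ j ∈ Finset.range (n + 1), (s + j) ≠ 0 :=
    Finset.prod_ne_zero_iff.2 fun j _ => add_natCast_ne_zero hs j
  have h1 : HasDerivAt (fun s : ℂ => (n : ℂ) ^ s * n.factorial)
      ((n : ℂ) ^ s * Complex.log n * n.factorial) s := by
    simpa using ((hasDerivAt_id s).const_cpow (Or.inl hn0)).mul_const (n.factorial : ℂ)
  have h2 : HasDerivAt (fun s : ℂ => ∏ j ∈ Finset.range (n + 1), (s + j))
      ((∏ j ∈ Finset.range (n + 1), (s + j)) * ∑ j ∈ Finset.range (n + 1), (s + j)⁻¹) s := by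
    have := HasDerivAt.fun_finsetProd (u := Finset.range (n + 1)) (f := fun (j : ℕ) (s : ℂ) => s + j)
      (f' := fun _ => 1) (x := s) fun j _ => (hasDerivAt_id s).add_const _
    refine this.congr_deriv ?_
    rw [Finset.mul_sum]
    refine Finset.sum_congr rfl fun j hj => ?_
    rw [← Finset.prod_erase_mul _ _ hj, smul_eq_mul, mul_one, mul_assoc,
      mul_inv_cancel₀ (add_natCast_ne_zero hs j), mul_one]
  refine (h1.div h2 hp).congr_deriv ?_
  unfold Complex.GammaSeq
  field_simp

lemma re_pos_of_mem_closedBall {c z : ℂ} (hz : z ∈ Metric.closedBall c (c.re / 2)) :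
    c.re / 2 ≤ z.re ∧ z.re ≤ 3 * c.re / 2 := by
  rw [Metric.mem_closedBall, dist_eq_norm] at hz
  have := abs_le.1 ((Complex.abs_re_le_norm (z - c)).trans hz)
  rw [Complex.sub_re] at this
  constructor <;> linarith [this.1, this.2]

lemma differentiableAt_Gamma_of_re_pos {s : ℂ} (hs : 0 < s.re) :
    DifferentiableAt ℂ Complex.Gamma s :=
  Complex.differentiableAt_Gamma s fun m h => by
    have := congrArg Complex.re h
    simp only [Complex.neg_re, Complex.natCast_re] at this
    have : (0 : ℝ) ≤ m := Nat.cast_nonneg m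
    linarith

/-- This is the logarithmic derivative of Euler's product for Γ. Differentiating the limit is
legitimate because of the bound `norm_GammaSeq_le`, uniform in n on a disc around s. -/
lemma tendsto_digamma {s : ℂ} (hs : 0 < s.re) :
    Tendsto (fun n : ℕ => Complex.log n - ∑ j ∈ Finset.range (n + 1), (s + j)⁻¹) atTop
      (𝓝 (Complex.digamma s)) := by
  have hpos : ∀ z ∈ Metric.closedBall s (s.re / 2), 0 < z.re := fun z hz => by
    have := (re_pos_of_mem_closedBall hz).1; linarith
  obtain ⟨M, hM⟩ : ∃ M, ∀ x ∈ Icc (s.re / 2) (3 * s.re / 2), ‖Real.Gamma x‖ ≤ M := by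
    refine isCompact_Icc.exists_bound_of_continuousOn fun x hx => ?_
    exact (Real.differentiableAt_Gamma fun m h => by
      have : (0 : ℝ) ≤ m := Nat.cast_nonneg m
      have := hx.1
      linarith).continuousAt.continuousWithinAt
  have hd := tendsto_deriv_of_bounded (f := fun n z => Complex.GammaSeq z n) (g := Complex.Gamma)
    (c := s) (R := s.re / 2) (M := M) (by linarith)
    (by
      filter_upwards [eventually_ne_atTop 0] with n hn z hz
      exact (hasDerivAt_GammaSeq (hpos z hz) hn).differentiableAt.differentiableWithinAt)
    (fun z hz => (differentiableAt_Gamma_of_re_pos (hpos z hz)).differentiableWithinAt)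
    (by
      filter_upwards [eventually_ne_atTop 0] with n hn z hz
      refine (norm_GammaSeq_le (hpos z hz) hn).trans ((le_abs_self _).trans ?_)
      exact hM _ (re_pos_of_mem_closedBall hz))
    fun z _ => Complex.GammaSeq_tendsto_Gamma z
  have hΓ : Complex.Gamma s ≠ 0 := Complex.Gamma_ne_zero_of_re_pos hs
  have hs' := Complex.GammaSeq_tendsto_Gamma s
  have hq := hd.div hs' hΓ
  rw [Complex.digamma_def, logDeriv_apply]
  refine hq.congr' ?_
  filter_upwards [eventually_ne_atTop 0, hs'.eventually_ne hΓ] with n hn hne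
  rw [Pi.div_apply, (hasDerivAt_GammaSeq hs hn).deriv, mul_div_cancel_left₀ _ hne]

/-- Telescoping: j + 1 + R ≤ 2(j + R) because R ≥ 1. -/
lemma sum_inv_sq_le {R : ℝ} (hR : 1 ≤ R) (n : ℕ) :
    ∑ j ∈ Finset.range n, ((j + R) ^ 2)⁻¹ ≤ 2 * (R⁻¹ - (n + R)⁻¹) := by
  induction n with
  | zero => simp
  | succ n ih =>
    rw [Finset.sum_range_succ]
    have hn : (0 : ℝ) ≤ n := Nat.cast_nonneg n
    have : ((n + R) ^ 2)⁻¹ ≤ 2 * ((n + R)⁻¹ - ((n + 1 : ℕ) + R)⁻¹) := by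
      rw [Nat.cast_succ, inv_sub_inv (by positivity) (by positivity), ← mul_div_assoc,
        inv_eq_one_div, div_le_div_iff₀ (by positivity) (by positivity)]
      nlinarith
    linarith

lemma inv_normSq_add_natCast_le {w : ℂ} (hw : 1 / 4 ≤ w.re) (j : ℕ) :
    (‖w + j‖ ^ 2)⁻¹ ≤ 32 * ((j + √(1 + w.im ^ 2)) ^ 2)⁻¹ := by
  have hj : (0 : ℝ) ≤ j := Nat.cast_nonneg j
  have hsq : ‖w + j‖ ^ 2 = (w.re + j) ^ 2 + w.im ^ 2 := by
    rw [Complex.sq_norm, Complex.normSq_apply]; simp; ring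
  have hR : √(1 + w.im ^ 2) ^ 2 = 1 + w.im ^ 2 := Real.sq_sqrt (by positivity)
  have hR0 : 0 < √(1 + w.im ^ 2) := Real.sqrt_pos.2 (by positivity)
  rw [hsq, ← div_eq_mul_inv, inv_eq_one_div, div_le_div_iff₀ (by positivity) (by positivity)]
  -- With R² = 1 + (Im w)², (j + R)² ≤ 2j² + 2 + 2(Im w)². On the other side (Re w + j)² ≥ 1/16 +
  -- j², and 32/16 = 2 explains the constant.
  nlinarith [sq_nonneg (j - √(1 + w.im ^ 2))]

lemma sum_inv_normSq_le {w : ℂ} (hw : 1 / 4 ≤ w.re) (n : ℕ) :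
    ∑ j ∈ Finset.range n, (‖w + j‖ ^ 2)⁻¹ ≤ 64 * (√(1 + w.im ^ 2))⁻¹ := by
  have hR : 1 ≤ √(1 + w.im ^ 2) := Real.one_le_sqrt.2 (by nlinarith [sq_nonneg w.im])
  refine (Finset.sum_le_sum fun j _ => inv_normSq_add_natCast_le hw j).trans ?_
  rw [← Finset.mul_sum]
  have h1 := sum_inv_sq_le hR n
  have h2 : 0 ≤ ((n : ℝ) + √(1 + w.im ^ 2))⁻¹ := by positivity
  linarith

/-- The logarithms cancel in the difference of the partial sums. The terms that remain are (w -
v)/((v+j)(w+j)), which the inequality of the two means splits into inverse squares. -/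
lemma norm_digamma_sub_le {v w : ℂ} (hv : 1 / 4 ≤ v.re) (hw : 1 / 4 ≤ w.re) :
    ‖Complex.digamma w - Complex.digamma v‖ ≤
      (32 * (√(1 + v.im ^ 2))⁻¹ + 32 * (√(1 + w.im ^ 2))⁻¹) * ‖w - v‖ := by
  have hv0 : 0 < v.re := by linarith
  have hw0 : 0 < w.re := by linarith
  refine le_of_tendsto ((tendsto_digamma hw0).sub (tendsto_digamma hv0)).norm
    (Eventually.of_forall fun n => ?_)
  rw [sub_sub_sub_cancel_left, ← Finset.sum_sub_distrib]
  have hterm : ∀ j ∈ Finset.range (n + 1), ‖(v + j)⁻¹ - (w + j)⁻¹‖ ≤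
      ((‖v + j‖ ^ 2)⁻¹ + (‖w + j‖ ^ 2)⁻¹) * (‖w - v‖ / 2) := fun j _ => by
    rw [inv_sub_inv (add_natCast_ne_zero hv0 j) (add_natCast_ne_zero hw0 j),
      add_sub_add_right_eq_sub, norm_div, norm_mul, div_eq_mul_inv, mul_inv, mul_comm ‖w - v‖,
      ← inv_pow, ← inv_pow]
    nlinarith [norm_nonneg (w - v), mul_nonneg (norm_nonneg (w - v))
      (sq_nonneg (‖v + j‖⁻¹ - ‖w + j‖⁻¹))]
  refine (norm_sum_le_of_le _ hterm).trans ?_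
  rw [← Finset.sum_mul, Finset.sum_add_distrib]
  have h1 := sum_inv_normSq_le hv (n + 1)
  have h2 := sum_inv_normSq_le hw (n + 1)
  have h3 := norm_nonneg (w - v)
  nlinarith

lemma norm_deriv_digamma_le {w : ℂ} (hw : 1 / 4 < w.re) :
    ‖deriv Complex.digamma w‖ ≤ 96 * (√(1 + w.im ^ 2))⁻¹ := by
  have hR0 : 0 < √(1 + w.im ^ 2) := Real.sqrt_pos.2 (by positivity)
  refine norm_deriv_le_of_lip' (by positivity) ?_
  have hc : Tendsto (fun v : ℂ => (√(1 + v.im ^ 2))⁻¹) (𝓝 w) (𝓝 (√(1 + w.im ^ 2))⁻¹) := by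
    have : ContinuousAt (fun v : ℂ => (√(1 + v.im ^ 2))⁻¹) w :=
      ContinuousAt.inv₀ (by fun_prop) hR0.ne'
    exact this
  -- For v near w the inverse root at v is less than twice that at w, so the constant 32 + 32
  -- becomes 64 + 32 = 96.
  have h2 := hc.eventually_lt_const (show (√(1 + w.im ^ 2))⁻¹ < 2 * (√(1 + w.im ^ 2))⁻¹ by
    have : 0 < (√(1 + w.im ^ 2))⁻¹ := by positivity
    linarith)
  have h3 : ∀ᶠ v : ℂ in 𝓝 w, 1 / 4 < v.re :=
    (isOpen_lt continuous_const Complex.continuous_re).mem_nhds hw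
  filter_upwards [h2, h3] with v hv hvre
  refine (norm_digamma_sub_le hw.le hvre.le).trans
    (mul_le_mul_of_nonneg_right ?_ (norm_nonneg _))
  linarith

end Digamma

/-! ### Size and derivative of χ'/χ -/

section ChiFactor

/-- The function `-χ'/χ` in the critical strip. -/
noncomputable def negLogDerivChi (s : ℂ) : ℂ :=
  -Complex.log (2 * Real.pi) + Complex.digamma (1 - s) -
    Real.pi / 2 * Complex.tan (Real.pi * (1 - s) / 2)

/-- The strip `1/4 < Re s < 3/4`. -/
def quarterStrip : Set ℂ := {s | 1 / 4 < s.re ∧ s.re < 3 / 4}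

lemma isOpen_quarterStrip : IsOpen quarterStrip :=
  (isOpen_lt continuous_const Complex.continuous_re).inter
    (isOpen_lt Complex.continuous_re continuous_const)

lemma convex_quarterStrip : Convex ℝ quarterStrip :=
  (convex_halfSpace_re_gt _).inter (convex_halfSpace_re_lt _)

/-- |cos(x+iy)|² = cos²x + sinh²y. Here cos x ≥ 1 - 2x/π = Re s > 1/4 and sinh²y ≥ y² ≥ (Im s)². -/
lemma normSq_cos_ge {s : ℂ} (hs : s ∈ quarterStrip) :
    (1 + s.im ^ 2) / 16 ≤ ‖Complex.cos (Real.pi * (1 - s) / 2)‖ ^ 2 := by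
  set x := Real.pi * (1 - s.re) / 2 with hx
  set y := -(Real.pi * s.im / 2) with hy
  have hz : Real.pi * (1 - s) / 2 = (x : ℂ) + y * Complex.I := by
    apply Complex.ext <;> simp [hx, hy]
    ring
  have hπ := Real.pi_pos
  have hn : ‖Complex.cos ((x : ℂ) + y * Complex.I)‖ ^ 2 = Real.cos x ^ 2 + Real.sinh y ^ 2 := by
    rw [Complex.cos_add_mul_I, Complex.sq_norm, ← Complex.ofReal_cos, ← Complex.ofReal_sin,
      ← Complex.ofReal_cosh, ← Complex.ofReal_sinh, Complex.normSq_apply]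
    simp only [Complex.sub_re, Complex.mul_re, Complex.ofReal_re, Complex.ofReal_im, Complex.I_re,
      Complex.I_im, Complex.sub_im, Complex.mul_im]
    have h1 := Real.cosh_sq y
    have h2 := Real.sin_sq_add_cos_sq x
    nlinarith
  have hcos : 1 / 4 ≤ Real.cos x := by
    have h := Real.one_sub_mul_le_cos (x := x) (by
      have := hs.2; rw [hx]; apply div_nonneg _ (by norm_num); apply mul_nonneg hπ.le; linarith) (by
      have := hs.1; rw [hx]; nlinarith)
    refine le_trans ?_ h
    rw [hx]
    have : 2 / Real.pi * (Real.pi * (1 - s.re) / 2) = 1 - s.re := by field_simp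
    rw [this]
    linarith [hs.1]
  have hsinh : y ^ 2 ≤ Real.sinh y ^ 2 := by
    rw [← sq_abs y, ← sq_abs (Real.sinh y), Real.abs_sinh]
    exact pow_le_pow_left₀ (abs_nonneg y) (Real.self_le_sinh_iff.2 (abs_nonneg y)) 2
  have hy2 : s.im ^ 2 ≤ y ^ 2 := by
    rw [hy, neg_sq, div_pow, mul_pow, le_div_iff₀ (by norm_num)]
    have h4 : 2 ^ 2 ≤ Real.pi ^ 2 := pow_le_pow_left₀ (by norm_num) Real.two_le_pi 2
    nlinarith [mul_le_mul_of_nonneg_left h4 (sq_nonneg s.im)]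
  rw [hz, hn]
  nlinarith [sq_nonneg s.im]

lemma cos_ne_zero_of_mem {s : ℂ} (hs : s ∈ quarterStrip) :
    Complex.cos (Real.pi * (1 - s) / 2) ≠ 0 := fun h => by
  have := normSq_cos_ge hs
  rw [h, norm_zero] at this
  nlinarith [sq_nonneg s.im]

lemma one_sub_re_pos {s : ℂ} (hs : s ∈ quarterStrip) : 1 / 4 < (1 - s).re := by
  have := hs.2
  simp only [Complex.sub_re, Complex.one_re]; linarith

lemma neg_logDeriv_chi {s : ℂ} (hs : s ∈ quarterStrip) : -logDeriv chi s = negLogDerivChi s := by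
  have hre : 0 < (1 - s).re := by linarith [one_sub_re_pos hs]
  have hΓ : Complex.Gamma (1 - s) ≠ 0 := Complex.Gamma_ne_zero_of_re_pos hre
  have hcos := cos_ne_zero_of_mem hs
  have h2π : (2 * Real.pi : ℂ) ≠ 0 := by
    exact_mod_cast mul_ne_zero two_ne_zero Real.pi_ne_zero
  have hpow : (2 * Real.pi : ℂ) ^ (-(1 - s)) ≠ 0 := by
    rw [Complex.cpow_def_of_ne_zero h2π]; exact Complex.exp_ne_zero _
  have hsub : HasDerivAt (fun s : ℂ => 1 - s) (-1) s := by
    simpa using (hasDerivAt_id s).const_sub 1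
  have d₁ : HasDerivAt (fun s : ℂ => 2 * (2 * Real.pi : ℂ) ^ (-(1 - s)))
      (2 * (2 * Real.pi : ℂ) ^ (-(1 - s)) * Complex.log (2 * Real.pi)) s := by
    have := (hsub.neg.const_cpow (c := (2 * Real.pi : ℂ)) (Or.inl h2π)).const_mul 2
    refine this.congr_deriv ?_
    simp; ring
  have d₂ : HasDerivAt (fun s : ℂ => Complex.Gamma (1 - s))
      (Complex.Gamma (1 - s) * -Complex.digamma (1 - s)) s := by
    have := HasDerivAt.comp (h := fun s : ℂ => 1 - s) s
      (differentiableAt_Gamma_of_re_pos hre).hasDerivAt hsub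
    refine this.congr_deriv ?_
    rw [Complex.digamma_def, logDeriv_apply]
    field_simp
  have d₃ : HasDerivAt (fun s : ℂ => Complex.cos (Real.pi * (1 - s) / 2))
      (Complex.cos (Real.pi * (1 - s) / 2) *
        (Real.pi / 2 * Complex.tan (Real.pi * (1 - s) / 2))) s := by
    have := ((hsub.const_mul (Real.pi : ℂ)).div_const 2).ccos
    refine this.congr_deriv ?_
    rw [Complex.tan_eq_sin_div_cos]
    field_simp
  have d : HasDerivAt chi (chi s * -negLogDerivChi s) s := by
    refine ((d₁.mul d₂).mul d₃).congr_deriv ?_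
    simp only [chi, negLogDerivChi, Pi.mul_apply]
    ring
  have hchi : chi s ≠ 0 := mul_ne_zero (mul_ne_zero (mul_ne_zero two_ne_zero hpow) hΓ) hcos
  rw [logDeriv_apply, d.deriv, mul_div_cancel_left₀ _ hchi, neg_neg]

lemma differentiableAt_digamma {s : ℂ} (hs : 0 < s.re) : DifferentiableAt ℂ Complex.digamma s := by
  have ho : IsOpen {z : ℂ | 0 < z.re} := isOpen_lt continuous_const Complex.continuous_re
  have hd : DifferentiableOn ℂ Complex.Gamma {z : ℂ | 0 < z.re} := fun z hz =>
    (differentiableAt_Gamma_of_re_pos hz).differentiableWithinAt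
  exact ((hd.deriv ho).div hd fun z hz =>
    Complex.Gamma_ne_zero_of_re_pos hz).differentiableAt (ho.mem_nhds hs)

lemma hasDerivAt_negLogDerivChi {s : ℂ} (hs : s ∈ quarterStrip) :
    HasDerivAt negLogDerivChi (-deriv Complex.digamma (1 - s) +
      (Real.pi / 2) ^ 2 / Complex.cos (Real.pi * (1 - s) / 2) ^ 2) s := by
  have hsub : HasDerivAt (fun s : ℂ => 1 - s) (-1) s := by
    simpa using (hasDerivAt_id s).const_sub 1
  have d₁ := HasDerivAt.comp (h := fun s : ℂ => 1 - s) s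
    (differentiableAt_digamma (by linarith [one_sub_re_pos hs])).hasDerivAt hsub
  have d₂ := HasDerivAt.comp (h := fun s : ℂ => (Real.pi : ℂ) * (1 - s) / 2) s
    (Complex.hasDerivAt_tan (cos_ne_zero_of_mem hs)) ((hsub.const_mul (Real.pi : ℂ)).div_const 2)
  refine ((d₁.const_add (-Complex.log (2 * Real.pi))).sub
    (d₂.const_mul (Real.pi / 2 : ℂ))).congr_deriv ?_
  ring

lemma norm_deriv_negLogDerivChi_le {s : ℂ} (hs : s ∈ quarterStrip) :
    ‖deriv negLogDerivChi s‖ ≤ 160 * (√(1 + s.im ^ 2))⁻¹ := by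
  rw [(hasDerivAt_negLogDerivChi hs).deriv]
  have h1 := norm_deriv_digamma_le (one_sub_re_pos hs)
  have him : (1 - s).im ^ 2 = s.im ^ 2 := by simp
  rw [him] at h1
  have hR : 1 ≤ √(1 + s.im ^ 2) := Real.one_le_sqrt.2 (by nlinarith [sq_nonneg s.im])
  have hRsq : √(1 + s.im ^ 2) ^ 2 = 1 + s.im ^ 2 := Real.sq_sqrt (by positivity)
  have hcos := normSq_cos_ge hs
  have hcos0 : 0 < ‖Complex.cos (Real.pi * (1 - s) / 2)‖ := norm_pos_iff.2 (cos_ne_zero_of_mem hs)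
  -- From (π/2)² ≤ 4 and the factor 1/16 for the cosine. Together with 96 from the digamma function
  -- this makes 160.
  have h2 : ‖((Real.pi / 2) ^ 2 / Complex.cos (Real.pi * (1 - s) / 2) ^ 2 : ℂ)‖ ≤
      64 * (√(1 + s.im ^ 2))⁻¹ := by
    rw [norm_div, norm_pow, norm_pow, norm_div, Complex.norm_real, Real.norm_eq_abs,
      abs_of_pos Real.pi_pos, Complex.norm_ofNat, ← div_eq_mul_inv,
      div_le_div_iff₀ (by positivity) (by positivity)]
    have hπ : (Real.pi / 2) ^ 2 ≤ 4 := by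
      have := Real.pi_pos; have := Real.pi_le_four; nlinarith
    nlinarith
  refine (norm_add_le _ _).trans ?_
  rw [norm_neg]
  linarith

/-- `χ'/χ` is of logarithmic size. -/
lemma exists_norm_negLogDerivChi_le : ∃ C : ℝ, 160 ≤ C ∧ ∀ s ∈ quarterStrip,
    ‖negLogDerivChi s‖ ≤ C * (1 + |Real.arsinh s.im|) := by
  refine ⟨‖negLogDerivChi (1 / 2)‖ + 160, by linarith [norm_nonneg (negLogDerivChi (1 / 2))],
    fun s hs => ?_⟩
  have hhalf : (1 / 2 : ℂ) ∈ quarterStrip := by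
    constructor <;> norm_num
  have hre : (s.re : ℂ) ∈ quarterStrip := by simpa [quarterStrip] using hs
  -- The path goes horizontally from 1/2 to Re s, then vertically to s. On the vertical part the
  -- bound for the derivative integrates to 160 arsinh(Im s).
  have h1 : ‖negLogDerivChi s.re - negLogDerivChi (1 / 2)‖ ≤ 160 * ‖(s.re : ℂ) - 1 / 2‖ := by
    refine convex_quarterStrip.norm_image_sub_le_of_norm_deriv_le
      (fun z hz => (hasDerivAt_negLogDerivChi hz).differentiableAt) (fun z hz => ?_) hhalf hre
    refine (norm_deriv_negLogDerivChi_le hz).trans ?_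
    have hR : 1 ≤ √(1 + z.im ^ 2) := Real.one_le_sqrt.2 (by nlinarith [sq_nonneg z.im])
    have := inv_le_one_of_one_le₀ hR
    linarith
  have h2 : ‖(s.re : ℂ) - 1 / 2‖ ≤ 1 := by
    rw [show (s.re : ℂ) - 1 / 2 = ((s.re - 1 / 2 : ℝ) : ℂ) by push_cast; ring, Complex.norm_real,
      Real.norm_eq_abs, abs_le]
    constructor <;> linarith [hs.1, hs.2]
  have hline : ∀ v : ℝ, (s.re : ℂ) + v * Complex.I ∈ quarterStrip := fun v => by
    simpa [quarterStrip] using hs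
  have hder : ∀ v : ℝ, HasDerivAt (fun v : ℝ => negLogDerivChi ((s.re : ℂ) + v * Complex.I))
      (deriv negLogDerivChi ((s.re : ℂ) + v * Complex.I) * Complex.I) v := fun v => by
    have hin : HasDerivAt (fun v : ℝ => (s.re : ℂ) + v * Complex.I) Complex.I v := by
      simpa using ((hasDerivAt_id v).ofReal_comp.mul_const Complex.I).const_add (s.re : ℂ)
    exact ((hasDerivAt_negLogDerivChi (hline v)).differentiableAt.hasDerivAt).comp v hin
  have hcont : Continuous fun v : ℝ =>
      deriv negLogDerivChi ((s.re : ℂ) + v * Complex.I) * Complex.I := by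
    have hd : DifferentiableOn ℂ (deriv negLogDerivChi) quarterStrip :=
      DifferentiableOn.deriv (fun z hz =>
        (hasDerivAt_negLogDerivChi hz).differentiableAt.differentiableWithinAt) isOpen_quarterStrip
    exact (hd.continuousOn.comp_continuous (by fun_prop) hline).mul continuous_const
  have hars : ∀ v : ℝ, HasDerivAt (fun v => 160 * Real.arsinh v) (160 * (√(1 + v ^ 2))⁻¹) v :=
    fun v => (Real.hasDerivAt_arsinh v).const_mul 160
  have hcont' : Continuous fun v : ℝ => 160 * (√(1 + v ^ 2))⁻¹ :=
    continuous_const.mul (Continuous.inv₀ (by fun_prop) fun v => (Real.sqrt_pos.2 (by positivity)).ne')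
  have e1 := intervalIntegral.integral_eq_sub_of_hasDerivAt (a := 0) (b := s.im)
    (fun v _ => hder v) (hcont.intervalIntegrable _ _)
  have e2 := intervalIntegral.integral_eq_sub_of_hasDerivAt (a := 0) (b := s.im)
    (fun v _ => hars v) (hcont'.intervalIntegrable _ _)
  have h3 : ‖negLogDerivChi s - negLogDerivChi s.re‖ ≤ 160 * |Real.arsinh s.im| := by
    have : ‖∫ v in (0 : ℝ)..s.im, deriv negLogDerivChi ((s.re : ℂ) + v * Complex.I) * Complex.I‖ ≤
        |∫ v in (0 : ℝ)..s.im, 160 * (√(1 + v ^ 2))⁻¹| := by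
      refine intervalIntegral.norm_integral_le_abs_of_norm_le (Eventually.of_forall fun v => ?_)
        (hcont'.intervalIntegrable _ _)
      rw [norm_mul, Complex.norm_I, mul_one]
      simpa using norm_deriv_negLogDerivChi_le (hline v)
    rw [e1, e2, Complex.re_add_im] at this
    simpa [abs_mul] using this
  have h4 : ‖negLogDerivChi s‖ ≤ ‖negLogDerivChi s - negLogDerivChi s.re‖ +
      ‖negLogDerivChi s.re - negLogDerivChi (1 / 2)‖ + ‖negLogDerivChi (1 / 2)‖ := by
    refine le_trans ?_ (add_le_add_left (norm_add_le _ _) _)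
    refine le_trans (le_of_eq ?_) (norm_add_le _ _)
    congr 1; ring
  have := norm_nonneg (negLogDerivChi (1 / 2))
  have := abs_nonneg (Real.arsinh s.im)
  nlinarith

end ChiFactor

/-! ### Partial summation and short intervals -/

section PartialSummation

/-- Partial summation. -/
lemma norm_integral_mul_le {f g g' : ℝ → ℂ} {H h : ℝ → ℝ} {a b M N V : ℝ} (hf : Continuous f)
    (hg : ∀ t, HasDerivAt g (g' t) t) (hg' : Continuous g') (hH : ∀ t, HasDerivAt H (h t) t)
    (hh : Continuous h) (hgh : ∀ t, ‖g' t‖ ≤ h t)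
    (hM : ∀ t ∈ Icc a b, ‖∫ u in a..t, f u‖ ≤ M) (hN : ∀ t ∈ Icc a b, ‖g t‖ ≤ N)
    (hV : ∀ t ∈ Icc a b, H t - H a ≤ V) :
    ∀ t ∈ Icc a b, ‖∫ u in a..t, f u * g u‖ ≤ M * (N + V) := by
  intro t ht
  have hM0 : 0 ≤ M := (norm_nonneg _).trans (hM t ht)
  have hF : ∀ u, HasDerivAt (fun u => ∫ v in a..u, f v) (f u) u := fun u =>
    intervalIntegral.integral_hasDerivAt_right (hf.intervalIntegrable _ _)
      (hf.stronglyMeasurableAtFilter _ _) hf.continuousAt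
  have hFc : Continuous fun u => ∫ v in a..u, f v :=
    continuous_iff_continuousAt.2 fun u => (hF u).continuousAt
  -- Integration by parts with the primitive of f that vanishes at a. The function H is a primitive
  -- of the majorant of |g'|, so it measures the variation of g.
  have hparts := intervalIntegral.integral_mul_deriv_eq_deriv_mul (a := a) (b := t)
    (fun u _ => hg u) (fun u _ => hF u) (hg'.intervalIntegrable _ _) (hf.intervalIntegrable _ _)
  simp only [intervalIntegral.integral_same, mul_zero, sub_zero] at hparts
  simp only [mul_comm (f _)]
  rw [hparts]
  have e : ∫ u in a..t, M * h u = M * (H t - H a) := by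
    rw [intervalIntegral.integral_const_mul, intervalIntegral.integral_eq_sub_of_hasDerivAt
      (fun u _ => hH u) (hh.intervalIntegrable _ _)]
  have hI : ‖∫ u in a..t, g' u * ∫ v in a..u, f v‖ ≤ M * V := by
    refine (intervalIntegral.norm_integral_le_of_norm_le ht.1 (g := fun u => M * h u)
      (Eventually.of_forall fun u hu => ?_)
      ((continuous_const.mul hh).intervalIntegrable _ _)).trans ?_
    · rw [norm_mul, mul_comm]
      exact mul_le_mul (hM u ⟨hu.1.le, hu.2.trans ht.2⟩) (hgh u) (norm_nonneg _) hM0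
    · rw [e]
      exact mul_le_mul_of_nonneg_left (hV t ht) hM0
  refine (norm_sub_le _ _).trans ?_
  rw [norm_mul, mul_add, mul_comm ‖g t‖]
  exact add_le_add (mul_le_mul (hM t ht) (hN t ht) (norm_nonneg _) hM0) hI

/-- A bound for the integrals over all long subintervals of `[-T,T]` implies one for the integrals
over the initial segments of such an interval. -/
lemma norm_integral_initial_le {f : ℝ → ℂ} (hf : Continuous f) {T L A e : ℝ} (hL : 0 < L)
    (hLT : L ≤ T) (hA : 0 ≤ A) (he : 0 ≤ e)
    (h : ∀ a b : ℝ, -T ≤ a → b ≤ T → L ≤ b - a → ‖∫ t in a..b, f t‖ ≤ A * (b - a) ^ e)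
    {a b : ℝ} (ha : -T ≤ a) (hb : b ≤ T) (hab : L ≤ b - a) :
    ∀ t ∈ Icc a b, ‖∫ u in a..t, f u‖ ≤ 4 * (A * (2 * (b - a)) ^ e) := by
  intro t ht
  have hE : ∀ {c d : ℝ}, -T ≤ c → d ≤ T → L ≤ d - c → d - c ≤ 2 * (b - a) →
      ‖∫ t in c..d, f t‖ ≤ A * (2 * (b - a)) ^ e := fun hc hd hcd hle =>
    (h _ _ hc hd hcd).trans (mul_le_mul_of_nonneg_left
      (Real.rpow_le_rpow (hL.le.trans hcd) hle he) hA)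
  have h0 : 0 ≤ A * (2 * (b - a)) ^ e :=
    mul_nonneg hA (Real.rpow_nonneg (by linarith) _)
  have hi : ∀ c d : ℝ, IntervalIntegrable f volume c d := fun c d => hf.intervalIntegrable c d
  have hsub : ∀ c d e : ℝ, (∫ t in c..d, f t) = (∫ t in e..d, f t) - ∫ t in e..c, f t := fun c d e =>
    (intervalIntegral.integral_interval_sub_left (hi e d) (hi e c)).symm
  have hsub' : ∀ c d e : ℝ, (∫ t in c..d, f t) = (∫ t in c..e, f t) - ∫ t in d..e, f t :=
    fun c d e => by
      rw [← intervalIntegral.integral_add_adjacent_intervals (hi c d) (hi d e)]; ring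
  by_cases h1 : L ≤ t - a
  · have := hE ha (ht.2.trans hb) h1 (by linarith [ht.2, ht.1])
    linarith
  rw [not_le] at h1
  have hta := ht.1
  by_cases h2 : 0 ≤ a
  -- A short segment is a difference of two long intervals: extended to the left if a ≥ 0, to the
  -- right if t ≤ 0. As L ≤ T this stays within [-T, T], and the lengths remain at most 2(b-a).
  · rw [hsub a t (a - L)]
    have i₁ := hE (c := a - L) (d := t) (by linarith) (ht.2.trans hb) (by linarith) (by linarith)
    have i₂ := hE (c := a - L) (d := a) (by linarith) (by linarith [ht.2]) (by linarith)
      (by linarith)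
    linarith [norm_sub_le (∫ t in (a - L)..t, f t) (∫ t in (a - L)..a, f t)]
  rw [not_le] at h2
  by_cases h3 : t ≤ 0
  · rw [hsub' a t (t + L)]
    have i₁ := hE (c := a) (d := t + L) ha (by linarith) (by linarith) (by linarith)
    have i₂ := hE (c := t) (d := t + L) (by linarith) (by linarith) (by linarith)
      (by linarith)
    linarith [norm_sub_le (∫ t in a..(t + L), f t) (∫ t in t..(t + L), f t)]
  rw [not_le] at h3
  -- If a < 0 < t, neither extension need fit. Cutting at 0 and comparing with L and -L uses four
  -- long intervals, hence the factor 4.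
  rw [← intervalIntegral.integral_add_adjacent_intervals (hi a 0) (hi 0 t), hsub' a 0 L,
    hsub 0 t (-L)]
  have i₁ := hE (c := a) (d := L) ha (by linarith) (by linarith) (by linarith)
  have i₂ := hE (c := 0) (d := L) (by linarith) (by linarith) (by linarith) (by linarith)
  have i₃ := hE (c := -L) (d := t) (by linarith) (ht.2.trans hb) (by linarith) (by linarith)
  have i₄ := hE (c := -L) (d := 0) (by linarith) (by linarith) (by linarith) (by linarith)
  have n₁ := norm_sub_le (∫ t in a..L, f t) (∫ t in (0 : ℝ)..L, f t)
  have n₂ := norm_sub_le (∫ t in (-L)..t, f t) (∫ t in (-L)..(0 : ℝ), f t)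
  have n₃ := norm_add_le ((∫ t in a..L, f t) - ∫ t in (0 : ℝ)..L, f t)
    ((∫ t in (-L)..t, f t) - ∫ t in (-L)..(0 : ℝ), f t)
  linarith

lemma exists_log_pow_le (k : ℕ) {δ : ℝ} (hδ : 0 < δ) : ∃ C : ℝ, 0 ≤ C ∧ ∀ T : ℝ, 1 ≤ T →
    Real.log T ^ k ≤ C * T ^ δ := by
  -- From log T ≤ T^d / d with d = δ/(k+1). The denominator k + 1 avoids division by 0 at k = 0, and
  -- dk ≤ δ.
  refine ⟨((δ / (k + 1))⁻¹) ^ k, by positivity, fun T hT => ?_⟩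
  have hT0 : 0 < T := by linarith
  have hd : 0 < δ / (k + 1) := by positivity
  have h1 : Real.log T ≤ T ^ (δ / (k + 1)) * (δ / (k + 1))⁻¹ := by
    rw [← div_eq_mul_inv]
    exact Real.log_le_rpow_div hT0.le hd
  refine (pow_le_pow_left₀ (Real.log_nonneg hT) h1 k).trans ?_
  rw [mul_pow, mul_comm, ← Real.rpow_natCast (T ^ (δ / (k + 1))), ← Real.rpow_mul hT0.le]
  refine mul_le_mul_of_nonneg_left (Real.rpow_le_rpow_of_exponent_le hT ?_) (by positivity)
  rw [div_mul_eq_mul_div, div_le_iff₀ (by positivity)]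
  nlinarith

end PartialSummation

/-! ### Inserting the factors χ'/χ -/

section ChiOnLine

lemma mem_quarterStrip {μ : ℂ} (hμ : |μ.re| < 1 / 4) (t : ℝ) :
    1 / 2 + Complex.I * t + μ ∈ quarterStrip := by
  have := abs_lt.1 hμ
  constructor <;> simp <;> linarith

lemma im_line (μ : ℂ) (t : ℝ) : (1 / 2 + Complex.I * t + μ : ℂ).im = t + μ.im := by simp

lemma hasDerivAt_negLogDerivChi_line {μ : ℂ} (hμ : |μ.re| < 1 / 4) (t : ℝ) :
    HasDerivAt (fun t : ℝ => negLogDerivChi (1 / 2 + Complex.I * t + μ))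
      (deriv negLogDerivChi (1 / 2 + Complex.I * t + μ) * Complex.I) t := by
  have hin : HasDerivAt (fun t : ℝ => (1 / 2 + Complex.I * t + μ : ℂ)) Complex.I t := by
    simpa using (((hasDerivAt_id t).ofReal_comp.const_mul Complex.I).const_add
      (1 / 2 : ℂ)).add_const μ
  exact ((hasDerivAt_negLogDerivChi (mem_quarterStrip hμ t)).differentiableAt.hasDerivAt).comp t hin

lemma continuous_negLogDerivChi_line {μ : ℂ} (hμ : |μ.re| < 1 / 4) :
    Continuous fun t : ℝ => negLogDerivChi (1 / 2 + Complex.I * t + μ) :=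
  continuous_iff_continuousAt.2 fun t => (hasDerivAt_negLogDerivChi_line hμ t).continuousAt

lemma continuous_deriv_negLogDerivChi_line {μ : ℂ} (hμ : |μ.re| < 1 / 4) :
    Continuous fun t : ℝ => deriv negLogDerivChi (1 / 2 + Complex.I * t + μ) * Complex.I := by
  have hd : DifferentiableOn ℂ (deriv negLogDerivChi) quarterStrip :=
    DifferentiableOn.deriv (fun z hz =>
      (hasDerivAt_negLogDerivChi hz).differentiableAt.differentiableWithinAt) isOpen_quarterStrip
  exact (hd.continuousOn.comp_continuous (by fun_prop) (mem_quarterStrip hμ)).mul continuous_const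

lemma prod_neg_logDeriv_chi {r : ℕ} {μ : Fin r → ℂ} (hμ : ∀ k, |(μ k).re| < 1 / 4) (t : ℝ) :
    ∏ k, (-logDeriv chi (1 / 2 + Complex.I * t + μ k)) =
      ∏ k, negLogDerivChi (1 / 2 + Complex.I * t + μ k) :=
  Finset.prod_congr rfl fun k _ => neg_logDeriv_chi (mem_quarterStrip (hμ k) t)

lemma abs_arsinh_le_log {x X : ℝ} (hx : |x| ≤ X) : |Real.arsinh x| ≤ Real.log (1 + 2 * X) := by
  have hX : 0 ≤ X := (abs_nonneg x).trans hx
  have hlog : Real.arsinh X ≤ Real.log (1 + 2 * X) := by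
    unfold Real.arsinh
    refine Real.log_le_log (by positivity) ?_
    have : √(1 + X ^ 2) ≤ 1 + X := Real.sqrt_le_iff.2 ⟨by linarith, by nlinarith⟩
    linarith
  have h1 := Real.arsinh_le_arsinh.2 (abs_le.1 hx).2
  have h2 := Real.arsinh_le_arsinh.2 (abs_le.1 hx).1
  rw [Real.arsinh_neg] at h2
  exact abs_le.2 ⟨by linarith, by linarith⟩

/-- Partial summation with the factor `-χ'/χ`. -/
lemma norm_integral_mul_negLogDerivChi_le {C : ℝ} (hC : 160 ≤ C)
    (hchi : ∀ s ∈ quarterStrip, ‖negLogDerivChi s‖ ≤ C * (1 + |Real.arsinh s.im|))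
    {f : ℝ → ℂ} (hf : Continuous f) {μ : ℂ} (hμ : |μ.re| < 1 / 4) {a b X M : ℝ}
    (hX : ∀ t ∈ Icc a b, |t + μ.im| ≤ X) (hM : ∀ t ∈ Icc a b, ‖∫ u in a..t, f u‖ ≤ M) :
    ∀ t ∈ Icc a b, ‖∫ u in a..t, f u * negLogDerivChi (1 / 2 + Complex.I * u + μ)‖ ≤
      M * (3 * C * (1 + Real.log (1 + 2 * X))) := by
  intro t ht
  have hM0 : 0 ≤ M := (norm_nonneg _).trans (hM t ht)
  have hX0 : 0 ≤ X := (abs_nonneg _).trans (hX t ht)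
  have hlog : 0 ≤ Real.log (1 + 2 * X) := Real.log_nonneg (by linarith)
  have key := norm_integral_mul_le (H := fun t => 160 * Real.arsinh (t + μ.im))
    (h := fun t => 160 * (√(1 + (t + μ.im) ^ 2))⁻¹) (M := M)
    (N := C * (1 + Real.log (1 + 2 * X))) (V := 160 * (2 * Real.log (1 + 2 * X))) hf
    (hasDerivAt_negLogDerivChi_line hμ) (continuous_deriv_negLogDerivChi_line hμ)
    (fun u => by
      have := ((hasDerivAt_id u).add_const μ.im).arsinh.const_mul 160
      simpa using this)
    (continuous_const.mul (Continuous.inv₀ (by fun_prop) fun v =>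
      (Real.sqrt_pos.2 (by positivity)).ne'))
    (fun u => by
      rw [norm_mul, Complex.norm_I, mul_one, ← im_line]
      exact norm_deriv_negLogDerivChi_le (mem_quarterStrip hμ u))
    hM (fun u hu => by
      refine (hchi _ (mem_quarterStrip hμ u)).trans (mul_le_mul_of_nonneg_left ?_ (by linarith))
      rw [im_line]
      linarith [abs_arsinh_le_log (hX u hu)])
    (fun u hu => by
      have h1 := abs_le.1 (abs_arsinh_le_log (hX u hu))
      have h2 := abs_le.1 (abs_arsinh_le_log (hX a ⟨le_rfl, hu.1.trans hu.2⟩))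
      linarith [h1.2, h2.1]) t ht
  refine key.trans (mul_le_mul_of_nonneg_left ?_ hM0)
  -- With Λ = log(1+2X): C(1+Λ) + 320Λ ≤ 3C(1+Λ), because C ≥ 160.
  nlinarith

/-- One factor is inserted at a time. The bound holds on all initial segments [a, t], which is the
form that the next partial summation requires. -/
lemma norm_integral_mul_prod_negLogDerivChi_le {C : ℝ} (hC : 160 ≤ C)
    (hchi : ∀ s ∈ quarterStrip, ‖negLogDerivChi s‖ ≤ C * (1 + |Real.arsinh s.im|))
    {τ : Type*} (s : Finset τ) {μ : τ → ℂ} (hμ : ∀ k, |(μ k).re| < 1 / 4) {a b X M : ℝ}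
    (hX : ∀ k, ∀ t ∈ Icc a b, |t + (μ k).im| ≤ X) {f : ℝ → ℂ} (hf : Continuous f)
    (hM : ∀ t ∈ Icc a b, ‖∫ u in a..t, f u‖ ≤ M) :
    ∀ t ∈ Icc a b, ‖∫ u in a..t, f u * ∏ k ∈ s, negLogDerivChi (1 / 2 + Complex.I * u + μ k)‖ ≤
      M * (3 * C * (1 + Real.log (1 + 2 * X))) ^ s.card := by
  classical
  induction s using Finset.induction_on with
  | empty => simpa using hM
  | insert k s hk ih =>
    intro t ht
    have hc : Continuous fun u : ℝ =>
        f u * ∏ k ∈ s, negLogDerivChi (1 / 2 + Complex.I * u + μ k) :=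
      hf.mul (continuous_finsetProd _ fun k _ => continuous_negLogDerivChi_line (hμ k))
    have := norm_integral_mul_negLogDerivChi_le hC hchi hc (hμ k) (hX k) ih t ht
    rw [Finset.card_insert_of_notMem hk, pow_succ, ← mul_assoc]
    simp only [Finset.prod_insert hk]
    have e : ∀ u : ℝ, f u * (negLogDerivChi (1 / 2 + Complex.I * u + μ k) *
        ∏ k ∈ s, negLogDerivChi (1 / 2 + Complex.I * u + μ k)) =
        (f u * ∏ k ∈ s, negLogDerivChi (1 / 2 + Complex.I * u + μ k)) *
          negLogDerivChi (1 / 2 + Complex.I * u + μ k) := fun u => by ring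
    simp only [e]
    exact this

end ChiOnLine

/-! ### Continuity of both sides and the final comparison of logarithms -/

section Conclusion

variable {ι κ : Type} [Fintype ι] [Fintype κ] [DecidableEq ι] [DecidableEq κ] {α : ι → ℂ} {β : κ → ℂ}

lemma continuous_prod_logDeriv_zeta (hRH : RiemannHypothesis)
    (hx : Sum.elim α β ∈ shiftDomain ι κ) :
    Continuous fun t : ℝ => (∏ i, logDeriv riemannZeta (1 / 2 + Complex.I * t + α i)) *
      ∏ j, logDeriv riemannZeta (1 / 2 - Complex.I * t + β j) := by
  simp only [← jet_ratiosIntegrand]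
  exact ((sepHol_ratiosIntegrand hRH hx).iterDeriv isOpen_shiftDomain _ _).continuous_param hx

lemma continuous_jStarSum (hx : Sum.elim α β ∈ shiftDomain ι κ) :
    Continuous fun t : ℝ => jStarSum t α β := by
  refine continuous_finsetSum _ fun S _ => continuous_finsetSum _ fun T _ => ?_
  exact (((sepHol_chiFactor S T).continuous_param hx).mul continuous_const |>.mul
    continuous_const).mul continuous_const

lemma jStar_eq {ρ : Type} [Fintype ρ] (t : ℝ) (α : ι → ℂ) (β : κ → ℂ) (μ : ρ → ℂ) :
    jStar t α β μ = jStarSum t α β * ∏ k, (-logDeriv chi (1 / 2 + Complex.I * t + μ k)) := rfl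

lemma continuous_prod_neg_logDeriv_chi {r : ℕ} {μ : Fin r → ℂ} (hμ : ∀ k, |(μ k).re| < 1 / 4) :
    Continuous fun t : ℝ => ∏ k, (-logDeriv chi (1 / 2 + Complex.I * t + μ k)) := by
  simp only [prod_neg_logDeriv_chi hμ]
  exact continuous_finsetProd _ fun k _ => continuous_negLogDerivChi_line (hμ k)

lemma log_one_add_two_mul_le {K T : ℝ} (hK : 0 < K) (hT : 2 ≤ T) :
    1 + Real.log (1 + 2 * ((1 + K) * T)) ≤ (2 * (4 + Real.log (1 + K))) * Real.log T := by
  have hlog : 1 / 2 < Real.log T := by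
    have := Real.log_two_gt_d9
    have := Real.log_le_log (by norm_num) hT
    linarith
  have hK' : 0 ≤ Real.log (1 + K) := Real.log_nonneg (by linarith)
  have h4 : Real.log 4 ≤ 2 := by
    have := Real.log_le_sub_one_of_pos (show (0 : ℝ) < 2 by norm_num)
    rw [show (4 : ℝ) = 2 ^ 2 by norm_num, Real.log_pow]
    push_cast; linarith
  have h : Real.log (1 + 2 * ((1 + K) * T)) ≤ Real.log 4 + Real.log (1 + K) + Real.log T := by
    rw [← Real.log_mul (by norm_num) (by positivity), ← Real.log_mul (by positivity) (by positivity)]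
    refine Real.log_le_log (by positivity) ?_
    nlinarith
  nlinarith

end Conclusion

end

end ZetaRatios

/-! ### The theorem -/

open ZetaRatios in
theorem mainTheorem7 (ϑ η : ℝ) (hϑ₀ : 0 ≤ ϑ) (hϑ₁ : ϑ ≤ 1) (hη₀ : 0 < η) (hη₁ : η ≤ 1)
    (hRH : RiemannHypothesis) (hRatios : RatiosConjecture ϑ η) (m n r : ℕ) :
    (∀ (α : Fin m → ℂ) (β : Fin n → ℂ) (μ : Fin r → ℂ), α.Injective → β.Injective →
      (∀ i, 0 < (α i).re ∧ (α i).re < 1 / 4) → (∀ j, 0 < (β j).re ∧ (β j).re < 1 / 4) →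
      (∀ k, |(μ k).re| < 1 / 4) → LocalNonvanishing α β →
      (∀ (S : Finset (Fin m)) (T : Finset (Fin n)), S.card = T.card →
        Multipliable (fun p : Nat.Primes =>
          arithLocal p (-T.restrict β) (-S.restrict α) (S.restrict α) (T.restrict β)) ∧
        ∀ W ⊆ Sᶜ.disjSum Tᶜ, W.Nonempty →
          Summable (fun p : Nat.Primes => primeTerm p α β S T W)) ∧
      ∀ a b : ℝ, IntervalIntegrable (fun t => jIntegrand t α β μ) MeasureTheory.volume a b ∧
        IntervalIntegrable (fun t => jStar t α β μ) MeasureTheory.volume a b) ∧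
    ∀ ε c K : ℝ, 0 < ε → 0 < c → 0 < K → ∃ C : ℝ,
      ∀ T a b : ℝ, 2 ≤ T → -T ≤ a → b ≤ T → T ^ η ≤ b - a →
      ∀ (α : Fin m → ℂ) (β : Fin n → ℂ) (μ : Fin r → ℂ), α.Injective → β.Injective →
        (∀ i, c / Real.log T ≤ (α i).re ∧ (α i).re ≤ 1 / 4 - c ∧ |(α i).im| ≤ K * T ^ ϑ) →
        (∀ j, c / Real.log T ≤ (β j).re ∧ (β j).re ≤ 1 / 4 - c ∧ |(β j).im| ≤ K * T ^ ϑ) →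
        (∀ k, |(μ k).re| < 1 / 4 ∧ |(μ k).im| ≤ K * T ^ ϑ) → LocalNonvanishing α β →
        ‖(∫ t in a..b, jIntegrand t α β μ) - ∫ t in a..b, jStar t α β μ‖ ≤
          C * (b - a) ^ (1 / 2 + ε) := by
  have hcont : ∀ (α : Fin m → ℂ) (β : Fin n → ℂ) (μ : Fin r → ℂ), α.Injective → β.Injective →
      (∀ i, 0 < (α i).re ∧ (α i).re < 1 / 4) → (∀ j, 0 < (β j).re ∧ (β j).re < 1 / 4) →
      (∀ k, |(μ k).re| < 1 / 4) → Continuous (fun t : ℝ => jIntegrand t α β μ) ∧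
        Continuous fun t : ℝ => jStar t α β μ := fun α β μ hαi hβi hα hβ hμ => by
    have hx := elim_mem_shiftDomain hαi hβi hα hβ
    have hchi := continuous_prod_neg_logDeriv_chi hμ
    exact ⟨(continuous_prod_logDeriv_zeta hRH hx).mul hchi, (continuous_jStarSum hx).mul hchi⟩
  -- A nonempty W makes the union of the complements nonempty, so the nonvanishing hypothesis
  -- applies to S and T.
  refine ⟨fun α β μ hαi hβi hα hβ hμ hne => ⟨fun S T hST => ⟨multipliable_arithLocal_base hα hβ S T,
    fun W hW hW' => (hasSum_primeTerm hα hβ (fun p => hne p S T hST (hW'.mono hW))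
      W hW hW').summable⟩, fun a b => ?_⟩, ?_⟩
  · obtain ⟨h₁, h₂⟩ := hcont α β μ hαi hβi hα hβ hμ
    exact ⟨h₁.intervalIntegrable _ _, h₂.intervalIntegrable _ _⟩
  intro ε c K hε hc hK
  -- Half of ε goes into the Ratios Conjecture, the other half absorbs the powers of log T.
  obtain ⟨C₁, hC₁, hmain⟩ := norm_integral_logDeriv_sub_jStarSum_le hϑ₀ hRH hRatios m n
    (half_pos hε) hc hK
  obtain ⟨C₂, hC₂, hchi⟩ := exists_norm_negLogDerivChi_le
  -- The exponent m + n comes from Cauchy's estimate and r from the factors χ'/χ. With δ = ηε/2, T^δ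
  -- ≤ (b-a)^(ε/2).
  obtain ⟨C₃, hC₃, hlogpow⟩ := exists_log_pow_le (m + n + r) (show 0 < η * (ε / 2) by positivity)
  set D := 3 * C₂ * (2 * (4 + Real.log (1 + K))) with hD
  have hD0 : 0 ≤ D := by
    have : 0 ≤ Real.log (1 + K) := Real.log_nonneg (by linarith)
    positivity
  refine ⟨4 * C₁ * 2 ^ (1 / 2 + ε / 2) * D ^ r * C₃, ?_⟩
  intro T a b hT ha hb hab α β μ hαi hβi hα hβ hμ hne
  have hlog : 0 < Real.log T := Real.log_pos (by linarith)
  have hT0 : 0 < T := by linarith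
  have hL : 0 < T ^ η := Real.rpow_pos_of_pos hT0 _
  have hba : 0 < b - a := hL.trans_le hab
  have hre : ∀ {x : ℝ}, c / Real.log T ≤ x → x ≤ 1 / 4 - c → 0 < x ∧ x < 1 / 4 := fun h h' =>
    ⟨(div_pos hc hlog).trans_le h, by linarith⟩
  have hα' := fun i => hre (hα i).1 (hα i).2.1
  have hβ' := fun i => hre (hβ i).1 (hβ i).2.1
  have hμ' := fun k => (hμ k).1
  have hx := elim_mem_shiftDomain hαi hβi hα' hβ'
  obtain ⟨h₁, h₂⟩ := hcont α β μ hαi hβi hα' hβ' hμ'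
  have c₁ := continuous_prod_logDeriv_zeta hRH hx
  have c₂ := continuous_jStarSum hx
  have c₃ : Continuous fun t : ℝ => (∏ i, logDeriv riemannZeta (1 / 2 + Complex.I * t + α i)) *
      (∏ j, logDeriv riemannZeta (1 / 2 - Complex.I * t + β j)) - jStarSum t α β := c₁.sub c₂
  have hpow : ∀ {θ : ℝ}, θ ≤ 1 → T ^ θ ≤ T := fun h =>
    (Real.rpow_le_rpow_of_exponent_le (by linarith) h).trans_eq (Real.rpow_one T)
  -- The case of empty U is used for every long subinterval of [-T, T] with the same T and shifts,
  -- so that its constant is common to all of them.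
  have hM := norm_integral_initial_le c₃ hL (hpow hη₁)
    (A := C₁ * Real.log T ^ (m + n)) (e := 1 / 2 + ε / 2) (by positivity) (by positivity)
    (fun a' b' ha' hb' hab' => by
      rw [intervalIntegral.integral_sub (c₁.intervalIntegrable _ _) (c₂.intervalIntegrable _ _)]
      exact hmain T a' b' hT ha' hb' hab' α β hαi hβi hα hβ hne) ha hb hab
  have hX : ∀ k, ∀ t ∈ Set.Icc a b, |t + (μ k).im| ≤ (1 + K) * T := fun k t ht => by
    have i₁ : |t| ≤ T := abs_le.2 ⟨ha.trans ht.1, ht.2.trans hb⟩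
    have i₂ := mul_le_mul_of_nonneg_left (hpow hϑ₁) hK.le
    linarith [abs_add_le t (μ k).im, (hμ k).2]
  have key := norm_integral_mul_prod_negLogDerivChi_le hC₂ hchi Finset.univ hμ' hX c₃ hM b
    ⟨by linarith, le_rfl⟩
  rw [← intervalIntegral.integral_sub (h₁.intervalIntegrable _ _) (h₂.intervalIntegrable _ _)]
  have e : ∀ t : ℝ, jIntegrand t α β μ - jStar t α β μ =
      ((∏ i, logDeriv riemannZeta (1 / 2 + Complex.I * t + α i)) *
        (∏ j, logDeriv riemannZeta (1 / 2 - Complex.I * t + β j)) - jStarSum t α β) *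
        ∏ k, negLogDerivChi (1 / 2 + Complex.I * t + μ k) := fun t => by
    rw [jStar_eq, ← prod_neg_logDeriv_chi hμ', sub_mul]
    rfl
  simp only [e]
  refine key.trans ?_
  rw [Finset.card_univ, Fintype.card_fin]
  have hfac : 3 * C₂ * (1 + Real.log (1 + 2 * ((1 + K) * T))) ≤ D * Real.log T := by
    rw [hD, mul_assoc (3 * C₂)]
    exact mul_le_mul_of_nonneg_left (log_one_add_two_mul_le hK hT) (by linarith)
  have hfac0 : 0 ≤ 3 * C₂ * (1 + Real.log (1 + 2 * ((1 + K) * T))) := by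
    have : 0 ≤ Real.log (1 + 2 * ((1 + K) * T)) := Real.log_nonneg (by nlinarith)
    positivity
  have hlp : Real.log T ^ (m + n + r) ≤ C₃ * (b - a) ^ (ε / 2) := by
    refine (hlogpow T (by linarith)).trans (mul_le_mul_of_nonneg_left ?_ hC₃)
    rw [Real.rpow_mul hT0.le]
    exact Real.rpow_le_rpow hL.le hab (by positivity)
  calc _ ≤ 4 * (C₁ * Real.log T ^ (m + n) * (2 * (b - a)) ^ (1 / 2 + ε / 2)) *
        (D * Real.log T) ^ r :=
        mul_le_mul_of_nonneg_left (pow_le_pow_left₀ hfac0 hfac r) (by positivity)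
    _ = 4 * C₁ * 2 ^ (1 / 2 + ε / 2) * D ^ r * (b - a) ^ (1 / 2 + ε / 2) *
        Real.log T ^ (m + n + r) := by
        rw [Real.mul_rpow (by norm_num) hba.le, mul_pow, pow_add _ (m + n)]; ring
    _ ≤ 4 * C₁ * 2 ^ (1 / 2 + ε / 2) * D ^ r * (b - a) ^ (1 / 2 + ε / 2) *
        (C₃ * (b - a) ^ (ε / 2)) := mul_le_mul_of_nonneg_left hlp (by positivity)
    _ = 4 * C₁ * 2 ^ (1 / 2 + ε / 2) * D ^ r * C₃ * (b - a) ^ (1 / 2 + ε) := by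
        rw [show 1 / 2 + ε = (1 / 2 + ε / 2) + ε / 2 by ring, Real.rpow_add hba (1 / 2 + ε / 2)]; ring
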